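/- \textbf{Theorem (Andrews, Cai, Diamondstone, Lempp, Miller).} Let $z\in[0,1]$ be a Martin-L\"of random real, i.e.\ $z\notin\bigcap_m G_m$ for every sequence $(G_m)_{m\in\mathbb N}$ of uniformly effectively open sets of reals (each $G_m$ is the union of a collection of open intervals with rational endpoints that is computably enumerable uniformly in $m$) with Lebesgue measure $\lambda(G_m)\le 2^{-m}$ for all $m$. Let $0.Z$ with $Z=(Z(n))_{n\ge 0}\in\{0,1\}^{\mathbb N}$ be the binary expansion of $z$, so $z=\sum_{n\ge 0}Z(n)2^{-n-1}$. Then the following are equivalent. (i) $z$ is a \emph{dyadic density-one point}: for every effectively closed class $C\subseteq\mathbb R$ (the complement of the union of a computably enumerable collection of open intervals with rational endpoints) with $z\in C$, $$\liminf_{z\in I,\ |I|\to 0}\frac{\lambda(I\cap C)}{|I|}=1,$$ where $I$ ranges over the basic dyadic intervals $[r2^{-n},(r+1)2^{-n}]$, $r\in\mathbb Z$, $n\in\mathbb N$, that contain $z$. (ii) Every left-c.e.\ martingale converges along $Z$: for every function $L$ from the finite binary strings to the nonnegative reals such that $L(\sigma0)+L(\sigma1)=2L(\sigma)$ for all $\sigma$,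 and such that $L(\sigma)$ is a left-c.e.\ real uniformly in $\sigma$ (the set of pairs $(\sigma,q)$ with $q\in\mathbb Q$ and $q<L(\sigma)$ is computably enumerable), the limit $\lim_n L(Z\upharpoonright n)$ exists in $\mathbb R$, where $Z\upharpoonright n$ is the string of the first $n$ bits of $Z$. -/

import Mathlib

open Filter Topology MeasureTheory
open scoped ENNReal

/-- The usual numbering of the rationals: the triple `(a, b, c)` of natural numbers is a code for
the rational number `(a - b) / (c + 1)`. -/
def ratOfCode (p : ℕ × ℕ × ℕ) : ℚ := ((p.1 : ℚ) - (p.2.1 : ℚ)) / ((p.2.2 : ℚ) + 1)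

/-- Every rational number has a code. -/
theorem ratOfCode_surjective : Function.Surjective ratOfCode := by
  intro q
  have hd : (q.den : ℚ) ≠ 0 := by exact_mod_cast q.den_nz
  have h1 : ((q.den - 1 : ℕ) : ℚ) + 1 = (q.den : ℚ) := by
    have : q.den - 1 + 1 = q.den := Nat.succ_pred q.den_nz
    exact_mod_cast this
  refine ⟨(q.num.toNat, (-q.num).toNat, q.den - 1), ?_⟩
  have h2 : ((q.num.toNat : ℤ) : ℚ) - (((-q.num).toNat : ℤ) : ℚ) = (q.num : ℚ) := by
    have : (q.num.toNat : ℤ) - ((-q.num).toNat : ℤ) = q.num := by omega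
    exact_mod_cast this
  simp only [ratOfCode, h1]
  push_cast at h2 ⊢
  have h3 : ((q.num.toNat : ℚ) - ((-q.num).toNat : ℚ)) = (q.num : ℚ) := by
    simpa using h2
  rw [h3]
  exact Rat.num_div_den q

/-- The open interval with rational endpoints coded by `p.1` and `p.2`
(empty when the left endpoint is not below the right one). -/
def ratIoo (p : (ℕ × ℕ × ℕ) × (ℕ × ℕ × ℕ)) : Set ℝ :=
  Set.Ioo (ratOfCode p.1 : ℝ) (ratOfCode p.2 : ℝ)

/-- A sequence of uniformly effectively open (uniformly `Σ⁰₁`) sets of reals: `G m` is the union of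
the rational open intervals that are enumerated, uniformly in `m`, by a single c.e. set. -/
def UniformlyEffectivelyOpen (G : ℕ → Set ℝ) : Prop :=
  ∃ W : ℕ × ((ℕ × ℕ × ℕ) × (ℕ × ℕ × ℕ)) → Prop,
    REPred W ∧ ∀ m, G m = ⋃ p ∈ {p | W (m, p)}, ratIoo p

/-- Effectively closed (`Π⁰₁`) classes of reals: complements of the union of a c.e. collection of
rational open intervals. -/
def EffectivelyClosed (C : Set ℝ) : Prop :=
  ∃ W : (ℕ × ℕ × ℕ) × (ℕ × ℕ × ℕ) → Prop,
    REPred W ∧ Cᶜ = ⋃ p ∈ {p | W p}, ratIoo p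

/-- A Martin-Löf test: uniformly effectively open sets `G m` of Lebesgue measure at most `2⁻ᵐ`. -/
def IsMLTest (G : ℕ → Set ℝ) : Prop :=
  UniformlyEffectivelyOpen G ∧ ∀ m, volume (G m) ≤ (2⁻¹ : ℝ≥0∞) ^ m

/-- A real is Martin-Löf random if it is captured by no Martin-Löf test. -/
def MLRandom (z : ℝ) : Prop :=
  ∀ G : ℕ → Set ℝ, IsMLTest G → z ∉ ⋂ m, G m

/-- The closed basic dyadic interval `[r 2⁻ⁿ, (r + 1) 2⁻ⁿ]`, where `p = (r, n)`. -/
def dyadicInterval (p : ℤ × ℕ) : Set ℝ :=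
  Set.Icc ((p.1 : ℝ) / 2 ^ p.2) (((p.1 : ℝ) + 1) / 2 ^ p.2)

/-- The lower dyadic density of `C` at `z`: the limit inferior of `λ(I ∩ C) / |I|` over the basic
dyadic intervals `I` that contain `z`, as the length `|I|` tends to `0`. -/
noncomputable def lowerDyadicDensity (C : Set ℝ) (z : ℝ) : ℝ≥0∞ :=
  liminf (fun p : ℤ × ℕ => volume (dyadicInterval p ∩ C) / volume (dyadicInterval p))
    (comap (fun p : ℤ × ℕ => (2⁻¹ : ℝ) ^ p.2) (𝓝 0) ⊓ 𝓟 {p | z ∈ dyadicInterval p})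

/-- `z` is a dyadic density-one point if every effectively closed class that contains `z` has lower
dyadic density one at `z`. -/
def DyadicDensityOnePoint (z : ℝ) : Prop :=
  ∀ C : Set ℝ, EffectivelyClosed C → z ∈ C → lowerDyadicDensity C z = 1

/-- A martingale: a function `L` from binary strings to the nonnegative reals with
`L (σ0) + L (σ1) = 2 L (σ)`. -/
def IsMartingale (L : List Bool → ℝ) : Prop :=
  (∀ σ, 0 ≤ L σ) ∧ ∀ σ, L (σ ++ [false]) + L (σ ++ [true]) = 2 * L σ

/-- `L σ` is a left-c.e. real uniformly in `σ`: the relation `q < L σ` between strings `σ` and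
(codes of) rationals `q` is c.e. -/
def LeftCE (L : List Bool → ℝ) : Prop :=
  REPred fun x : List Bool × (ℕ × ℕ × ℕ) => (ratOfCode x.2 : ℝ) < L x.1

/-- The string formed by the first `n` bits of `Z`. -/
def initialSegment (Z : ℕ → Bool) (n : ℕ) : List Bool := (List.range n).map Z

/-- `L` converges along `Z`: the limit of `L (Z ↾ n)` exists in `ℝ`. -/
def ConvergesAlong (L : List Bool → ℝ) (Z : ℕ → Bool) : Prop :=
  ∃ l : ℝ, Tendsto (fun n => L (initialSegment Z n)) atTop (𝓝 l)

/-- `0.Z` is a binary expansion of `z`, that is, `z = ∑ₙ Z(n) 2⁻⁽ⁿ⁺¹⁾`. -/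
def IsBinaryExpansion (Z : ℕ → Bool) (z : ℝ) : Prop :=
  HasSum (fun n => if Z n = true then (2⁻¹ : ℝ) ^ (n + 1) else 0) z

/-! A Martin-Löf random real is not a dyadic rational, so each level has exactly one dyadic cell
containing `z`, and strings, dyadic cells and the intervals around `z` are interchangeable. A
martingale `L` becomes the measure `μ n r = L σ / 2 ^ n` on cells, and `L` along `Z` is the density
`2 ^ n * μ n (dyadicIndex z n)`. Randomness is used only through `MLRandom.exists_avoids`: `z`
avoids some member of a uniformly c.e. sequence of sets of cells whose `k`-th member has measure at
most `c / 2 ^ k`.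

From density to convergence. Approximate `μ` from below by a computable increasing sequence of
measures (`exists_approximatesCells`), and read the `n`-th one at level `n`. Its density is a
computable submartingale, since passing to a later approximation only adds mass. Doob's upcrossing
inequality, turned into a test, makes it converge along `z` (`tendsto_approxDensity`). It remains to
see that the missing density `2 ^ n * (μ - μ_n)` tends to `0` at `z`, and here density one enters
(`tendsto_sub_approxDensity`). Each time the approximation grows on a cell, copy the growth, scaled
by `2⁻ᵏ`, into Lebesgue measure by enumerating an initial part of that cell. The resulting open set
has measure at most `μ 0 0 / 2 ^ k`, so `z` avoids it for some `k`. Add all cells of density above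
`2 ^ B`, which `z` avoids for large `B` by Ville's inequality. Call the union the hole. A cell
outside the hole pays for later growth of its mass with `2 ^ k` times the newly enumerated Lebesgue
measure (`increase_le_hole`). Mass inside the hole is at most `2 * 2 ^ B` times its Lebesgue
measure, because a cell just entering the hole has a parent of density at most `2 ^ B`
(`extSum_hole_le`). So the missing density is at most a constant times the relative measure of the
hole near `z`, up to rounding. Since `z` lies in the complement of the hole, an effectively closed
class, that relative measure tends to `0`.

From convergence to density. For an effectively closed `C` containing `z`, the density of `Cᶜ` on
cells is a left-c.e. martingale, so it has a limit `l` along `z`. If `l` were positive, `Cᶜ` would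
fill more than a fixed fraction `2⁻ᵉ` of every small cell around `z`. A machine that waits until
this fraction of its cell is enumerated, and then moves into the remaining subcells, would move
infinitely often along `z`; but `K` moves happen only on measure `(1 - 2⁻ᵉ) ^ K`, contradicting
randomness (`frequently_small`). Hence `l = 0` and `C` has density one. -/

/-! ### Closure properties of computable functions and predicates -/

section ComputabilityTools

variable {α β : Type*} [Primcodable α] [Primcodable β]

theorem Computable.natAdd {f g : α → ℕ} (hf : Computable f) (hg : Computable g) :
    Computable fun a => f a + g a := Primrec.nat_add.to_comp.comp hf hg

theorem Computable.natSub {f g : α → ℕ} (hf : Computable f) (hg : Computable g) :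
    Computable fun a => f a - g a := Primrec.nat_sub.to_comp.comp hf hg

theorem Computable.natMul {f g : α → ℕ} (hf : Computable f) (hg : Computable g) :
    Computable fun a => f a * g a := Primrec.nat_mul.to_comp.comp hf hg

theorem Computable.natDiv {f g : α → ℕ} (hf : Computable f) (hg : Computable g) :
    Computable fun a => f a / g a := Primrec.nat_div.to_comp.comp hf hg

theorem Computable.natMod {f g : α → ℕ} (hf : Computable f) (hg : Computable g) :
    Computable fun a => f a % g a := Primrec.nat_mod.to_comp.comp hf hg

theorem Computable.natPow {f g : α → ℕ} (hf : Computable f) (hg : Computable g) :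
    Computable fun a => f a ^ g a :=
  (Primrec₂.unpaired'.1 Nat.Primrec.pow).to_comp.comp hf hg

theorem Computable.two_pow {f : α → ℕ} (hf : Computable f) : Computable fun a => 2 ^ f a :=
  (Computable.const 2).natPow hf

theorem Computable.natMax {f g : α → ℕ} (hf : Computable f) (hg : Computable g) :
    Computable fun a => max (f a) (g a) := Primrec.nat_max.to_comp.comp hf hg

theorem Computable.comp_three {β₁ β₂ β₃ σ : Type*} [Primcodable β₁] [Primcodable β₂]
    [Primcodable β₃] [Primcodable σ] {f : β₁ → β₂ → β₃ → σ}
    (hf : Computable fun x : β₁ × β₂ × β₃ => f x.1 x.2.1 x.2.2) {g₁ : α → β₁} {g₂ : α → β₂}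
    {g₃ : α → β₃} (h₁ : Computable g₁) (h₂ : Computable g₂) (h₃ : Computable g₃) :
    Computable fun a => f (g₁ a) (g₂ a) (g₃ a) :=
  hf.comp (h₁.pair (h₂.pair h₃))

theorem Computable.comp_four {β₁ β₂ β₃ β₄ σ : Type*} [Primcodable β₁] [Primcodable β₂]
    [Primcodable β₃] [Primcodable β₄] [Primcodable σ] {f : β₁ → β₂ → β₃ → β₄ → σ}
    (hf : Computable fun x : β₁ × β₂ × β₃ × β₄ => f x.1 x.2.1 x.2.2.1 x.2.2.2) {g₁ : α → β₁}
    {g₂ : α → β₂} {g₃ : α → β₃} {g₄ : α → β₄} (h₁ : Computable g₁) (h₂ : Computable g₂)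
    (h₃ : Computable g₃) (h₄ : Computable g₄) :
    Computable fun a => f (g₁ a) (g₂ a) (g₃ a) (g₄ a) :=
  hf.comp (h₁.pair (h₂.pair (h₃.pair h₄)))

theorem ComputablePred.comp {p : β → Prop} {f : α → β} (hp : ComputablePred p)
    (hf : Computable f) : ComputablePred fun a => p (f a) := by
  obtain ⟨g, hg, rfl⟩ := ComputablePred.computable_iff.1 hp
  exact ComputablePred.computable_iff.2 ⟨_, hg.comp hf, rfl⟩

theorem ComputablePred.nat_le {f g : α → ℕ} (hf : Computable f) (hg : Computable g) :
    ComputablePred fun a => f a ≤ g a :=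
  (Primrec.nat_le.decide.to_comp.comp hf hg).computablePred

theorem ComputablePred.nat_lt {f g : α → ℕ} (hf : Computable f) (hg : Computable g) :
    ComputablePred fun a => f a < g a :=
  (Primrec.nat_lt.decide.to_comp.comp hf hg).computablePred

theorem ComputablePred.eq [DecidableEq β] {f g : α → β} (hf : Computable f) (hg : Computable g) :
    ComputablePred fun a => f a = g a :=
  (Primrec.eq.decide.to_comp.comp hf hg).computablePred

theorem ComputablePred.and {p q : α → Prop} (hp : ComputablePred p) (hq : ComputablePred q) :
    ComputablePred fun a => p a ∧ q a := by
  obtain ⟨f, hf, rfl⟩ := ComputablePred.computable_iff.1 hp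
  obtain ⟨g, hg, rfl⟩ := ComputablePred.computable_iff.1 hq
  exact ComputablePred.computable_iff.2
    ⟨_, Primrec.and.to_comp.comp hf hg, funext fun a => by simp⟩

theorem ComputablePred.or {p q : α → Prop} (hp : ComputablePred p) (hq : ComputablePred q) :
    ComputablePred fun a => p a ∨ q a := by
  obtain ⟨f, hf, rfl⟩ := ComputablePred.computable_iff.1 hp
  obtain ⟨g, hg, rfl⟩ := ComputablePred.computable_iff.1 hq
  exact ComputablePred.computable_iff.2
    ⟨_, Primrec.or.to_comp.comp hf hg, funext fun a => by simp⟩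

theorem Computable.if_then_else {p : α → Prop} [DecidablePred p] {f g : α → β}
    (hp : ComputablePred p) (hf : Computable f) (hg : Computable g) :
    Computable fun a => if p a then f a else g a := by
  simpa [Bool.cond_decide] using hp.decide.cond hf hg

theorem Computable.sum_range {f : α → ℕ → ℕ} {n : α → ℕ}
    (hf : Computable fun x : α × ℕ => f x.1 x.2) (hn : Computable n) :
    Computable fun a => ∑ i ∈ Finset.range (n a), f a i := by
  refine (Computable.nat_rec (h := fun a x => x.2 + f a x.1) hn (Computable.const 0) ?_).of_eq
    fun a => ?_
  · exact (Computable.snd.comp Computable.snd).natAdd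
      (hf.comp (Computable.fst.pair (Computable.fst.comp Computable.snd)))
  · induction n a with
    | zero => rfl
    | succ k ih => rw [Finset.sum_range_succ, ← ih]

theorem Computable.sup_range {f : α → ℕ → ℕ} {n : α → ℕ}
    (hf : Computable fun x : α × ℕ => f x.1 x.2) (hn : Computable n) :
    Computable fun a => (Finset.range (n a)).sup (f a) := by
  refine (Computable.nat_rec (h := fun a x => max x.2 (f a x.1)) hn (Computable.const 0) ?_).of_eq
    fun a => ?_
  · exact (Computable.snd.comp Computable.snd).natMax
      (hf.comp (Computable.fst.pair (Computable.fst.comp Computable.snd)))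
  · induction n a with
    | zero => rfl
    | succ k ih => rw [Finset.range_add_one, Finset.sup_insert, ← ih, sup_comm]

theorem ComputablePred.forall_lt {p : α → ℕ → Prop} {n : α → ℕ}
    (hp : ComputablePred fun x : α × ℕ => p x.1 x.2) (hn : Computable n) :
    ComputablePred fun a => ∀ i < n a, p a i := by
  obtain ⟨f, hf, hpf⟩ := ComputablePred.computable_iff.1 hp
  have hpf' : ∀ a i, p a i ↔ f (a, i) = true := fun a i => by
    have := congrFun hpf (a, i)
    simp only at this
    rw [this]
  refine ComputablePred.computable_iff.2
    ⟨_, Computable.nat_rec (h := fun a x => x.2 && f (a, x.1)) hn (Computable.const true) ?_, ?_⟩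
  · exact Primrec.and.to_comp.comp (Computable.snd.comp Computable.snd)
      (hf.comp (Computable.fst.pair (Computable.fst.comp Computable.snd)))
  · funext a
    refine propext ?_
    induction n a with
    | zero => simp
    | succ k ih =>
      rw [Nat.forall_lt_succ_right, ih, hpf']
      simp

theorem ComputablePred.exists_lt {p : α → ℕ → Prop} {n : α → ℕ}
    (hp : ComputablePred fun x : α × ℕ => p x.1 x.2) (hn : Computable n) :
    ComputablePred fun a => ∃ i < n a, p a i :=
  (hp.not.forall_lt (p := fun a i => ¬ p a i) hn).not.of_eq fun a => by simp

open Classical in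
theorem Computable.card_filter_range {p : α → ℕ → Prop} {n : α → ℕ}
    (hp : ComputablePred fun x : α × ℕ => p x.1 x.2) (hn : Computable n) :
    Computable fun a => ((Finset.range (n a)).filter (p a)).card := by
  simp only [Finset.card_filter]
  exact Computable.sum_range (f := fun a i => if p a i then 1 else 0)
    (Computable.if_then_else hp (Computable.const 1) (Computable.const 0)) hn

/-- Unbounded search for a witness is computable. -/
theorem Computable.exists_choice {p : α → ℕ → Prop}
    (hp : ComputablePred fun x : α × ℕ => p x.1 x.2) (h : ∀ a, ∃ n, p a n) :
    ∃ f : α → ℕ, Computable f ∧ ∀ a, p a (f a) := by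
  classical
  exact ⟨_, Computable.find hp h, fun a => Nat.find_spec (h a)⟩

/-! ### Closure properties of recursively enumerable predicates -/

theorem ComputablePred.re_exists {p : α → ℕ → Prop}
    (hp : ComputablePred fun x : α × ℕ => p x.1 x.2) : REPred fun a => ∃ n, p a n := by
  obtain ⟨f, hf, hpf⟩ := ComputablePred.computable_iff.1 hp
  have hpf' : ∀ a i, p a i ↔ f (a, i) = true := fun a i => by
    have := congrFun hpf (a, i)
    simp only at this
    rw [this]
  have h : Partrec fun a => Nat.rfind fun n => Part.some (f (a, n)) :=
    Partrec.rfind hf.partrec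
  refine h.dom_re.of_eq fun a => ?_
  refine Nat.rfind_dom.trans ?_
  constructor
  · rintro ⟨n, hn, -⟩
    exact ⟨n, (hpf' a n).2 (Part.mem_some_iff.1 hn).symm⟩
  · rintro ⟨n, hn⟩
    exact ⟨n, Part.mem_some_iff.2 ((hpf' a n).1 hn).symm, fun _ => trivial⟩

/-- A recursively enumerable predicate is the union of an increasing sequence of
uniformly computable approximations. -/
theorem REPred.exists_stages {p : α → Prop} (hp : REPred p) :
    ∃ q : α → ℕ → Prop, (ComputablePred fun x : α × ℕ => q x.1 x.2) ∧
      (∀ a s t, s ≤ t → q a s → q a t) ∧ ∀ a, p a ↔ ∃ s, q a s := by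
  obtain ⟨c, hc⟩ := Nat.Partrec.Code.exists_code.1 hp
  -- Stage `s` runs a code for the semidecision procedure with the bound `s`; monotonicity in `s` is
  -- that of `evaln`.
  refine ⟨fun a s => (Nat.Partrec.Code.evaln s c (Encodable.encode a)).isSome = true, ?_, ?_, ?_⟩
  · refine ComputablePred.computable_iff.2 ⟨_, ?_, rfl⟩
    exact Primrec.option_isSome.to_comp.comp (Nat.Partrec.Code.primrec_evaln.to_comp.comp
      ((Computable.snd.pair (Computable.const c)).pair (Computable.encode.comp Computable.fst)))
  · intro a s t hst h
    obtain ⟨x, hx⟩ := Option.isSome_iff_exists.1 h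
    exact Option.isSome_iff_exists.2 ⟨x, Nat.Partrec.Code.evaln_mono hst hx⟩
  · intro a
    have h1 : (Nat.Partrec.Code.eval c (Encodable.encode a)).Dom ↔ p a := by
      rw [hc]
      simp [Part.assert]
    rw [← h1, Part.dom_iff_mem]
    simp only [Nat.Partrec.Code.evaln_complete, Option.isSome_iff_exists, Option.mem_def]
    exact exists_comm

theorem REPred.comp {p : β → Prop} {f : α → β} (hp : REPred p) (hf : Computable f) :
    REPred fun a => p (f a) :=
  Partrec.comp (f := fun b => Part.assert (p b) fun _ => Part.some ()) hp hf

theorem REPred.exists_nat {p : α → ℕ → Prop} (hp : REPred fun x : α × ℕ => p x.1 x.2) :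
    REPred fun a => ∃ n, p a n := by
  obtain ⟨q, hq, -, hpq⟩ := hp.exists_stages
  have h : ComputablePred fun x : α × ℕ => q (x.1, x.2.unpair.1) x.2.unpair.2 :=
    ComputablePred.comp (p := fun x : (α × ℕ) × ℕ => q x.1 x.2) hq
      ((Computable.fst.pair (Computable.fst.comp (Computable.unpair.comp Computable.snd))).pair
        (Computable.snd.comp (Computable.unpair.comp Computable.snd)))
  refine (ComputablePred.re_exists (p := fun a m => q (a, m.unpair.1) m.unpair.2) h).of_eq
    fun a => ?_
  constructor
  · rintro ⟨m, hm⟩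
    exact ⟨m.unpair.1, (hpq (a, m.unpair.1)).2 ⟨_, hm⟩⟩
  · rintro ⟨n, hn⟩
    obtain ⟨s, hs⟩ := (hpq (a, n)).1 hn
    exact ⟨Nat.pair n s, by simpa using hs⟩

theorem REPred.and {p q : α → Prop} (hp : REPred p) (hq : REPred q) :
    REPred fun a => p a ∧ q a := by
  obtain ⟨p', hp', mp, hpp⟩ := hp.exists_stages
  obtain ⟨q', hq', mq, hqq⟩ := hq.exists_stages
  refine (ComputablePred.re_exists (p := fun a s => p' a s ∧ q' a s) (hp'.and hq')).of_eq
    fun a => ?_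
  rw [hpp, hqq]
  constructor
  · rintro ⟨s, h1, h2⟩
    exact ⟨⟨s, h1⟩, ⟨s, h2⟩⟩
  · rintro ⟨⟨s, h1⟩, ⟨t, h2⟩⟩
    exact ⟨max s t, mp _ _ _ (le_max_left _ _) h1, mq _ _ _ (le_max_right _ _) h2⟩

theorem REPred.or {p q : α → Prop} (hp : REPred p) (hq : REPred q) :
    REPred fun a => p a ∨ q a := by
  obtain ⟨p', hp', mp, hpp⟩ := hp.exists_stages
  obtain ⟨q', hq', mq, hqq⟩ := hq.exists_stages
  refine (ComputablePred.re_exists (p := fun a s => p' a s ∨ q' a s) (hp'.or hq')).of_eq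
    fun a => ?_
  rw [hpp, hqq, exists_or]

/-- Witnesses are searched through their natural-number codes; a number that decodes to nothing
counts as a failed test, whence the default `false`. -/
theorem REPred.exists {p : α → β → Prop} (hp : REPred fun x : α × β => p x.1 x.2) :
    REPred fun a => ∃ b, p a b := by
  obtain ⟨q, hq, -, hpq⟩ := hp.exists_stages
  obtain ⟨f, hf, hqf⟩ := ComputablePred.computable_iff.1 hq
  have hqf' : ∀ x s, q x s ↔ f (x, s) = true := fun x i => by
    have := congrFun hqf (x, i)
    simp only at this
    rw [this]
  have h : Computable fun x : (α × ℕ) × ℕ =>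
      ((Encodable.decode (α := β) x.1.2).map fun b => f ((x.1.1, b), x.2)).getD false := by
    refine Computable.option_getD (Computable.option_map
      (Computable.decode.comp (Computable.snd.comp Computable.fst)) ?_) (Computable.const false)
    exact hf.comp (((Computable.fst.comp (Computable.fst.comp Computable.fst)).pair
      Computable.snd).pair (Computable.snd.comp Computable.fst))
  have h2 := ComputablePred.re_exists (p := fun (x : α × ℕ) s =>
    ((Encodable.decode (α := β) x.2).map fun b => f ((x.1, b), s)).getD false = true)
    (ComputablePred.computable_iff.2 ⟨_, h, rfl⟩)
  refine (REPred.exists_nat (p := fun a m => ∃ s,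
    ((Encodable.decode (α := β) m).map fun b => f ((a, b), s)).getD false = true) h2).of_eq
    fun a => ?_
  constructor
  · rintro ⟨m, s, hs⟩
    rcases hd : (Encodable.decode (α := β) m) with _ | b
    · simp [hd] at hs
    · refine ⟨b, (hpq (a, b)).2 ⟨s, (hqf' _ _).2 ?_⟩⟩
      simpa [hd] using hs
  · rintro ⟨b, hb⟩
    obtain ⟨s, hs⟩ := (hpq (a, b)).1 hb
    exact ⟨Encodable.encode b, s, by simpa using (hqf' _ _).1 hs⟩

end ComputabilityTools

/-! ### Sums over the dyadic subcells of a dyadic cell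

The cell `(n, r)` is the dyadic interval from `r / 2 ^ n` to `(r + 1) / 2 ^ n`; its subcells at level
`n + d` are the cells `(n + d, r * 2 ^ d + j)` with `j < 2 ^ d`. -/

section ExtSum

open Classical in
/-- The truth value of a proposition, as a real number. -/
noncomputable def truthValue (p : Prop) : ℝ := if p then 1 else 0

theorem truthValue_of {p : Prop} (h : p) : truthValue p = 1 := if_pos h

theorem truthValue_of_not {p : Prop} (h : ¬ p) : truthValue p = 0 := if_neg h

theorem truthValue_nonneg (p : Prop) : 0 ≤ truthValue p := by
  unfold truthValue
  split_ifs <;> norm_num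

theorem truthValue_mono {p q : Prop} (h : p → q) : truthValue p ≤ truthValue q := by
  by_cases hp : p
  · rw [truthValue_of hp, truthValue_of (h hp)]
  · rw [truthValue_of_not hp]
    exact truthValue_nonneg q

/-- The sum of `f` over the indices of the subcells, `d` levels deeper, of a cell with index `r`. -/
def extSum (f : ℕ → ℝ) (r d : ℕ) : ℝ := ∑ j ∈ Finset.range (2 ^ d), f (r * 2 ^ d + j)

@[simp] theorem extSum_zero (f : ℕ → ℝ) (r : ℕ) : extSum f r 0 = f r := by simp [extSum]

theorem Finset.sum_range_mul_eq {M : Type*} [AddCommMonoid M] (g : ℕ → M) (a b : ℕ) :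
    ∑ x ∈ Finset.range (a * b), g x =
      ∑ i ∈ Finset.range a, ∑ j ∈ Finset.range b, g (i * b + j) := by
  induction a with
  | zero => simp
  | succ k ih => rw [Nat.succ_mul, Finset.sum_range_add, ih, Finset.sum_range_succ]

theorem extSum_add (f : ℕ → ℝ) (r d e : ℕ) :
    extSum f r (d + e) = extSum (fun i => extSum f i e) r d := by
  unfold extSum
  rw [pow_add, Finset.sum_range_mul_eq (fun j => f (r * (2 ^ d * 2 ^ e) + j))]
  refine Finset.sum_congr rfl fun i _ => Finset.sum_congr rfl fun j _ => ?_
  congr 1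
  ring

theorem extSum_one (f : ℕ → ℝ) (r : ℕ) : extSum f r 1 = f (2 * r) + f (2 * r + 1) := by
  simp [extSum, Finset.sum_range_succ, mul_comm]

theorem extSum_succ (f : ℕ → ℝ) (r d : ℕ) :
    extSum f r (d + 1) = extSum (fun i => f (2 * i) + f (2 * i + 1)) r d := by
  rw [extSum_add]
  simp only [extSum_one]

theorem mul_pow_add_div {r d j : ℕ} (hj : j < 2 ^ d) : (r * 2 ^ d + j) / 2 ^ d = r := by
  rw [mul_comm, Nat.mul_add_div (by positivity), Nat.div_eq_of_lt hj, add_zero]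

theorem extSum_le_extSum {f g : ℕ → ℝ} {r d : ℕ} (h : ∀ x, x / 2 ^ d = r → f x ≤ g x) :
    extSum f r d ≤ extSum g r d :=
  Finset.sum_le_sum fun _ hj => h _ (mul_pow_add_div (Finset.mem_range.1 hj))

theorem extSum_congr {f g : ℕ → ℝ} {r d : ℕ} (h : ∀ x, x / 2 ^ d = r → f x = g x) :
    extSum f r d = extSum g r d :=
  Finset.sum_congr rfl fun _ hj => h _ (mul_pow_add_div (Finset.mem_range.1 hj))

theorem extSum_const (c : ℝ) (r d : ℕ) : extSum (fun _ => c) r d = 2 ^ d * c := by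
  simp [extSum]

theorem extSum_fun_add (f g : ℕ → ℝ) (r d : ℕ) :
    extSum (fun x => f x + g x) r d = extSum f r d + extSum g r d := Finset.sum_add_distrib

theorem extSum_fun_sub (f g : ℕ → ℝ) (r d : ℕ) :
    extSum (fun x => f x - g x) r d = extSum f r d - extSum g r d := Finset.sum_sub_distrib _ _

theorem extSum_mul_left (c : ℝ) (f : ℕ → ℝ) (r d : ℕ) :
    extSum (fun x => c * f x) r d = c * extSum f r d := (Finset.mul_sum _ _ _).symm

theorem extSum_mul_right (c : ℝ) (f : ℕ → ℝ) (r d : ℕ) :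
    extSum (fun x => f x * c) r d = extSum f r d * c := (Finset.sum_mul _ _ _).symm

theorem extSum_nonneg {f : ℕ → ℝ} (h : ∀ x, 0 ≤ f x) (r d : ℕ) : 0 ≤ extSum f r d :=
  Finset.sum_nonneg fun _ _ => h _

theorem div_two_pow_div (x a b : ℕ) : x / 2 ^ a / 2 ^ b = x / 2 ^ (a + b) := by
  rw [Nat.div_div_eq_div_mul, pow_add]

end ExtSum

/-! ### Dyadic cells -/

section Cells

/-- The index of the dyadic cell of level `n` that contains `z`. -/
noncomputable def dyadicIndex (z : ℝ) (n : ℕ) : ℕ := ⌊z * 2 ^ n⌋₊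

/-- The open dyadic cell of level `n` and index `r`. -/
def openCell (n r : ℕ) : Set ℝ := Set.Ioo ((r : ℝ) / 2 ^ n) (((r : ℝ) + 1) / 2 ^ n)

/-- The dyadic rationals with nonnegative numerator. -/
def dyadicRationals : Set ℝ := Set.range fun p : ℕ × ℕ => (p.2 : ℝ) / 2 ^ p.1

theorem countable_dyadicRationals : dyadicRationals.Countable := Set.countable_range _

theorem dyadicIndex_div (z : ℝ) {n N : ℕ} (h : n ≤ N) :
    dyadicIndex z N / 2 ^ (N - n) = dyadicIndex z n := by
  unfold dyadicIndex
  have h1 : z * 2 ^ n = z * 2 ^ N / ((2 ^ (N - n) : ℕ) : ℝ) := by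
    rw [eq_div_iff (by positivity)]
    push_cast
    rw [mul_assoc, ← pow_add]
    congr 2
    omega
  rw [h1, Nat.floor_div_natCast]

/-- Floors describe half-open cells. Off the dyadic rationals no left endpoint is hit, so the open
cells serve equally well. -/
theorem mem_openCell_iff {y : ℝ} (h0 : 0 ≤ y) (hy : y ∉ dyadicRationals) (n r : ℕ) :
    y ∈ openCell n r ↔ r = dyadicIndex y n := by
  have hp : (0 : ℝ) < 2 ^ n := by positivity
  have hne : ∀ k : ℕ, (k : ℝ) ≠ y * 2 ^ n := fun k hk => hy ⟨(n, k), by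
    simp only [hk]; field_simp⟩
  unfold openCell dyadicIndex
  rw [Set.mem_Ioo, div_lt_iff₀ hp, lt_div_iff₀ hp, eq_comm, Nat.floor_eq_iff (by positivity)]
  exact and_congr_left fun _ => ⟨le_of_lt, fun h => lt_of_le_of_ne h (hne r)⟩

theorem openCell_subset (n d x : ℕ) : openCell (n + d) x ⊆ openCell n (x / 2 ^ d) := by
  have hp : (0 : ℝ) < 2 ^ n := by positivity
  have hd : (0 : ℝ) < 2 ^ d := by positivity
  refine Set.Ioo_subset_Ioo ?_ ?_
  · rw [pow_add, div_le_div_iff₀ hp (by positivity)]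
    have : ((x / 2 ^ d : ℕ) : ℝ) * 2 ^ d ≤ x := by
      exact_mod_cast Nat.div_mul_le_self x (2 ^ d)
    nlinarith
  · rw [pow_add, div_le_div_iff₀ (by positivity) hp]
    have : (x : ℝ) + 1 ≤ (((x / 2 ^ d : ℕ) : ℝ) + 1) * 2 ^ d := by
      exact_mod_cast (Nat.lt_mul_of_div_lt (Nat.lt_succ_self _) (by positivity) : x < _)
    nlinarith

theorem volume_openCell (n r : ℕ) : volume (openCell n r) = ENNReal.ofReal ((2 ^ n)⁻¹) := by
  rw [openCell, Real.volume_Ioo]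
  congr 1
  field_simp
  ring

theorem disjoint_openCell {n r s : ℕ} (h : r ≠ s) : Disjoint (openCell n r) (openCell n s) := by
  have hp : (0 : ℝ) < 2 ^ n := by positivity
  rw [Set.disjoint_left]
  rintro y ⟨h1, h2⟩ ⟨h3, h4⟩
  rw [div_lt_iff₀ hp] at h1 h3
  rw [lt_div_iff₀ hp] at h2 h4
  have h5 : (r : ℝ) < s + 1 := h1.trans h4
  have h6 : (s : ℝ) < r + 1 := h3.trans h2
  norm_cast at h5 h6
  omega

open Classical in
theorem volume_biUnion_openCell (p : ℕ → Prop) (n r d : ℕ) :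
    volume (⋃ x ∈ {x | x / 2 ^ d = r ∧ p x}, openCell (n + d) x) =
      ENNReal.ofReal (extSum (fun x => truthValue (p x)) r d * (2 ^ (n + d))⁻¹) := by
  have h1 : {x | x / 2 ^ d = r ∧ p x} =
      (((Finset.range (2 ^ d)).filter fun j => p (r * 2 ^ d + j)).image fun j => r * 2 ^ d + j :
        Finset ℕ) := by
    ext x
    simp only [Set.mem_ofPred_eq, Finset.coe_image, Finset.coe_filter, Finset.mem_range,
      Set.mem_image]
    constructor
    · rintro ⟨h, hx⟩
      have h2 : r * 2 ^ d + x % 2 ^ d = x := by rw [← h]; exact Nat.div_add_mod' x (2 ^ d)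
      exact ⟨x % 2 ^ d, ⟨Nat.mod_lt _ (by positivity), by rwa [h2]⟩, h2⟩
    · rintro ⟨j, ⟨hj, hx⟩, rfl⟩
      exact ⟨mul_pow_add_div hj, hx⟩
  rw [h1]
  simp only [Finset.mem_coe]
  rw [measure_biUnion_finset (fun a _ b _ hab => disjoint_openCell hab)
    (fun _ _ => measurableSet_Ioo)]
  simp only [volume_openCell, Finset.sum_const]
  rw [Finset.card_image_of_injective _ (add_right_injective _), extSum]
  simp only [truthValue]
  rw [Finset.sum_boole, nsmul_eq_mul, ENNReal.ofReal_mul (by positivity), ENNReal.ofReal_natCast]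

end Cells

/-! ### Martin-Löf tests given by dyadic cells -/

section Tests

theorem ratOfCode_cast (a b c : ℕ) :
    ((ratOfCode (a, b, c) : ℚ) : ℝ) = ((a : ℝ) - b) / ((c : ℝ) + 1) := by
  simp [ratOfCode]

/-- A code of the open dyadic cell of level `n` and index `r` as a rational interval. -/
def cellCode (n r : ℕ) : (ℕ × ℕ × ℕ) × (ℕ × ℕ × ℕ) := ((r, 0, 2 ^ n - 1), (r + 1, 0, 2 ^ n - 1))

theorem ratIoo_cellCode (n r : ℕ) : ratIoo (cellCode n r) = openCell n r := by
  have h : ((2 ^ n - 1 : ℕ) : ℝ) + 1 = 2 ^ n := by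
    have : 2 ^ n - 1 + 1 = 2 ^ n := Nat.sub_add_cancel (Nat.succ_le_of_lt (by positivity))
    exact_mod_cast this
  simp only [ratIoo, cellCode, openCell, ratOfCode_cast, h]
  simp

theorem Computable.cellCode {α : Type*} [Primcodable α] {n r : α → ℕ} (hn : Computable n)
    (hr : Computable r) : Computable fun a => cellCode (n a) (r a) := by
  have h : Computable fun a => 2 ^ n a - 1 := hn.two_pow.natSub (.const 1)
  exact (hr.pair ((Computable.const 0).pair h)).pair
    ((hr.natAdd (.const 1)).pair ((Computable.const 0).pair h))

/-- A dyadic rational is captured by the test formed of single intervals shrinking around it. -/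
theorem MLRandom.notMem_dyadicRationals {z : ℝ} (hz : MLRandom z) : z ∉ dyadicRationals := by
  rintro ⟨⟨n, r⟩, rfl⟩
  let D : ℕ → ℕ := fun m => 2 ^ n * 2 ^ (m + 1) - 1
  -- With `D m + 1 = 2 ^ n * 2 ^ (m + 1)` the interval has radius `1 / (D m + 1)`, hence length at
  -- most `2⁻ᵐ`.
  let code : ℕ → (ℕ × ℕ × ℕ) × (ℕ × ℕ × ℕ) := fun m =>
    ((r * 2 ^ (m + 1), 1, D m), (r * 2 ^ (m + 1) + 1, 0, D m))
  have hD : ∀ m, (D m : ℝ) + 1 = 2 ^ n * 2 ^ (m + 1) := fun m => by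
    have : 2 ^ n * 2 ^ (m + 1) - 1 + 1 = 2 ^ n * 2 ^ (m + 1) := Nat.sub_add_cancel (Nat.succ_le_of_lt (by positivity))
    exact_mod_cast this
  have hcode : Computable code := by
    have h1 : Computable fun m => r * 2 ^ (m + 1) :=
      (Computable.const r).natMul (Computable.id.natAdd (.const 1)).two_pow
    have h2 : Computable D := ((Computable.const (2 ^ n)).natMul
      (Computable.id.natAdd (.const 1)).two_pow).natSub (.const 1)
    exact (h1.pair ((Computable.const 1).pair h2)).pair
      ((h1.natAdd (.const 1)).pair ((Computable.const 0).pair h2))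
  have hI : ∀ m, ratIoo (code m) = Set.Ioo ((r : ℝ) / 2 ^ n - (2 ^ n * 2 ^ (m + 1))⁻¹)
      ((r : ℝ) / 2 ^ n + (2 ^ n * 2 ^ (m + 1))⁻¹) := fun m => by
    simp only [ratIoo, code, ratOfCode_cast, hD]
    congr 1
    · push_cast
      field_simp
    · push_cast
      field_simp
      ring
  refine hz (fun m => ratIoo (code m)) ⟨⟨fun x => x.2 = code x.1, ?_, ?_⟩, ?_⟩ ?_
  · exact (ComputablePred.eq Computable.snd (hcode.comp Computable.fst)).to_re
  · intro m
    simp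
  · intro m
    simp only [hI]
    rw [Real.volume_Ioo, ← ENNReal.ofReal_ofNat, ← ENNReal.ofReal_inv_of_pos (by norm_num),
      ← ENNReal.ofReal_pow (by norm_num)]
    refine ENNReal.ofReal_le_ofReal ?_
    have h1 : (1 : ℝ) ≤ 2 ^ n := one_le_pow₀ (by norm_num)
    have h2 : (0 : ℝ) < 2 ^ m := by positivity
    have h3 : (r : ℝ) / 2 ^ n + (2 ^ n * 2 ^ (m + 1))⁻¹ - (r / 2 ^ n - (2 ^ n * 2 ^ (m + 1))⁻¹) =
      (2 ^ n * 2 ^ m)⁻¹ := by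
      field_simp
      ring
    rw [h3, inv_pow]
    exact inv_anti₀ h2 (by nlinarith)
  · refine Set.mem_iInter.2 fun m => ?_
    rw [hI]
    have : (0 : ℝ) < (2 ^ n * 2 ^ (m + 1))⁻¹ := by positivity
    exact ⟨by simp only; linarith, by simp only; linarith⟩

theorem dyadicIndex_lt {z : ℝ} (h0 : 0 ≤ z) (h1 : z < 1) (n : ℕ) : dyadicIndex z n < 2 ^ n := by
  rw [dyadicIndex, Nat.floor_lt (by positivity)]
  push_cast
  have : (0 : ℝ) < 2 ^ n := by positivity
  nlinarith

/-- The union of cells that cover at most the fraction `c` of every level has measure at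
most `c`. -/
theorem volume_iUnion_openCell_le (W : ℕ → ℕ → Prop) (c : ℝ)
    (h : ∀ N, extSum (fun x => truthValue (∃ n ≤ N, W n (x / 2 ^ (N - n)))) 0 N ≤ c * 2 ^ N) :
    volume (⋃ n, ⋃ r, ⋃ (_ : r < 2 ^ n ∧ W n r), openCell n r) ≤ ENNReal.ofReal c := by
  let A : ℕ → Set ℝ := fun N =>
    ⋃ x ∈ {x | x / 2 ^ N = 0 ∧ ∃ n ≤ N, W n (x / 2 ^ (N - n))}, openCell (0 + N) x
  have hA : ∀ N, volume (A N) ≤ ENNReal.ofReal c := fun N => by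
    rw [volume_biUnion_openCell]
    refine ENNReal.ofReal_le_ofReal ?_
    rw [zero_add, ← div_eq_mul_inv, div_le_iff₀ (by positivity)]
    exact h N
  -- The cells of level at most `N` are refined to cells of level `N`, losing only dyadic rationals.
  -- These truncations increase to the whole union, so continuity of measure from below gives the
  -- bound.
  let B : ℕ → Set ℝ := fun N => ⋃ n ≤ N, ⋃ r, ⋃ (_ : r < 2 ^ n ∧ W n r), openCell n r
  have hB : ∀ N, volume (B N) ≤ ENNReal.ofReal c := fun N => by
    have hsub : B N ⊆ A N ∪ dyadicRationals := by
      intro y hy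
      by_cases hd : y ∈ dyadicRationals
      · exact Or.inr hd
      refine Or.inl ?_
      simp only [B, Set.mem_iUnion] at hy
      obtain ⟨n, hn, r, ⟨hr, hW⟩, hy⟩ := hy
      have hp : (0 : ℝ) < 2 ^ n := by positivity
      have h0 : 0 ≤ y := le_trans (by positivity) hy.1.le
      have h1 : y < 1 := by
        refine hy.2.trans_le ?_
        rw [div_le_one hp]
        exact_mod_cast hr
      rw [mem_openCell_iff h0 hd] at hy
      simp only [A, Set.mem_iUnion]
      refine ⟨dyadicIndex y N, ⟨Nat.div_eq_of_lt (dyadicIndex_lt h0 h1 N), n, hn, ?_⟩, ?_⟩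
      · rwa [dyadicIndex_div _ hn, ← hy]
      · rw [zero_add, mem_openCell_iff h0 hd]
    calc volume (B N) ≤ volume (A N ∪ dyadicRationals) := measure_mono hsub
      _ ≤ volume (A N) + volume dyadicRationals := measure_union_le _ _
      _ ≤ _ := by rw [countable_dyadicRationals.measure_zero, add_zero]; exact hA N
  have hU : (⋃ n, ⋃ r, ⋃ (_ : r < 2 ^ n ∧ W n r), openCell n r) = ⋃ N, B N := by
    ext y
    simp only [B, Set.mem_iUnion]
    constructor
    · rintro ⟨n, h⟩
      exact ⟨n, n, le_rfl, h⟩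
    · rintro ⟨-, n, -, h⟩
      exact ⟨n, h⟩
  have hm : Monotone B := fun M N hMN =>
    Set.iUnion_mono fun n => Set.iUnion_mono' fun hn => ⟨hn.trans hMN, le_rfl⟩
  rw [hU, hm.measure_iUnion]
  exact iSup_le hB

/-- A random real avoids some component of every sequence of recursively enumerable sets of cells
whose `k`-th component covers at most the fraction `c / 2 ^ k` of every level. -/
theorem MLRandom.exists_avoids {z : ℝ} (hz : MLRandom z) (h0 : 0 ≤ z) (h1 : z < 1)
    {W : ℕ → ℕ → ℕ → Prop} (hW : REPred fun x : ℕ × ℕ × ℕ => W x.1 x.2.1 x.2.2) (c : ℝ)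
    (h : ∀ k N, extSum (fun x => truthValue (∃ n ≤ N, W k n (x / 2 ^ (N - n)))) 0 N ≤
      c / 2 ^ k * 2 ^ N) (k₀ : ℕ) :
    ∃ k ≥ k₀, ∀ n, ¬ W k n (dyadicIndex z n) := by
  have hd := hz.notMem_dyadicRationals
  obtain ⟨e, he⟩ := pow_unbounded_of_one_lt c (one_lt_two (α := ℝ))
  -- The shift by `e` absorbs the constant `c < 2 ^ e`, and the shift by `k₀` makes the avoided
  -- index large.
  let k : ℕ → ℕ := fun m => m + e + k₀
  let G : ℕ → Set ℝ := fun m => ⋃ n, ⋃ r, ⋃ (_ : r < 2 ^ n ∧ W (k m) n r), openCell n r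
  have hG : IsMLTest G := by
    refine ⟨⟨fun x => ∃ y : ℕ × ℕ, y.2 < 2 ^ y.1 ∧ W (k x.1) y.1 y.2 ∧ x.2 = cellCode y.1 y.2,
      ?_, ?_⟩, ?_⟩
    · refine REPred.exists (p := fun x : ℕ × ((ℕ × ℕ × ℕ) × (ℕ × ℕ × ℕ)) => fun y : ℕ × ℕ =>
        y.2 < 2 ^ y.1 ∧ W (k x.1) y.1 y.2 ∧ x.2 = cellCode y.1 y.2) ?_
      have hn : Computable fun x : (ℕ × ((ℕ × ℕ × ℕ) × (ℕ × ℕ × ℕ))) × ℕ × ℕ => x.2.1 :=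
        Computable.fst.comp Computable.snd
      have hr : Computable fun x : (ℕ × ((ℕ × ℕ × ℕ) × (ℕ × ℕ × ℕ))) × ℕ × ℕ => x.2.2 :=
        Computable.snd.comp Computable.snd
      have hk : Computable fun x : (ℕ × ((ℕ × ℕ × ℕ) × (ℕ × ℕ × ℕ))) × ℕ × ℕ => k x.1.1 :=
        ((Computable.fst.comp Computable.fst).natAdd (.const e)).natAdd (.const k₀)
      refine (ComputablePred.nat_lt hr hn.two_pow).to_re.and (REPred.and ?_ ?_)
      · exact REPred.comp (p := fun x : ℕ × ℕ × ℕ => W x.1 x.2.1 x.2.2) hW (hk.pair (hn.pair hr))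
      · exact (ComputablePred.eq (Computable.snd.comp Computable.fst) (hn.cellCode hr)).to_re
    · intro m
      ext y
      simp only [G, Set.mem_iUnion, Set.mem_ofPred_eq, Prod.exists, exists_prop]
      constructor
      · rintro ⟨n, r, ⟨hr, hw⟩, hy⟩
        refine ⟨(cellCode n r).1.1, (cellCode n r).1.2.1, (cellCode n r).1.2.2,
          (cellCode n r).2.1, (cellCode n r).2.2.1, (cellCode n r).2.2.2, ⟨n, r, hr, hw, rfl⟩, ?_⟩
        rw [← ratIoo_cellCode] at hy
        exact hy
      · rintro ⟨a, b, c, a', b', c', ⟨n, r, hr, hw, he⟩, hy⟩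
        refine ⟨n, r, ⟨hr, hw⟩, ?_⟩
        rw [he, ratIoo_cellCode] at hy
        exact hy
    · intro m
      refine (volume_iUnion_openCell_le _ _ (h (k m))).trans ?_
      rw [← ENNReal.ofReal_ofNat, ← ENNReal.ofReal_inv_of_pos (by norm_num),
        ← ENNReal.ofReal_pow (by norm_num)]
      refine ENNReal.ofReal_le_ofReal ?_
      rw [div_le_iff₀ (by positivity), inv_pow]
      have : (1 : ℝ) ≤ 2 ^ k₀ := one_le_pow₀ (by norm_num)
      have he' : (0 : ℝ) < 2 ^ e := by positivity
      calc c ≤ 2 ^ e := he.le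
        _ ≤ 2 ^ e * 2 ^ k₀ := by nlinarith
        _ = (2 ^ m)⁻¹ * 2 ^ k m := by
          simp only [k]
          rw [pow_add, pow_add]
          field_simp
  have hn := hz G hG
  rw [Set.mem_iInter, not_forall] at hn
  obtain ⟨m, hm⟩ := hn
  refine ⟨k m, Nat.le_add_left _ _, fun n hn => hm ?_⟩
  simp only [G, Set.mem_iUnion]
  exact ⟨n, dyadicIndex z n, ⟨dyadicIndex_lt h0 h1 n, hn⟩, (mem_openCell_iff h0 hd _ _).2 rfl⟩

end Tests

/-! ### Dyadic density -/

section Density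

/-- The dyadic interval of level `n` that contains `z`. -/
noncomputable def dyadicIntervalAt (z : ℝ) (n : ℕ) : Set ℝ :=
  dyadicInterval ((dyadicIndex z n : ℕ), n)

theorem dyadicInterval_ae_eq_openCell (n r : ℕ) :
    (dyadicInterval ((r : ℕ), n) : Set ℝ) =ᵐ[volume] openCell n r := by
  have : dyadicInterval (((r : ℕ) : ℤ), n) = Set.Icc ((r : ℝ) / 2 ^ n) (((r : ℝ) + 1) / 2 ^ n) := by
    simp [dyadicInterval]
  rw [this]
  exact Ioo_ae_eq_Icc.symm

theorem volume_dyadicIntervalAt_inter (z : ℝ) (n : ℕ) (C : Set ℝ) :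
    volume (dyadicIntervalAt z n ∩ C) = volume (openCell n (dyadicIndex z n) ∩ C) :=
  measure_congr ((dyadicInterval_ae_eq_openCell _ _).inter (ae_eq_refl C))

theorem mem_dyadicInterval_iff {z : ℝ} (h0 : 0 ≤ z) (hd : z ∉ dyadicRationals) (p : ℤ × ℕ) :
    z ∈ dyadicInterval p ↔ p.1 = (dyadicIndex z p.2 : ℕ) := by
  obtain ⟨r, n⟩ := p
  have hp : (0 : ℝ) < 2 ^ n := by positivity
  have hmem := (mem_openCell_iff h0 hd n (dyadicIndex z n)).2 rfl
  constructor
  · rintro ⟨h1, h2⟩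
    simp only at h1 h2 ⊢
    obtain ⟨h3, h4⟩ := hmem
    have h5 : (r : ℝ) < dyadicIndex z n + 1 := by
      have := h1.trans_lt h4
      rwa [div_lt_div_iff_of_pos_right hp] at this
    have h6 : (dyadicIndex z n : ℝ) < r + 1 := by
      have := h3.trans_le h2
      rwa [div_lt_div_iff_of_pos_right hp] at this
    norm_cast at h5 h6
    have h7 : r < (dyadicIndex z n : ℤ) + 1 := by exact_mod_cast h5
    have h8 : (dyadicIndex z n : ℤ) < r + 1 := by exact_mod_cast h6
    omega
  · intro h
    simp only at h
    subst h
    simpa [dyadicInterval] using Set.Ioo_subset_Icc_self hmem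

/-- Only one interval of each level contains a non-dyadic `z`, so the filter in the definition is
the image of `atTop` under the map sending `n` to that interval. Endpoints do not affect volume. -/
theorem lowerDyadicDensity_eq {z : ℝ} (h0 : 0 ≤ z) (hd : z ∉ dyadicRationals) (C : Set ℝ) :
    lowerDyadicDensity C z = liminf (fun n => ENNReal.ofReal
      (2 ^ n * volume.real (openCell n (dyadicIndex z n) ∩ C))) atTop := by
  have hF : (comap (fun p : ℤ × ℕ => (2⁻¹ : ℝ) ^ p.2) (𝓝 0) ⊓ 𝓟 {p | z ∈ dyadicInterval p}) =
      map (fun n : ℕ => (((dyadicIndex z n : ℕ) : ℤ), n)) atTop := by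
    have hc : comap (fun p : ℤ × ℕ => (2⁻¹ : ℝ) ^ p.2) (𝓝 0) = comap Prod.snd atTop := by
      have h1 : comap (fun n : ℕ => (2⁻¹ : ℝ) ^ n) (𝓝 0) = atTop := by
        refine le_antisymm ?_ (tendsto_iff_comap.1
          (tendsto_pow_atTop_nhds_zero_of_lt_one (by norm_num) (by norm_num)))
        refine atTop_basis.ge_iff.2 fun N _ => ?_
        refine mem_comap.2 ⟨Set.Iio ((2⁻¹ : ℝ) ^ N), Iio_mem_nhds (by positivity), fun n hn => ?_⟩
        by_contra hlt
        simp only [Set.mem_Ici, not_le] at hlt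
        exact absurd (Set.mem_Iio.1 hn) (not_lt.2
          (pow_le_pow_of_le_one (a := (2⁻¹ : ℝ)) (by norm_num) (by norm_num) hlt.le))
      rw [← h1, comap_comap]
      rfl
    rw [hc]
    ext s
    rw [mem_map, mem_inf_principal, mem_comap]
    constructor
    · rintro ⟨t, ht, hts⟩
      filter_upwards [ht] with n hn
      exact hts (show _ ∈ Prod.snd ⁻¹' t from hn) ((mem_dyadicInterval_iff h0 hd _).2 rfl)
    · intro hs
      refine ⟨_, hs, ?_⟩
      rintro ⟨r, n⟩ hn hz
      have := (mem_dyadicInterval_iff h0 hd _).1 hz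
      simp only at this
      subst this
      exact hn
  rw [lowerDyadicDensity, hF, ← Filter.liminf_comp]
  congr 1
  funext n
  have hp : (0 : ℝ) < 2 ^ n := by positivity
  have hne : volume (openCell n (dyadicIndex z n) ∩ C) ≠ ∞ :=
    ((measure_mono Set.inter_subset_left).trans_lt
      (by rw [volume_openCell]; exact ENNReal.ofReal_lt_top)).ne
  have h1 := volume_dyadicIntervalAt_inter z n C
  have h2 := volume_dyadicIntervalAt_inter z n Set.univ
  rw [Set.inter_univ, Set.inter_univ, volume_openCell] at h2
  simp only [dyadicIntervalAt] at h1 h2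
  simp only [Function.comp]
  rw [h1, h2, ENNReal.ofReal_inv_of_pos hp, div_eq_mul_inv, inv_inv,
    ENNReal.ofReal_mul hp.le, Measure.real, ENNReal.ofReal_toReal hne, mul_comm]

theorem real_volume_inter_compl (n r : ℕ) {C : Set ℝ} (hC : MeasurableSet C) :
    volume.real (openCell n r ∩ C) + volume.real (openCell n r ∩ Cᶜ) = (2 ^ n)⁻¹ := by
  rw [← Set.sdiff_eq, measureReal_inter_add_sdiff hC (by rw [volume_openCell]; finiteness),
    Measure.real, volume_openCell, ENNReal.toReal_ofReal (by positivity)]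

theorem EffectivelyClosed.measurableSet {C : Set ℝ} (hC : EffectivelyClosed C) :
    MeasurableSet C := by
  obtain ⟨W, -, hW⟩ := hC
  rw [← MeasurableSet.compl_iff, hW]
  exact MeasurableSet.biUnion (Set.to_countable _) fun _ _ => measurableSet_Ioo

/-- A recursively enumerable set of cells that does not contain any cell around a dyadic density-one
point covers only a small fraction of the small cells around that point. -/
theorem DyadicDensityOnePoint.eventually_small {z : ℝ} (hz : DyadicDensityOnePoint z) (h0 : 0 ≤ z)
    (hd : z ∉ dyadicRationals) {H : ℕ → ℕ → Prop} (hH : REPred fun x : ℕ × ℕ => H x.1 x.2)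
    (hn : ∀ n, ¬ H n (dyadicIndex z n)) {η : ℝ} (hη : 0 < η) :
    ∀ᶠ n in atTop, ∀ d, extSum (fun x => truthValue (∃ e ≤ d, H (n + e) (x / 2 ^ (d - e))))
      (dyadicIndex z n) d ≤ η * 2 ^ d := by
  let C : Set ℝ := (⋃ n, ⋃ r, ⋃ (_ : H n r), openCell n r)ᶜ
  have hC : EffectivelyClosed C := by
    refine ⟨fun p => ∃ y : ℕ × ℕ, H y.1 y.2 ∧ p = cellCode y.1 y.2, ?_, ?_⟩
    · refine REPred.exists (p := fun p : (ℕ × ℕ × ℕ) × (ℕ × ℕ × ℕ) => fun y : ℕ × ℕ =>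
        H y.1 y.2 ∧ p = cellCode y.1 y.2) (REPred.and ?_ ?_)
      · exact REPred.comp (p := fun x : ℕ × ℕ => H x.1 x.2) hH Computable.snd
      · exact (ComputablePred.eq Computable.fst ((Computable.fst.comp Computable.snd).cellCode
          (Computable.snd.comp Computable.snd))).to_re
    · rw [compl_compl]
      ext y
      simp only [Set.mem_iUnion, Set.mem_ofPred_eq, exists_prop]
      constructor
      · rintro ⟨n, r, hw, hy⟩
        exact ⟨cellCode n r, ⟨(n, r), hw, rfl⟩, by rwa [ratIoo_cellCode]⟩
      · rintro ⟨p, ⟨⟨n, r⟩, hw, rfl⟩, hy⟩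
        exact ⟨n, r, hw, by rwa [ratIoo_cellCode] at hy⟩
  have hzC : z ∈ C := by
    simp only [C, Set.mem_compl_iff, Set.mem_iUnion, not_exists]
    intro n r hr hy
    rw [mem_openCell_iff h0 hd] at hy
    exact hn n (hy ▸ hr)
  have hlim := hz C hC hzC
  rw [lowerDyadicDensity_eq h0 hd] at hlim
  have hlt : ENNReal.ofReal (1 - η) < 1 := by
    rw [ENNReal.ofReal_lt_one]
    linarith
  have hev := eventually_lt_of_lt_liminf (hlim.symm ▸ hlt)
  filter_upwards [hev] with n hn d
  set r := dyadicIndex z n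
  have hp : (0 : ℝ) < 2 ^ n := by positivity
  have hpd : (0 : ℝ) < 2 ^ d := by positivity
  have h1 : 1 - η < 2 ^ n * volume.real (openCell n r ∩ C) :=
    (ENNReal.ofReal_lt_ofReal_iff'.1 hn).1
  have h2 := real_volume_inter_compl n r hC.measurableSet
  have h3 : extSum (fun x => truthValue (∃ e ≤ d, H (n + e) (x / 2 ^ (d - e)))) r d *
      (2 ^ (n + d))⁻¹ ≤ volume.real (openCell n r ∩ Cᶜ) := by
    rw [Measure.real, ← ENNReal.ofReal_le_iff_le_toReal
      ((measure_mono Set.inter_subset_left).trans_lt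
        (by rw [volume_openCell]; exact ENNReal.ofReal_lt_top)).ne, ← volume_biUnion_openCell]
    refine measure_mono (Set.iUnion₂_subset fun x hx => Set.subset_inter ?_ ?_)
    · rw [← hx.1]
      exact openCell_subset n d x
    · obtain ⟨e, he, hH⟩ := hx.2
      rw [compl_compl]
      have := openCell_subset (n + e) (d - e) x
      rw [add_assoc, Nat.add_sub_cancel' he] at this
      exact this.trans (Set.subset_iUnion_of_subset _ (Set.subset_iUnion_of_subset _
        (Set.subset_iUnion_of_subset hH le_rfl)))
  have h4 : 2 ^ n * volume.real (openCell n r ∩ C) + 2 ^ n * volume.real (openCell n r ∩ Cᶜ) = 1 := by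
    rw [← mul_add, h2, mul_inv_cancel₀ hp.ne']
  have h5 : 2 ^ n * volume.real (openCell n r ∩ Cᶜ) ≤ η := by linarith
  have h6 := (mul_le_mul_of_nonneg_left h3 hp.le).trans h5
  rw [pow_add, mul_inv, mul_left_comm, mul_inv_cancel_left₀ hp.ne', ← div_eq_mul_inv,
    div_le_iff₀ hpd] at h6
  exact h6

end Density

/-! ### Computable approximations of left-c.e. measures -/

section Approximation

/-- A measure on the dyadic cells. -/
structure IsCellMeasure (μ : ℕ → ℕ → ℝ) : Prop where
  nonneg : ∀ n r, 0 ≤ μ n r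
  add : ∀ n r, μ (n + 1) (2 * r) + μ (n + 1) (2 * r + 1) = μ n r

/-- The measures of the cells are uniformly left-c.e. reals. -/
def LeftCECells (μ : ℕ → ℕ → ℝ) : Prop :=
  REPred fun x : ℕ × ℕ × ℕ × ℕ => (x.2.2.1 : ℝ) / 2 ^ x.2.2.2 < μ x.1 x.2.1

variable {μ : ℕ → ℕ → ℝ}

/-- Iterated additivity: a cell has the total mass of its subcells at any deeper level. -/
theorem IsCellMeasure.extSum_eq (h : IsCellMeasure μ) (n r d : ℕ) :
    extSum (μ (n + d)) r d = μ n r := by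
  induction d generalizing n with
  | zero => simp
  | succ d ih =>
    rw [extSum_succ, ← ih n]
    exact extSum_congr fun x _ => h.add (n + d) x

/-- The value at stage `s` is the largest `c / 2 ^ e` with `c, e ≤ s` recognised by then as lying
below `μ n r`, written over the denominator `2 ^ s`. The default value `0` covers the absence of a
candidate; otherwise the approximation is strictly below `μ n r`, and this strictness lets later
stages overtake it. No additivity over cells is expected yet. -/
theorem exists_computable_stages (hre : LeftCECells μ) (h0 : ∀ n r, 0 ≤ μ n r) :
    ∃ a : ℕ → ℕ → ℕ → ℕ, (Computable fun x : ℕ × ℕ × ℕ => a x.1 x.2.1 x.2.2) ∧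
      (∀ s n r, a s n r = 0 ∨ (a s n r : ℝ) / 2 ^ s < μ n r) ∧
      ∀ n r x, x < μ n r → ∀ᶠ s in atTop, x < (a s n r : ℝ) / 2 ^ s := by
  classical
  obtain ⟨q, hq, hmono, hqp⟩ := hre.exists_stages
  let b : (ℕ × ℕ × ℕ) × ℕ → ℕ → ℕ := fun y e =>
    if q (y.1.2.1, y.1.2.2, y.2, e) y.1.1 then y.2 * 2 ^ (y.1.1 - e) else 0
  let a : ℕ → ℕ → ℕ → ℕ := fun s n r =>
    (Finset.range (s + 1)).sup fun c => (Finset.range (s + 1)).sup (b ((s, n, r), c))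
  have hscale : ∀ c e s : ℕ, e ≤ s → ((c * 2 ^ (s - e) : ℕ) : ℝ) / 2 ^ s = c / 2 ^ e := by
    intro c e s he
    rw [div_eq_div_iff (by positivity) (by positivity)]
    push_cast
    rw [mul_assoc, ← pow_add, Nat.sub_add_cancel he]
  refine ⟨a, ?_, ?_, ?_⟩
  · have hb : Computable fun z : ((ℕ × ℕ × ℕ) × ℕ) × ℕ => b z.1 z.2 := by
      have hy : Computable fun z : ((ℕ × ℕ × ℕ) × ℕ) × ℕ => z.1.1 :=
        Computable.fst.comp Computable.fst
      have hs : Computable fun z : ((ℕ × ℕ × ℕ) × ℕ) × ℕ => z.1.1.1 := Computable.fst.comp hy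
      have hn : Computable fun z : ((ℕ × ℕ × ℕ) × ℕ) × ℕ => z.1.1.2.1 :=
        Computable.fst.comp (Computable.snd.comp hy)
      have hr : Computable fun z : ((ℕ × ℕ × ℕ) × ℕ) × ℕ => z.1.1.2.2 :=
        Computable.snd.comp (Computable.snd.comp hy)
      have hc : Computable fun z : ((ℕ × ℕ × ℕ) × ℕ) × ℕ => z.1.2 :=
        Computable.snd.comp Computable.fst
      refine Computable.if_then_else (p := fun z : ((ℕ × ℕ × ℕ) × ℕ) × ℕ =>
        q (z.1.1.2.1, z.1.1.2.2, z.1.2, z.2) z.1.1.1) ?_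
        (hc.natMul (hs.natSub Computable.snd).two_pow) (Computable.const 0)
      exact ComputablePred.comp (p := fun x : (ℕ × ℕ × ℕ × ℕ) × ℕ => q x.1 x.2) hq
        ((hn.pair (hr.pair (hc.pair Computable.snd))).pair hs)
    have hs' : Computable fun y : (ℕ × ℕ × ℕ) × ℕ => y.1.1 + 1 :=
      (Computable.fst.comp Computable.fst).natAdd (.const 1)
    have h1 : Computable fun y : (ℕ × ℕ × ℕ) × ℕ => (Finset.range (y.1.1 + 1)).sup (b y) :=
      Computable.sup_range hb hs'
    have h2 : Computable fun x : ℕ × ℕ × ℕ => x.1 + 1 := Computable.fst.natAdd (.const 1)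
    exact (Computable.sup_range (f := fun (x : ℕ × ℕ × ℕ) c => (Finset.range (x.1 + 1)).sup (b (x, c)))
      h1 h2).of_eq fun x => rfl
  · intro s n r
    by_cases h : a s n r = 0
    · exact Or.inl h
    refine Or.inr ?_
    obtain ⟨c, hc, hac⟩ := Finset.exists_mem_eq_sup (Finset.range (s + 1)) ⟨0, by simp⟩
      fun c => (Finset.range (s + 1)).sup (b ((s, n, r), c))
    obtain ⟨e, he, hae⟩ := Finset.exists_mem_eq_sup (Finset.range (s + 1)) ⟨0, by simp⟩
      (b ((s, n, r), c))
    have hab : a s n r = b ((s, n, r), c) e := hac.trans hae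
    rw [hab] at h ⊢
    by_cases hqe : q (n, r, c, e) s
    · have hbv : b ((s, n, r), c) e = c * 2 ^ (s - e) := if_pos hqe
      rw [hbv, hscale c e s (Nat.lt_succ_iff.1 (Finset.mem_range.1 he))]
      exact (hqp (n, r, c, e)).2 ⟨s, hqe⟩
    · exact absurd (if_neg hqe) h
  · intro n r x hx
    -- Candidates are nonnegative, so `x` is replaced by `max x 0`; this fails to stay below `μ n r`
    -- only if `μ n r = 0`, when `x` is negative.
    have h1 : max x 0 < μ n r ∨ μ n r = 0 := by
      rcases (h0 n r).lt_or_eq with h | h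
      · exact Or.inl (max_lt hx h)
      · exact Or.inr h.symm
    rcases h1 with h1 | h1
    · obtain ⟨e, he⟩ := exists_pow_lt_of_lt_one (sub_pos.2 h1) (by norm_num : (2⁻¹ : ℝ) < 1)
      have hp : (0 : ℝ) < 2 ^ e := by positivity
      set c := ⌊max x 0 * 2 ^ e⌋₊ + 1
      have hc1 : max x 0 < (c : ℝ) / 2 ^ e := by
        rw [lt_div_iff₀ hp]
        simp only [c]
        push_cast
        exact Nat.lt_floor_add_one _
      have hc2 : (c : ℝ) / 2 ^ e < μ n r := by
        rw [div_lt_iff₀ hp]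
        have h2 := Nat.floor_le (show 0 ≤ max x 0 * 2 ^ e by positivity)
        have h3 : 1 < (μ n r - max x 0) * 2 ^ e := by
          rwa [inv_pow, inv_lt_iff_one_lt_mul₀ hp] at he
        simp only [c]
        push_cast
        nlinarith
      obtain ⟨t, ht⟩ := (hqp (n, r, c, e)).1 hc2
      filter_upwards [eventually_ge_atTop (max t (max c e))] with s hs
      have hts : t ≤ s := (le_max_left _ _).trans hs
      have hcs : c ≤ s := (le_max_left _ _).trans ((le_max_right _ _).trans hs)
      have hes : e ≤ s := (le_max_right _ _).trans ((le_max_right _ _).trans hs)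
      have hbv : b ((s, n, r), c) e = c * 2 ^ (s - e) := if_pos (hmono _ _ _ hts ht)
      have hle : c * 2 ^ (s - e) ≤ a s n r := by
        rw [← hbv]
        exact (Finset.le_sup (f := b ((s, n, r), c)) (Finset.mem_range.2 (Nat.lt_succ_of_le hes))).trans
          (Finset.le_sup (f := fun c => (Finset.range (s + 1)).sup (b ((s, n, r), c)))
            (Finset.mem_range.2 (Nat.lt_succ_of_le hcs)))
      calc x ≤ max x 0 := le_max_left _ _
        _ < (c : ℝ) / 2 ^ e := hc1
        _ = ((c * 2 ^ (s - e) : ℕ) : ℝ) / 2 ^ s := (hscale c e s hes).symm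
        _ ≤ _ := by gcongr
    · exact Eventually.of_forall fun s => (h1 ▸ hx).trans_le (by positivity)

/-- The levels at which the successive approximations of a measure are given. -/
def level (i : ℕ) : ℕ := (i + 1) ^ 2

/-- The gaps between levels grow. Rounding the growth on a cell to whole subcells of the next level
then costs a fraction of order `2 ^ (-(2 * i + 3))`, which is summable over `i`. -/
theorem level_succ (i : ℕ) : level (i + 1) = level i + (2 * i + 3) := by
  unfold level
  ring

theorem lt_level (i : ℕ) : i < level i := by
  unfold level
  nlinarith

theorem level_mono : Monotone level := monotone_nat_of_le_succ fun i => by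
  rw [level_succ]
  omega

/-- An increasing computable sequence of approximations `num i m r / 2 ^ st i` of the measure `μ`;
the `i`-th one is a measure on the cells of level at most `level i`. -/
structure ApproximatesCells (μ : ℕ → ℕ → ℝ) (num : ℕ → ℕ → ℕ → ℕ) (st : ℕ → ℕ) : Prop where
  computable_num : Computable fun x : ℕ × ℕ × ℕ => num x.1 x.2.1 x.2.2
  computable_st : Computable st
  st_lt : ∀ i, st i < st (i + 1)
  extSum_num : ∀ i m d r, m + d ≤ level i →
    extSum (fun x => (num i (m + d) x : ℝ)) r d = num i m r
  mono : ∀ i m r, m ≤ level i → r < 2 ^ m →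
    (num i m r : ℝ) / 2 ^ st i ≤ num (i + 1) m r / 2 ^ st (i + 1)
  le : ∀ i m r, m ≤ level i → (num i m r : ℝ) / 2 ^ st i ≤ μ m r
  exists_gt : ∀ m r x, r < 2 ^ m → x < μ m r → ∀ i, ∃ j ≥ i, x < (num j m r : ℝ) / 2 ^ st j

/-- Additivity is forced by keeping only the raw approximations at level `level i` and summing them
over subcells. Raw values need not be coherent between levels or increasing in the stage, so the
next stage is found by search: its sums must dominate the current raw values at every level up to
`level i`. Dominance at level `level i` yields monotonicity; dominance at the smaller levels yields
convergence to `μ`. -/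
theorem exists_approximatesCells (hμ : IsCellMeasure μ) (hre : LeftCECells μ) :
    ∃ num st, ApproximatesCells μ num st := by
  obtain ⟨a, ha, hlt, hconv⟩ := exists_computable_stages hre hμ.nonneg
  have hle : ∀ s n r, (a s n r : ℝ) / 2 ^ s ≤ μ n r := fun s n r => by
    rcases hlt s n r with h | h
    · rw [h]
      simpa using hμ.nonneg n r
    · exact h.le
  let S : ℕ → ℕ → ℕ → ℕ → ℕ := fun t l m r =>
    ∑ j ∈ Finset.range (2 ^ (l - m)), a t l (r * 2 ^ (l - m) + j)
  have hS : ∀ t l m r, (S t l m r : ℝ) = extSum (fun x => (a t l x : ℝ)) r (l - m) := by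
    intro t l m r
    simp [S, extSum]
  have hSc : Computable fun x : ℕ × ℕ × ℕ × ℕ => S x.1 x.2.1 x.2.2.1 x.2.2.2 := by
    have h2 : Computable fun x : ℕ × ℕ × ℕ × ℕ => 2 ^ (x.2.1 - x.2.2.1) :=
      ((Computable.fst.comp Computable.snd).natSub
        (Computable.fst.comp (Computable.snd.comp Computable.snd))).two_pow
    refine (Computable.sum_range (f := fun (x : ℕ × ℕ × ℕ × ℕ) j =>
      a x.1 x.2.1 (x.2.2.2 * 2 ^ (x.2.1 - x.2.2.1) + j)) ?_ h2).of_eq fun x => rfl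
    refine Computable.comp_three ha (Computable.fst.comp Computable.fst)
      (Computable.fst.comp (Computable.snd.comp Computable.fst)) ?_
    exact ((Computable.snd.comp (Computable.snd.comp (Computable.snd.comp Computable.fst))).natMul
      (h2.comp Computable.fst)).natAdd Computable.snd
  have hlevel : Computable level := (Computable.id.natAdd (.const 1)).natPow (.const 2)
  -- the condition that defines the next stage
  let P : ℕ × ℕ → ℕ → Prop := fun y t => y.2 < t ∧ ∀ m < level y.1 + 1, ∀ r < 2 ^ m,
    a y.2 m r * 2 ^ (t - y.2) ≤ S t (level (y.1 + 1)) m r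
  have hPc : ComputablePred fun x : (ℕ × ℕ) × ℕ => P x.1 x.2 := by
    have hi : Computable fun x : (ℕ × ℕ) × ℕ => x.1.1 := Computable.fst.comp Computable.fst
    have hs : Computable fun x : (ℕ × ℕ) × ℕ => x.1.2 := Computable.snd.comp Computable.fst
    refine (ComputablePred.nat_lt hs Computable.snd).and ?_
    refine ComputablePred.forall_lt (p := fun (x : (ℕ × ℕ) × ℕ) m => ∀ r < 2 ^ m,
      a x.1.2 m r * 2 ^ (x.2 - x.1.2) ≤ S x.2 (level (x.1.1 + 1)) m r) ?_
      ((hlevel.comp hi).natAdd (.const 1))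
    refine ComputablePred.forall_lt (p := fun (x : ((ℕ × ℕ) × ℕ) × ℕ) r =>
      a x.1.1.2 x.2 r * 2 ^ (x.1.2 - x.1.1.2) ≤ S x.1.2 (level (x.1.1.1 + 1)) x.2 r) ?_
      Computable.snd.two_pow
    have hx : Computable fun x : (((ℕ × ℕ) × ℕ) × ℕ) × ℕ => x.1.1 :=
      Computable.fst.comp Computable.fst
    have hm : Computable fun x : (((ℕ × ℕ) × ℕ) × ℕ) × ℕ => x.1.2 :=
      Computable.snd.comp Computable.fst
    have ht : Computable fun x : (((ℕ × ℕ) × ℕ) × ℕ) × ℕ => x.1.1.2 := Computable.snd.comp hx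
    refine ComputablePred.nat_le ?_ ?_
    · exact (Computable.comp_three ha (hs.comp hx) hm Computable.snd).natMul
        (ht.natSub (hs.comp hx)).two_pow
    · exact Computable.comp_four hSc ht (hlevel.comp ((hi.comp hx).natAdd (.const 1))) hm
        Computable.snd
  have hPex : ∀ y, ∃ t, P y t := by
    rintro ⟨i, s⟩
    -- The search terminates: only finitely many raw values are involved, each is `0` or strictly
    -- below `μ m r`, and the sums over the fixed finer level converge to `μ m r`.
    have hev : ∀ᶠ t in atTop, ∀ m ∈ Finset.range (level i + 1), ∀ r ∈ Finset.range (2 ^ m),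
        (a s m r : ℝ) / 2 ^ s ≤ S t (level (i + 1)) m r / 2 ^ t := by
      rw [eventually_all_finset]
      intro m hm
      rw [eventually_all_finset]
      intro r _
      rcases hlt s m r with h | h
      · exact Eventually.of_forall fun t => by rw [h]; simp only [Nat.cast_zero, zero_div]; positivity
      · have hml : m ≤ level (i + 1) :=
          (Nat.lt_succ_iff.1 (Finset.mem_range.1 hm)).trans (level_mono (Nat.le_succ i))
        set d := level (i + 1) - m
        have hsum : extSum (μ (level (i + 1))) r d = μ m r := by
          have := hμ.extSum_eq m r d
          rwa [Nat.add_sub_cancel' hml] at this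
        have htend : Tendsto (fun t => extSum (fun x => (a t (level (i + 1)) x : ℝ) / 2 ^ t) r d)
            atTop (𝓝 (μ m r)) := by
          rw [← hsum]
          refine tendsto_finsetSum _ fun j _ => ?_
          refine tendsto_order.2 ⟨fun x hx => hconv _ _ x hx, fun x hx => ?_⟩
          exact Eventually.of_forall fun t => (hle t _ _).trans_lt hx
        filter_upwards [htend.eventually (lt_mem_nhds h)] with t ht
        rw [hS, div_eq_mul_inv _ ((2 : ℝ) ^ t), ← extSum_mul_right]
        exact ht.le
    obtain ⟨t, ht, hst⟩ := (hev.and (eventually_gt_atTop s)).exists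
    refine ⟨t, hst, fun m hm r hr => ?_⟩
    have h1 := ht m (Finset.mem_range.2 hm) r (Finset.mem_range.2 hr)
    rw [div_le_div_iff₀ (by positivity) (by positivity)] at h1
    have h2 : (2 : ℝ) ^ t = 2 ^ (t - s) * 2 ^ s := by rw [← pow_add, Nat.sub_add_cancel hst.le]
    rw [h2, ← mul_assoc] at h1
    have h3 := le_of_mul_le_mul_right h1 (by positivity)
    simp only at h3 ⊢
    exact_mod_cast h3
  obtain ⟨next, hnext, hP⟩ := Computable.exists_choice hPc hPex
  let st : ℕ → ℕ := fun i => Nat.rec 0 (fun k s => next (k, s)) i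
  have hst : ∀ i, P (i, st i) (st (i + 1)) := fun i => hP (i, st i)
  have hstc : Computable st :=
    (Computable.nat_rec (f := fun i : ℕ => i) (g := fun _ => 0) (h := fun _ x => next x)
      Computable.id (Computable.const 0) (hnext.comp Computable.snd))
  have hstlt : ∀ i, st i < st (i + 1) := fun i => (hst i).1
  have hstmono : StrictMono st := strictMono_nat_of_lt_succ hstlt
  let num : ℕ → ℕ → ℕ → ℕ := fun i m r => S (st i) (level i) m r
  -- every approximation of the values at the previous stage is exceeded
  have hstep : ∀ i m r, m ≤ level i → r < 2 ^ m →
      (a (st i) m r : ℝ) / 2 ^ st i ≤ num (i + 1) m r / 2 ^ st (i + 1) := by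
    intro i m r hm hr
    have h1 := (hst i).2 m (Nat.lt_succ_of_le hm) r hr
    have h2 : (2 : ℝ) ^ st (i + 1) = 2 ^ (st (i + 1) - st i) * 2 ^ st i := by
      rw [← pow_add, Nat.sub_add_cancel (hstlt i).le]
    rw [div_le_div_iff₀ (by positivity) (by positivity), h2, ← mul_assoc]
    refine mul_le_mul_of_nonneg_right ?_ (by positivity)
    simp only at h1
    exact_mod_cast h1
  have hadd : ∀ i m d r, m + d ≤ level i →
      extSum (fun x => (num i (m + d) x : ℝ)) r d = num i m r := by
    intro i m d r h
    simp only [num, hS]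
    rw [show level i - m = d + (level i - (m + d)) by omega, extSum_add]
  refine ⟨num, st, ?_, hstc, hstlt, hadd, ?_, ?_, ?_⟩
  · exact Computable.comp_four hSc (hstc.comp Computable.fst) (hlevel.comp Computable.fst)
      (Computable.fst.comp Computable.snd) (Computable.snd.comp Computable.snd)
  · intro i m r hm hr
    have h1 := hadd i m (level i - m) r (by omega)
    have h2 := hadd (i + 1) m (level i - m) r (by rw [level_succ]; omega)
    rw [Nat.add_sub_cancel' hm] at h1 h2
    rw [← h1, ← h2, div_eq_mul_inv, div_eq_mul_inv, ← extSum_mul_right, ← extSum_mul_right]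
    refine extSum_le_extSum fun x hx => ?_
    have hx' : x < 2 ^ level i := by
      have h3 : x < (r + 1) * 2 ^ (level i - m) :=
        Nat.lt_mul_of_div_lt (by omega) (by positivity)
      have h4 : (r + 1) * 2 ^ (level i - m) ≤ 2 ^ m * 2 ^ (level i - m) :=
        Nat.mul_le_mul_right _ hr
      rw [← pow_add, Nat.add_sub_cancel' hm] at h4
      omega
    have h5 := hstep i (level i) x le_rfl hx'
    rw [div_eq_mul_inv, div_eq_mul_inv] at h5
    have h6 : num i (level i) x = a (st i) (level i) x := by simp [num, S]
    rw [h6]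
    exact h5
  · intro i m r hm
    have h1 := hμ.extSum_eq m r (level i - m)
    rw [Nat.add_sub_cancel' hm] at h1
    simp only [num, hS]
    rw [← h1, div_eq_mul_inv, ← extSum_mul_right]
    exact extSum_le_extSum fun x _ => by
      rw [← div_eq_mul_inv]
      exact hle _ _ _
  · intro m r x hr hx i
    have h1 := hstmono.tendsto_atTop.eventually (hconv m r x hx)
    obtain ⟨j, hj, hij⟩ := (h1.and (eventually_ge_atTop (max i m))).exists
    refine ⟨j + 1, by have := le_max_left i m; omega, hj.trans_le (hstep j m r ?_ hr)⟩
    exact ((le_max_right i m).trans hij).trans (lt_level j).le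

end Approximation

/-! ### Boundedness along random reals -/

section Bounded

/-- The supermartingale principle, in mass form: a quantity that never increases when a cell is
split does not increase in total. The inequalities of Ville and Doob and the bounds on the hole use
it with different potentials. -/
theorem extSum_le_of_step {f : ℕ → ℕ → ℝ} {r : ℕ}
    (h : ∀ d x, x / 2 ^ d = r → f (d + 1) (2 * x) + f (d + 1) (2 * x + 1) ≤ f d x) (d : ℕ) :
    extSum (f d) r d ≤ f 0 r := by
  induction d with
  | zero => simp
  | succ d ih =>
    rw [extSum_succ]
    exact (extSum_le_extSum fun x hx => h d x hx).trans ih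

theorem exists_le_succ_div_iff {W : ℕ → ℕ → Prop} {N x : ℕ} :
    (∃ n ≤ N + 1, W n (x / 2 ^ (N + 1 - n))) ↔
      (∃ n ≤ N, W n (x / 2 / 2 ^ (N - n))) ∨ W (N + 1) x := by
  constructor
  · rintro ⟨n, hn, h⟩
    rcases Nat.lt_or_eq_of_le hn with hn | rfl
    · refine Or.inl ⟨n, Nat.lt_succ_iff.1 hn, ?_⟩
      have h1 := div_two_pow_div x 1 (N - n)
      rw [pow_one] at h1
      rwa [h1, show 1 + (N - n) = N + 1 - n by omega]
    · exact Or.inr (by simpa using h)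
  · rintro (⟨n, hn, h⟩ | h)
    · refine ⟨n, by omega, ?_⟩
      have h1 := div_two_pow_div x 1 (N - n)
      rw [pow_one] at h1
      rwa [h1, show 1 + (N - n) = N + 1 - n by omega] at h
    · exact ⟨N + 1, le_rfl, by simpa using h⟩

variable {μ : ℕ → ℕ → ℝ}

/-- Ville's maximal inequality. -/
theorem IsCellMeasure.maximal_ineq (hμ : IsCellMeasure μ) {c : ℝ} (hc : 0 < c) (N : ℕ) :
    extSum (fun x => truthValue (∃ n ≤ N, c < 2 ^ n * μ n (x / 2 ^ (N - n)))) 0 N ≤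
      μ 0 0 / c * 2 ^ N := by
  classical
  let hit : ℕ → ℕ → Prop := fun N x => ∃ n ≤ N, c < 2 ^ n * μ n (x / 2 ^ (N - n))
  have hsucc : ∀ N x, hit (N + 1) x ↔ hit N (x / 2) ∨ c < 2 ^ (N + 1) * μ (N + 1) x := fun N x =>
    exists_le_succ_div_iff (W := fun n r => c < 2 ^ n * μ n r)
  -- The stopped process: once the density has exceeded `c`, the mass is cut down to density exactly
  -- `c`, and it is kept at that density from then on.
  let f : ℕ → ℕ → ℝ := fun N x => if hit N x then c / 2 ^ N else μ N x
  have hnew : ∀ N x, ¬ hit N (x / 2) → f (N + 1) x ≤ μ (N + 1) x := by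
    intro N x hx
    simp only [f]
    split_ifs with h
    · rw [hsucc] at h
      rw [div_le_iff₀' (by positivity)]
      exact (h.resolve_left hx).le
    · exact le_rfl
  have hstep := extSum_le_of_step (f := f) (r := 0) (fun N x _ => by
    have e0 : 2 * x / 2 = x := by omega
    have e1 : (2 * x + 1) / 2 = x := by omega
    by_cases h : hit N x
    · have h1 : hit (N + 1) (2 * x) := (hsucc _ _).2 (Or.inl (by rwa [e0]))
      have h2 : hit (N + 1) (2 * x + 1) := (hsucc _ _).2 (Or.inl (by rwa [e1]))
      simp only [f, if_pos h, if_pos h1, if_pos h2]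
      rw [pow_succ]
      apply le_of_eq
      field_simp
      ring
    · have h1 := hnew N (2 * x) (by rwa [e0])
      have h2 := hnew N (2 * x + 1) (by rwa [e1])
      have h3 : f N x = μ N x := if_neg h
      rw [h3, ← hμ.add N x]
      exact add_le_add h1 h2) N
  have h0 : f 0 0 ≤ μ 0 0 := by
    simp only [f]
    split_ifs with h
    · obtain ⟨n, hn, h⟩ := h
      obtain rfl : n = 0 := by omega
      simp at h
      simpa using h.le
    · exact le_rfl
  have h1 : extSum (fun x => truthValue (hit N x) * (c / 2 ^ N)) 0 N ≤ μ 0 0 := by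
    refine (extSum_le_extSum fun x _ => ?_).trans (hstep.trans h0)
    by_cases h : hit N x
    · have h2 : f N x = c / 2 ^ N := if_pos h
      rw [truthValue_of h, one_mul, h2]
    · simp only [truthValue_of_not h, f, if_neg h, zero_mul]
      exact hμ.nonneg _ _
  rw [extSum_mul_right] at h1
  have h2 : extSum (fun x => truthValue (hit N x)) 0 N ≤ μ 0 0 / (c / 2 ^ N) := by
    rwa [le_div_iff₀ (by positivity)]
  refine h2.trans (le_of_eq ?_)
  field_simp

/-- By Ville's inequality the cells of density above `2 ^ k` form a test, up to the constant `μ 0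
0`. -/
theorem MLRandom.exists_bound {z : ℝ} (hz : MLRandom z) (h0 : 0 ≤ z) (h1 : z < 1)
    (hμ : IsCellMeasure μ) (hre : LeftCECells μ) :
    ∃ B : ℕ, ∀ n, 2 ^ n * μ n (dyadicIndex z n) ≤ 2 ^ B := by
  have hW : REPred fun x : ℕ × ℕ × ℕ => (2 : ℝ) ^ x.1 < 2 ^ x.2.1 * μ x.2.1 x.2.2 := by
    have hc : Computable fun x : ℕ × ℕ × ℕ => (x.2.1, x.2.2, 2 ^ x.1, x.2.1) :=
      (Computable.fst.comp Computable.snd).pair ((Computable.snd.comp Computable.snd).pair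
        (Computable.fst.two_pow.pair (Computable.fst.comp Computable.snd)))
    refine (REPred.comp (p := fun x : ℕ × ℕ × ℕ × ℕ => (x.2.2.1 : ℝ) / 2 ^ x.2.2.2 < μ x.1 x.2.1)
      hre hc).of_eq fun x => ?_
    simp only
    rw [div_lt_iff₀' (by positivity)]
    push_cast
    rfl
  obtain ⟨k, -, hk⟩ := hz.exists_avoids h0 h1
    (W := fun k n r => (2 : ℝ) ^ k < 2 ^ n * μ n r) hW (μ 0 0)
    (fun k N => hμ.maximal_ineq (by positivity) N) 0
  exact ⟨k, fun n => not_lt.1 (hk n)⟩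

end Bounded

/-! ### Runs of machines along the cells that contain a real -/

section Machine

variable {σ : Type*}

/-- The state that is reached from `s₀` by applying `step` to the cells that contain the cell
`(n, r)`, in order of decreasing size. -/
def cellRun (step : ℕ → ℕ → σ → σ) (s₀ : σ) : ℕ → ℕ → σ
  | 0, _ => s₀
  | n + 1, r => step (n + 1) r (cellRun step s₀ n (r / 2))

/-- The defining recursion changes the index at each level. Fixing the final index and reading its
prefixes by division makes it an ordinary primitive recursion. -/
theorem computable_cellRun [Primcodable σ] {step : ℕ → ℕ → σ → σ} (s₀ : σ)
    (h : Computable fun x : ℕ × ℕ × σ => step x.1 x.2.1 x.2.2) :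
    Computable fun x : ℕ × ℕ => cellRun step s₀ x.1 x.2 := by
  have h1 : ∀ n r m, m ≤ n → (Nat.rec s₀ (fun j s => step (j + 1) (r / 2 ^ (n - (j + 1))) s) m : σ) =
      cellRun step s₀ m (r / 2 ^ (n - m)) := by
    intro n r m hm
    induction m with
    | zero => rfl
    | succ m ih =>
      have h2 := div_two_pow_div r (n - (m + 1)) 1
      rw [pow_one, show n - (m + 1) + 1 = n - m by omega] at h2
      simp only [cellRun]
      rw [ih (by omega), h2]
  refine (Computable.nat_rec (f := fun x : ℕ × ℕ => x.1) (g := fun _ => s₀)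
    (h := fun x y => step (y.1 + 1) (x.2 / 2 ^ (x.1 - (y.1 + 1))) y.2) Computable.fst
    (Computable.const s₀) ?_).of_eq fun x => ?_
  · have hx : Computable fun x : (ℕ × ℕ) × ℕ × σ => x.1 := Computable.fst
    have hj : Computable fun x : (ℕ × ℕ) × ℕ × σ => x.2.1 + 1 :=
      (Computable.fst.comp Computable.snd).natAdd (.const 1)
    exact Computable.comp_three h hj ((Computable.snd.comp hx).natDiv
      ((Computable.fst.comp hx).natSub hj).two_pow) (Computable.snd.comp Computable.snd)
  · have := h1 x.1 x.2 x.1 le_rfl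
    simpa using this

theorem cellRun_dyadicIndex (step : ℕ → ℕ → σ → σ) (s₀ : σ) (z : ℝ) (n : ℕ) :
    cellRun step s₀ (n + 1) (dyadicIndex z (n + 1)) =
      step (n + 1) (dyadicIndex z (n + 1)) (cellRun step s₀ n (dyadicIndex z n)) := by
  have h := dyadicIndex_div z (Nat.le_succ n)
  rw [show n.succ - n = 1 by omega, pow_one] at h
  simp only [cellRun]
  rw [h]

end Machine

/-! ### Convergence of the approximations along random reals -/

section Upcrossing

variable {μ : ℕ → ℕ → ℝ} {num : ℕ → ℕ → ℕ → ℕ} {st : ℕ → ℕ}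

/-- One step in counting the upcrossings: the first component of the state is `0` while waiting for
a low value, and `1` while waiting for a high value; the second one counts the upcrossings. -/
noncomputable def upStep (lo hi : ℕ → ℕ → Prop) (n r : ℕ) (s : ℕ × ℕ) : ℕ × ℕ :=
  open Classical in
  if s.1 = 0 then (if lo n r then (1, s.2) else (0, s.2))
  else (if hi n r then (0, s.2 + 1) else (1, s.2))

theorem computable_upStep {lo hi : ℕ → ℕ → Prop}
    (hlo : ComputablePred fun x : ℕ × ℕ => lo x.1 x.2)
    (hhi : ComputablePred fun x : ℕ × ℕ => hi x.1 x.2) :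
    Computable fun x : ℕ × ℕ × (ℕ × ℕ) => upStep lo hi x.1 x.2.1 x.2.2 := by
  classical
  have hnr : Computable fun x : ℕ × ℕ × (ℕ × ℕ) => (x.1, x.2.1) :=
    Computable.fst.pair (Computable.fst.comp Computable.snd)
  have hs1 : Computable fun x : ℕ × ℕ × (ℕ × ℕ) => x.2.2.1 :=
    Computable.fst.comp (Computable.snd.comp Computable.snd)
  have hs2 : Computable fun x : ℕ × ℕ × (ℕ × ℕ) => x.2.2.2 :=
    Computable.snd.comp (Computable.snd.comp Computable.snd)
  have hl : ComputablePred fun x : ℕ × ℕ × (ℕ × ℕ) => lo x.1 x.2.1 := hlo.comp hnr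
  have hh : ComputablePred fun x : ℕ × ℕ × (ℕ × ℕ) => hi x.1 x.2.1 := hhi.comp hnr
  exact Computable.if_then_else (ComputablePred.eq hs1 (Computable.const 0))
    (Computable.if_then_else hl ((Computable.const 1).pair hs2) ((Computable.const 0).pair hs2))
    (Computable.if_then_else hh ((Computable.const 0).pair (hs2.natAdd (.const 1)))
      ((Computable.const 1).pair hs2))

theorem snd_le_upStep (lo hi : ℕ → ℕ → Prop) (n r : ℕ) (s : ℕ × ℕ) :
    s.2 ≤ (upStep lo hi n r s).2 := by
  unfold upStep
  split_ifs <;> simp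

/-- A sequence that is infinitely often low and infinitely often high has infinitely many
upcrossings. -/
theorem exists_upcrossings {lo hi : ℕ → ℕ → Prop} {z : ℝ} (hlh : ∀ n r, lo n r → ¬ hi n r)
    (hlo : ∃ᶠ n in atTop, lo n (dyadicIndex z n)) (hhi : ∃ᶠ n in atTop, hi n (dyadicIndex z n))
    (K : ℕ) : ∃ n, K ≤ (cellRun (upStep lo hi) (0, 0) n (dyadicIndex z n)).2 := by
  set s : ℕ → ℕ × ℕ := fun n => cellRun (upStep lo hi) (0, 0) n (dyadicIndex z n)
  have hs : ∀ n, s (n + 1) = upStep lo hi (n + 1) (dyadicIndex z (n + 1)) (s n) := fun n =>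
    cellRun_dyadicIndex _ _ z n
  have hmono : Monotone fun n => (s n).2 := monotone_nat_of_le_succ fun n => by
    rw [hs]
    exact snd_le_upStep _ _ _ _ _
  induction K with
  | zero => exact ⟨0, Nat.zero_le _⟩
  | succ K ih =>
    obtain ⟨N, hN⟩ := ih
    obtain ⟨n₁, hn₁, h₁⟩ := frequently_atTop.1 hlo (N + 1)
    obtain ⟨n₂, hn₂, h₂⟩ := frequently_atTop.1 hhi (n₁ + 1)
    -- After a low value the machine waits for a high one, in either mode: a low value cannot be
    -- high at the same time.
    have hmode : (s n₁).1 = 1 := by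
      obtain ⟨m, rfl⟩ : ∃ m, n₁ = m + 1 := ⟨n₁ - 1, by omega⟩
      rw [hs]
      unfold upStep
      simp [h₁, hlh _ _ h₁]
    -- Until an upcrossing is completed the machine keeps waiting for a high value, so the next high
    -- value completes one.
    have hinv : ∀ d, (s n₁).2 < (s (n₁ + d)).2 ∨
        ((s (n₁ + d)).1 = 1 ∧ (s (n₁ + d)).2 = (s n₁).2) := by
      intro d
      induction d with
      | zero => exact Or.inr ⟨hmode, rfl⟩
      | succ d ih =>
        rcases ih with ih | ⟨ih1, ih2⟩
        · exact Or.inl (ih.trans_le (hmono (by omega)))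
        · rw [← add_assoc, hs]
          unfold upStep
          by_cases h : hi (n₁ + d + 1) (dyadicIndex z (n₁ + d + 1))
          · left
            simp [ih1, h, ih2]
          · right
            simp [ih1, h, ih2]
    have hlt : (s n₁).2 < (s n₂).2 := by
      obtain ⟨d, rfl⟩ : ∃ d, n₂ = n₁ + d + 1 := ⟨n₂ - n₁ - 1, by omega⟩
      rcases hinv d with h | ⟨h3, h4⟩
      · exact h.trans_le (hmono (by omega))
      · rw [hs]
        unfold upStep
        simp [h3, h₂, h4]
    have := hmono (show N ≤ n₁ by omega)
    simp only at this
    exact ⟨n₂, by simp only [s] at *; omega⟩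

/-- The approximation of the density of `μ` on the cells of level `n`. -/
noncomputable def approxDensity (num : ℕ → ℕ → ℕ → ℕ) (st : ℕ → ℕ) (n r : ℕ) : ℝ :=
  2 ^ n * (num n n r / 2 ^ st n)

theorem ApproximatesCells.approxDensity_le (h : ApproximatesCells μ num st) (n r : ℕ) :
    approxDensity num st n r ≤ 2 ^ n * μ n r :=
  mul_le_mul_of_nonneg_left (h.le n n r (lt_level n).le) (by positivity)

theorem approxDensity_nonneg (num : ℕ → ℕ → ℕ → ℕ) (st : ℕ → ℕ) (n r : ℕ) :
    0 ≤ approxDensity num st n r := by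
  unfold approxDensity
  positivity

/-- The `n`-th approximation is already additive from level `n` to level `n + 1`, and the next
approximation is at least as large on both children. -/
theorem ApproximatesCells.submartingale (h : ApproximatesCells μ num st) {n r : ℕ}
    (hr : r < 2 ^ n) : 2 * approxDensity num st n r ≤
      approxDensity num st (n + 1) (2 * r) + approxDensity num st (n + 1) (2 * r + 1) := by
  have hp : 2 ^ (n + 1) = 2 * 2 ^ n := pow_succ' 2 n
  have h1 := h.extSum_num n n 1 r (lt_level n)
  rw [extSum_one] at h1
  have h2 := h.mono n (n + 1) (2 * r) (lt_level n) (by omega)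
  have h3 := h.mono n (n + 1) (2 * r + 1) (lt_level n) (by omega)
  unfold approxDensity
  rw [← h1, pow_succ', add_div]
  have : (0 : ℝ) < 2 ^ n := by positivity
  nlinarith

theorem ApproximatesCells.sum_approxDensity_le (h : ApproximatesCells μ num st) (n : ℕ) :
    extSum (approxDensity num st n) 0 n ≤ 2 ^ n * μ 0 0 := by
  have h1 := h.extSum_num n 0 n 0 (by rw [zero_add]; exact (lt_level n).le)
  rw [zero_add] at h1
  have h2 : extSum (approxDensity num st n) 0 n = 2 ^ n * (num n 0 0 / 2 ^ st n) := by
    unfold approxDensity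
    rw [extSum_mul_left]
    simp only [div_eq_mul_inv]
    rw [extSum_mul_right, h1]
  rw [h2]
  exact mul_le_mul_of_nonneg_left (h.le n 0 0 (Nat.zero_le _)) (by positivity)

/-- Doob's upcrossing inequality for the approximations. -/
theorem ApproximatesCells.upcrossing_ineq (h : ApproximatesCells μ num st)
    {lo hi : ℕ → ℕ → Prop} {a b : ℝ} (ha : 0 ≤ a)
    (hlo : ∀ n r, lo n r ↔ approxDensity num st n r < a)
    (hhi : ∀ n r, hi n r ↔ b < approxDensity num st n r) (N : ℕ) :
    (b - a) * extSum (fun x => ((cellRun (upStep lo hi) (0, 0) N x).2 : ℝ)) 0 N ≤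
      2 ^ N * (a + μ 0 0) := by
  set D := approxDensity num st
  set s := cellRun (upStep lo hi) (0, 0)
  -- `P` is a supermartingale. While a low value is awaited, `a - D` decreases on average; at a low
  -- value a positive term is dropped; at a high value the gain `b - a` is offset by the restored
  -- term `a - D < a - b`. Initially `P ≤ a`, and at the end `(b - a) * count ≤ P + D`.
  let P : ℕ → ℕ → ℝ := fun n x => (b - a) * (s n x).2 + if (s n x).1 = 0 then a - D n x else 0
  -- the change of the potential in one step
  have hchange : ∀ n x, P (n + 1) x ≤ (b - a) * (s n (x / 2)).2 +
      if (s n (x / 2)).1 = 0 then a - D (n + 1) x else 0 := by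
    intro n x
    have hs : s (n + 1) x = upStep lo hi (n + 1) x (s n (x / 2)) := rfl
    simp only [P, hs]
    unfold upStep
    by_cases hm : (s n (x / 2)).1 = 0
    · by_cases hl : lo (n + 1) x
      · simp only [hm, if_true, hl, one_ne_zero, if_false]
        have := (hlo _ _).1 hl
        simp only [D]
        linarith
      · simp [hm, hl]
    · by_cases hh : hi (n + 1) x
      · simp only [hm, if_false, hh, if_true]
        have := (hhi _ _).1 hh
        push_cast
        simp only [D]
        linarith
      · simp [hm, hh]
  have hstep := extSum_le_of_step (f := fun n x => P n x / 2 ^ n) (r := 0) (fun n x hx => by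
    have hx' : x < 2 ^ n := by
      by_contra hge
      have := Nat.div_pos (not_lt.1 hge) (by positivity)
      omega
    have h1 := hchange n (2 * x)
    have h2 := hchange n (2 * x + 1)
    rw [show 2 * x / 2 = x by omega] at h1
    rw [show (2 * x + 1) / 2 = x by omega] at h2
    have h3 := h.submartingale hx'
    have h4 : P (n + 1) (2 * x) + P (n + 1) (2 * x + 1) ≤ 2 * P n x := by
      by_cases hm : (s n x).1 = 0
      · simp only [hm, if_true] at h1 h2
        simp only [P, hm, if_true]
        simp only [P] at h1 h2
        simp only [D] at *
        linarith
      · simp only [hm, if_false] at h1 h2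
        simp only [P, hm, if_false]
        simp only [P] at h1 h2
        linarith
    rw [pow_succ, ← add_div, div_le_div_iff₀ (by positivity) (by positivity)]
    have : (0 : ℝ) < 2 ^ n := by positivity
    nlinarith) N
  have hP0 : P 0 0 ≤ a := by
    have h1 : s 0 0 = (0, 0) := rfl
    have h2 := approxDensity_nonneg num st 0 0
    have h3 : P 0 0 = a - approxDensity num st 0 0 := by simp [P, h1, D]
    linarith
  have hlow : ∀ x, (b - a) * ((s N x).2 : ℝ) ≤ P N x + D N x := by
    intro x
    have h1 := approxDensity_nonneg num st N x
    simp only [P]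
    split_ifs
    · linarith
    · simp only [D]
      linarith
  calc (b - a) * extSum (fun x => ((s N x).2 : ℝ)) 0 N
      = extSum (fun x => (b - a) * ((s N x).2 : ℝ)) 0 N := (extSum_mul_left _ _ _ _).symm
    _ ≤ extSum (fun x => P N x + D N x) 0 N := extSum_le_extSum fun x _ => hlow x
    _ = extSum (P N) 0 N + extSum (D N) 0 N := extSum_fun_add _ _ _ _
    _ ≤ 2 ^ N * a + 2 ^ N * μ 0 0 := by
      refine add_le_add ?_ (h.sum_approxDensity_le N)
      have h1 : extSum (P N) 0 N / 2 ^ N ≤ a := by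
        simp only [div_eq_mul_inv] at hstep ⊢
        rw [extSum_mul_right] at hstep
        refine hstep.trans ?_
        simpa using hP0
      rw [div_le_iff₀ (by positivity)] at h1
      linarith
    _ = _ := by ring

theorem ApproximatesCells.computable_approxDensity_lt (h : ApproximatesCells μ num st) (p q : ℕ) :
    (ComputablePred fun x : ℕ × ℕ => num x.1 x.1 x.2 * 2 ^ x.1 * q < p * 2 ^ st x.1) ∧
    (ComputablePred fun x : ℕ × ℕ => p * 2 ^ st x.1 < num x.1 x.1 x.2 * 2 ^ x.1 * q) := by
  have h1 : Computable fun x : ℕ × ℕ => num x.1 x.1 x.2 * 2 ^ x.1 * q :=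
    ((Computable.comp_three h.computable_num Computable.fst Computable.fst Computable.snd).natMul
      Computable.fst.two_pow).natMul (.const q)
  have h2 : Computable fun x : ℕ × ℕ => p * 2 ^ st x.1 :=
    (Computable.const p).natMul (h.computable_st.comp Computable.fst).two_pow
  exact ⟨.nat_lt h1 h2, .nat_lt h2 h1⟩

theorem approxDensity_lt_iff (num : ℕ → ℕ → ℕ → ℕ) (st : ℕ → ℕ) (n r p : ℕ) {q : ℕ} (hq : 0 < q) :
    (num n n r * 2 ^ n * q < p * 2 ^ st n ↔ approxDensity num st n r < (p : ℝ) / q) ∧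
    (p * 2 ^ st n < num n n r * 2 ^ n * q ↔ (p : ℝ) / q < approxDensity num st n r) := by
  have hq' : (0 : ℝ) < q := by exact_mod_cast hq
  have h1 : approxDensity num st n r = ((num n n r * 2 ^ n : ℕ) : ℝ) / (2 ^ st n : ℕ) := by
    unfold approxDensity
    push_cast
    ring
  have h2 : (0 : ℝ) < (2 ^ st n : ℕ) := by positivity
  rw [h1, div_lt_div_iff₀ h2 hq', div_lt_div_iff₀ hq' h2]
  norm_cast

/-- A bounded sequence that diverges crosses some rational interval infinitely often. The
upcrossings of rational bounds are counted computably, and by Markov's inequality and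
`upcrossing_ineq` the cells with at least `2 ^ k` of them form a test. -/
theorem ApproximatesCells.tendsto_approxDensity (h : ApproximatesCells μ num st) {z : ℝ}
    (hz : MLRandom z) (h0 : 0 ≤ z) (h1 : z < 1)
    {B : ℝ} (hB : ∀ n, 2 ^ n * μ n (dyadicIndex z n) ≤ B) :
    ∃ l, Tendsto (fun n => approxDensity num st n (dyadicIndex z n)) atTop (𝓝 l) := by
  set u : ℕ → ℝ := fun n => approxDensity num st n (dyadicIndex z n)
  have hu0 : ∀ n, 0 ≤ u n := fun n => approxDensity_nonneg _ _ _ _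
  have huB : ∀ n, u n ≤ B := fun n => (h.approxDensity_le _ _).trans (hB n)
  refine tendsto_of_no_upcrossings (s := Set.range ((↑) : ℚ → ℝ)) Rat.denseRange_cast ?_
    (isBoundedUnder_of ⟨B, huB⟩) (isBoundedUnder_of ⟨0, hu0⟩)
  rintro _ ⟨a, rfl⟩ _ ⟨b, rfl⟩ hab ⟨hlo, hhi⟩
  have ha : 0 ≤ a := by
    obtain ⟨n, hn⟩ := hlo.exists
    exact_mod_cast ((hu0 n).trans hn.le)
  have hb : 0 ≤ b := ha.trans (by exact_mod_cast hab.le)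
  have hden : 0 < a.den * b.den := Nat.mul_pos a.den_pos b.den_pos
  have hda : ((a.den : ℕ) : ℝ) ≠ 0 := by exact_mod_cast a.den_nz
  have hdb : ((b.den : ℕ) : ℝ) ≠ 0 := by exact_mod_cast b.den_nz
  have hnum : ∀ c : ℚ, 0 ≤ c → (c : ℝ) = (c.num.toNat : ℝ) / c.den := fun c hc => by
    have h1 : ((c.num.toNat : ℤ) : ℝ) = c.num := by
      rw [Int.toNat_of_nonneg (Rat.num_nonneg.2 hc)]
    rw [Int.cast_natCast] at h1
    rw [h1]
    exact Rat.cast_def c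
  -- A common denominator turns both comparisons with the approximate density into inequalities
  -- between natural numbers.
  have haq : (a : ℝ) = ((a.num.toNat * b.den : ℕ) : ℝ) / (a.den * b.den : ℕ) := by
    rw [hnum a ha]
    push_cast
    field_simp
  have hbq : (b : ℝ) = ((b.num.toNat * a.den : ℕ) : ℝ) / (a.den * b.den : ℕ) := by
    rw [hnum b hb]
    push_cast
    field_simp
  set q := a.den * b.den
  set pa := a.num.toNat * b.den
  set pb := b.num.toNat * a.den
  let lo : ℕ → ℕ → Prop := fun n r => num n n r * 2 ^ n * q < pa * 2 ^ st n
  let hi : ℕ → ℕ → Prop := fun n r => pb * 2 ^ st n < num n n r * 2 ^ n * q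
  have hlo' : ∀ n r, lo n r ↔ approxDensity num st n r < a := fun n r => by
    rw [haq]
    exact (approxDensity_lt_iff num st n r pa hden).1
  have hhi' : ∀ n r, hi n r ↔ (b : ℝ) < approxDensity num st n r := fun n r => by
    rw [hbq]
    exact (approxDensity_lt_iff num st n r pb hden).2
  have hrun : Computable fun x : ℕ × ℕ => cellRun (upStep lo hi) (0, 0) x.1 x.2 :=
    computable_cellRun (0, 0) (computable_upStep (h.computable_approxDensity_lt pa q).1
      (h.computable_approxDensity_lt pb q).2)
  let W : ℕ → ℕ → ℕ → Prop := fun k n r => 2 ^ k ≤ (cellRun (upStep lo hi) (0, 0) n r).2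
  have hW : REPred fun x : ℕ × ℕ × ℕ => W x.1 x.2.1 x.2.2 :=
    (ComputablePred.nat_le Computable.fst.two_pow
      (Computable.snd.comp (hrun.comp Computable.snd))).to_re
  have hmono : ∀ N n x, n ≤ N → (cellRun (upStep lo hi) (0, 0) n (x / 2 ^ (N - n))).2 ≤
      (cellRun (upStep lo hi) (0, 0) N x).2 := by
    intro N n x hn
    induction N generalizing x with
    | zero =>
      obtain rfl : n = 0 := by omega
      simp
    | succ N ih =>
      rcases Nat.lt_or_eq_of_le hn with hn | rfl
      · have h2 := div_two_pow_div x 1 (N - n)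
        rw [pow_one, show 1 + (N - n) = N + 1 - n by omega] at h2
        rw [← h2]
        exact (ih (x / 2) (by omega)).trans (snd_le_upStep _ _ _ _ _)
      · simp
  have hba : (0 : ℝ) < b - a := sub_pos.2 hab
  obtain ⟨k, -, hk⟩ := hz.exists_avoids h0 h1 hW ((a + μ 0 0) / (b - a)) (fun k N => by
    have h2 := h.upcrossing_ineq (by exact_mod_cast ha : (0 : ℝ) ≤ a) hlo' hhi' N
    have h3 : extSum (fun x => truthValue (∃ n ≤ N, W k n (x / 2 ^ (N - n)))) 0 N ≤
        extSum (fun x => ((cellRun (upStep lo hi) (0, 0) N x).2 : ℝ) * (2 ^ k)⁻¹) 0 N := by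
      refine extSum_le_extSum fun x _ => ?_
      by_cases hx : ∃ n ≤ N, W k n (x / 2 ^ (N - n))
      · rw [truthValue_of hx, ← div_eq_mul_inv, le_div_iff₀ (by positivity), one_mul]
        obtain ⟨n, hn, hx⟩ := hx
        exact_mod_cast hx.trans (hmono N n x hn)
      · rw [truthValue_of_not hx]
        positivity
    rw [extSum_mul_right] at h3
    refine h3.trans ?_
    rw [← le_div_iff₀' hba] at h2
    refine (mul_le_mul_of_nonneg_right h2 (by positivity)).trans (le_of_eq ?_)
    ring) 0
  obtain ⟨n, hn⟩ := exists_upcrossings (lo := lo) (hi := hi) (z := z) (fun n r h1 h2 => by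
    rw [hlo'] at h1
    rw [hhi'] at h2
    linarith) (hlo.mono fun n hn => (hlo' _ _).2 hn) (hhi.mono fun n hn => (hhi' _ _).2 hn) (2 ^ k)
  exact hk n hn

end Upcrossing

/-! ### The approximations are asymptotically exact at random density-one points -/

section Holes

theorem extSum_truthValue_mod_lt (c r w : ℕ) :
    extSum (fun x => truthValue (x % 2 ^ w < c)) r w = (min c (2 ^ w) : ℕ) := by
  have h1 : ∀ j ∈ Finset.range (2 ^ w), truthValue ((r * 2 ^ w + j) % 2 ^ w < c) =
      if j < c then (1 : ℝ) else 0 := fun j hj => by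
    rw [Nat.mul_add_mod_self_right, Nat.mod_eq_of_lt (Finset.mem_range.1 hj)]
    by_cases h : j < c
    · rw [truthValue_of h, if_pos h]
    · rw [truthValue_of_not h, if_neg h]
  rw [extSum, Finset.sum_congr rfl h1, Finset.sum_boole]
  congr 1
  have h2 : (Finset.range (2 ^ w)).filter (· < c) = Finset.range (min c (2 ^ w)) := by
    ext j
    simp only [Finset.mem_filter, Finset.mem_range]
    omega
  rw [h2, Finset.card_range]

theorem lt_two_pow_of_div_eq {x d r n : ℕ} (h : x / 2 ^ d = r) (hr : r < 2 ^ n) :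
    x < 2 ^ (n + d) := by
  rw [pow_add]
  exact Nat.lt_mul_of_div_lt (h ▸ hr) (by positivity)

theorem exists_le_div_of_div {W : ℕ → ℕ → Prop} {d w y : ℕ}
    (h : ∃ e ≤ d, W e (y / 2 ^ w / 2 ^ (d - e))) : ∃ e ≤ d + w, W e (y / 2 ^ (d + w - e)) := by
  obtain ⟨e, he, h⟩ := h
  refine ⟨e, by omega, ?_⟩
  rwa [div_two_pow_div, show w + (d - e) = d + w - e by omega] at h

variable {μ : ℕ → ℕ → ℝ} {num : ℕ → ℕ → ℕ → ℕ} {st : ℕ → ℕ}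

/-- The number of subcells that are enumerated into the hole at stage `i` inside the cell of level
`level i` and index `r`. -/
def chunkSize (num : ℕ → ℕ → ℕ → ℕ) (st : ℕ → ℕ) (k i r : ℕ) : ℕ :=
  (num (i + 1) (level i) r - num i (level i) r * 2 ^ (st (i + 1) - st i)) * 2 ^ level (i + 1) /
    2 ^ (st (i + 1) + k)

/-- The cells that are enumerated into the hole: the increase of the measure of a cell at stage `i`
is copied, scaled by `2⁻ᵏ`, to the Lebesgue measure of an initial segment of that cell. -/
def InChunk (num : ℕ → ℕ → ℕ → ℕ) (st : ℕ → ℕ) (k n x : ℕ) : Prop :=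
  ∃ i < n, n = level (i + 1) ∧ x % 2 ^ (2 * i + 3) < chunkSize num st k i (x / 2 ^ (2 * i + 3))

/-- The search for the stage `i` is bounded: `n = level (i + 1)` forces `i < n`. -/
theorem ApproximatesCells.computable_inChunk (h : ApproximatesCells μ num st) :
    ComputablePred fun x : ℕ × ℕ × ℕ => InChunk num st x.1 x.2.1 x.2.2 := by
  have hlevel : Computable level := (Computable.id.natAdd (.const 1)).natPow (.const 2)
  have hsize : Computable fun x : ℕ × ℕ × ℕ => chunkSize num st x.1 x.2.1 x.2.2 := by
    have hi : Computable fun x : ℕ × ℕ × ℕ => x.2.1 := Computable.fst.comp Computable.snd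
    have hi' : Computable fun x : ℕ × ℕ × ℕ => x.2.1 + 1 := hi.natAdd (.const 1)
    have hr : Computable fun x : ℕ × ℕ × ℕ => x.2.2 := Computable.snd.comp Computable.snd
    have hs := h.computable_st.comp hi
    have hs' := h.computable_st.comp hi'
    exact (((Computable.comp_three h.computable_num hi' (hlevel.comp hi) hr).natSub
      ((Computable.comp_three h.computable_num hi (hlevel.comp hi) hr).natMul
        (hs'.natSub hs).two_pow)).natMul (hlevel.comp hi').two_pow).natDiv
      (hs'.natAdd Computable.fst).two_pow
  have hk : Computable fun x : (ℕ × ℕ × ℕ) × ℕ => x.1.1 := Computable.fst.comp Computable.fst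
  have hn : Computable fun x : (ℕ × ℕ × ℕ) × ℕ => x.1.2.1 :=
    Computable.fst.comp (Computable.snd.comp Computable.fst)
  have hx : Computable fun x : (ℕ × ℕ × ℕ) × ℕ => x.1.2.2 :=
    Computable.snd.comp (Computable.snd.comp Computable.fst)
  have hw : Computable fun x : (ℕ × ℕ × ℕ) × ℕ => 2 ^ (2 * x.2 + 3) :=
    (((Computable.const 2).natMul Computable.snd).natAdd (.const 3)).two_pow
  exact ComputablePred.exists_lt (p := fun (x : ℕ × ℕ × ℕ) i => x.2.1 = level (i + 1) ∧
    x.2.2 % 2 ^ (2 * i + 3) < chunkSize num st x.1 i (x.2.2 / 2 ^ (2 * i + 3)))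
    ((ComputablePred.eq hn (hlevel.comp (Computable.snd.natAdd (.const 1)))).and
      (ComputablePred.nat_lt (hx.natMod hw)
        (Computable.comp_three hsize hk Computable.snd (hx.natDiv hw))))
    (Computable.fst.comp Computable.snd)

/-- The increase of the approximation from stage `i` to stage `i + 1`. -/
noncomputable def increase (num : ℕ → ℕ → ℕ → ℕ) (st : ℕ → ℕ) (i m r : ℕ) : ℝ :=
  num (i + 1) m r / 2 ^ st (i + 1) - num i m r / 2 ^ st i

/-- The chunk size is the floor of the scaled growth, counted in cells of level `level (i + 1)`.
Monotonicity of the approximation makes the truncated subtraction exact. -/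
theorem ApproximatesCells.chunkSize_bounds (h : ApproximatesCells μ num st) (k : ℕ) {i r : ℕ}
    (hr : r < 2 ^ level i) :
    (chunkSize num st k i r : ℝ) ≤ increase num st i (level i) r * 2 ^ level (i + 1) / 2 ^ k ∧
    increase num st i (level i) r * 2 ^ level (i + 1) / 2 ^ k < chunkSize num st k i r + 1 := by
  have h1 := h.mono i (level i) r le_rfl hr
  have h2 : (2 : ℝ) ^ st (i + 1) = 2 ^ (st (i + 1) - st i) * 2 ^ st i := by
    rw [← pow_add, Nat.sub_add_cancel (h.st_lt i).le]
  have h3 : num i (level i) r * 2 ^ (st (i + 1) - st i) ≤ num (i + 1) (level i) r := by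
    rw [div_le_div_iff₀ (by positivity) (by positivity), h2, ← mul_assoc] at h1
    have := le_of_mul_le_mul_right h1 (by positivity)
    exact_mod_cast this
  set v := num (i + 1) (level i) r - num i (level i) r * 2 ^ (st (i + 1) - st i)
  have h4 : increase num st i (level i) r = (v : ℝ) / 2 ^ st (i + 1) := by
    simp only [v]
    rw [Nat.cast_sub h3, increase, h2]
    push_cast
    field_simp
  have h5 : increase num st i (level i) r * 2 ^ level (i + 1) / 2 ^ k =
      ((v * 2 ^ level (i + 1) : ℕ) : ℝ) / ((2 ^ (st (i + 1) + k) : ℕ) : ℝ) := by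
    rw [h4]
    push_cast
    rw [pow_add]
    field_simp
  rw [h5]
  constructor
  · exact Nat.cast_div_le
  · rw [div_lt_iff₀ (by positivity)]
    have := Nat.lt_div_mul_add (a := v * 2 ^ level (i + 1)) (b := 2 ^ (st (i + 1) + k))
      (by positivity)
    have h6 : v * 2 ^ level (i + 1) < (chunkSize num st k i r + 1) * 2 ^ (st (i + 1) + k) := by
      unfold chunkSize
      rw [add_mul, one_mul]
      exact this
    exact_mod_cast h6

theorem ApproximatesCells.extSum_increase (h : ApproximatesCells μ num st) {i m d : ℕ} (r : ℕ)
    (hm : m + d ≤ level i) :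
    extSum (increase num st i (m + d)) r d = increase num st i m r := by
  have h1 := h.extSum_num i m d r hm
  have h2 := h.extSum_num (i + 1) m d r (hm.trans (level_mono (Nat.le_succ i)))
  unfold increase
  rw [extSum_fun_sub]
  simp only [div_eq_mul_inv]
  rw [extSum_mul_right, extSum_mul_right, h1, h2]

/-- The chunks of stage `i` have total Lebesgue measure at most `2⁻ᵏ` times the total growth at that
stage, and the growths telescope to at most `μ 0 0`. -/
theorem ApproximatesCells.sum_inChunk_le (h : ApproximatesCells μ num st) (k N : ℕ) :
    extSum (fun x => truthValue (∃ n ≤ N, InChunk num st k n (x / 2 ^ (N - n)))) 0 N ≤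
      μ 0 0 / 2 ^ k * 2 ^ N := by
  have hmono : ∀ i j, i ≤ j → (num i 0 0 : ℝ) / 2 ^ st i ≤ num j 0 0 / 2 ^ st j := fun i j hij =>
    monotone_nat_of_le_succ (f := fun i => (num i 0 0 : ℝ) / 2 ^ st i)
      (fun i => h.mono i 0 0 (Nat.zero_le _) (by simp)) hij
  have hnew : ∀ i, extSum (fun x => truthValue (InChunk num st k (level (i + 1)) x)) 0
      (level (i + 1)) ≤ increase num st i 0 0 / 2 ^ k * 2 ^ level (i + 1) := by
    intro i
    have hchunk : ∀ x, InChunk num st k (level (i + 1)) x →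
        x % 2 ^ (2 * i + 3) < chunkSize num st k i (x / 2 ^ (2 * i + 3)) := by
      rintro x ⟨j, -, hj, hx⟩
      obtain rfl : i = j := by
        have h1 : StrictMono level := strictMono_nat_of_lt_succ fun i => by
          rw [level_succ]
          omega
        have := h1.injective hj
        omega
      exact hx
    have h1 : extSum (fun x => truthValue (InChunk num st k (level (i + 1)) x)) 0 (level (i + 1)) ≤
        extSum (fun r => increase num st i (level i) r * (2 ^ level (i + 1) / 2 ^ k)) 0
          (level i) := by
      nth_rw 2 [level_succ]
      rw [extSum_add]
      refine extSum_le_extSum fun r hr => ?_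
      have hr' : r < 2 ^ level i := by
        have := lt_two_pow_of_div_eq (n := 0) hr (by simp)
        rwa [zero_add] at this
      refine (extSum_le_extSum (g := fun x => truthValue (x % 2 ^ (2 * i + 3) <
        chunkSize num st k i r)) fun x hx => ?_).trans ?_
      · exact truthValue_mono fun hc => hx ▸ hchunk x hc
      · rw [extSum_truthValue_mod_lt, ← mul_div_assoc]
        refine le_trans ?_ (h.chunkSize_bounds k hr').1
        exact_mod_cast min_le_left _ _
    have h2 := h.extSum_increase (i := i) (m := 0) (d := level i) 0 (by simp)
    rw [zero_add] at h2
    rw [extSum_mul_right, h2] at h1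
    refine h1.trans (le_of_eq ?_)
    ring
  -- For `N < level (j + 1)` only stages before `j` have enumerated chunks, so the mass of the
  -- `j`-th approximation already bounds the measure. New cells appear only when `N` reaches one of
  -- the levels `level (i + 1)`.
  have hmain : ∀ N j, N < level (j + 1) →
      extSum (fun x => truthValue (∃ n ≤ N, InChunk num st k n (x / 2 ^ (N - n)))) 0 N ≤
      num j 0 0 / 2 ^ st j / 2 ^ k * 2 ^ N := by
    intro N
    induction N with
    | zero =>
      intro j _
      rw [extSum_zero, truthValue_of_not]
      · positivity
      · rintro ⟨n, hn, i, hi, -⟩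
        omega
    | succ N ih =>
      intro j hj
      have h1 : ∀ x, truthValue (∃ n ≤ N + 1, InChunk num st k n (x / 2 ^ (N + 1 - n))) ≤
          truthValue (∃ n ≤ N, InChunk num st k n (x / 2 / 2 ^ (N - n))) +
            truthValue (InChunk num st k (N + 1) x) := by
        intro x
        by_cases hx : ∃ n ≤ N + 1, InChunk num st k n (x / 2 ^ (N + 1 - n))
        · rw [truthValue_of hx]
          rcases (exists_le_succ_div_iff (W := InChunk num st k)).1 hx with hx | hx
          · rw [truthValue_of hx]
            linarith [truthValue_nonneg (InChunk num st k (N + 1) x)]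
          · rw [truthValue_of hx]
            linarith [truthValue_nonneg (∃ n ≤ N, InChunk num st k n (x / 2 / 2 ^ (N - n)))]
        · rw [truthValue_of_not hx]
          exact add_nonneg (truthValue_nonneg _) (truthValue_nonneg _)
      have h2 := extSum_le_extSum (r := 0) (d := N + 1) fun x _ => h1 x
      rw [extSum_fun_add] at h2
      have h3 : extSum (fun x => truthValue (∃ n ≤ N, InChunk num st k n (x / 2 / 2 ^ (N - n)))) 0
          (N + 1) = 2 *
          extSum (fun x => truthValue (∃ n ≤ N, InChunk num st k n (x / 2 ^ (N - n)))) 0 N := by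
        rw [extSum_succ, ← extSum_mul_left]
        refine extSum_congr fun x _ => ?_
        rw [show 2 * x / 2 = x by omega, show (2 * x + 1) / 2 = x by omega]
        ring
      rw [h3] at h2
      refine h2.trans ?_
      by_cases hN : ∃ i, N + 1 = level (i + 1)
      · obtain ⟨i, hi⟩ := hN
        have hij : i + 1 ≤ j := by
          by_contra hlt
          have := level_mono (show j + 1 ≤ i + 1 by omega)
          omega
        have h4 := ih i (by omega)
        have h5 := hnew i
        rw [← hi] at h5
        have h6 := hmono (i + 1) j hij
        have h7 : (0 : ℝ) < (2 ^ k)⁻¹ * 2 ^ (N + 1) := by positivity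
        have h8 := mul_le_mul_of_nonneg_right h6 h7.le
        unfold increase at h5
        rw [pow_succ (2 : ℝ) N] at *
        simp only [div_eq_mul_inv] at *
        linarith
      · have h4 := ih j (by omega)
        have h5 : extSum (fun x => truthValue (InChunk num st k (N + 1) x)) 0 (N + 1) = 0 := by
          rw [extSum_congr (g := fun _ => 0), extSum_const, mul_zero]
          rintro x -
          refine truthValue_of_not ?_
          rintro ⟨i, -, hi, -⟩
          exact hN ⟨i, hi⟩
        rw [h5, pow_succ (2 : ℝ) N]
        linarith
  refine (hmain N N ?_).trans ?_
  · have := lt_level (N + 1)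
    omega
  · have := h.le N 0 0 (Nat.zero_le _)
    gcongr

/-- A hole for the cells of level `n + d` that lie in a fixed cell of level `n`. -/
def InHole (H : ℕ → ℕ → Prop) (n d x : ℕ) : Prop := ∃ e ≤ d, H (n + e) (x / 2 ^ (d - e))

theorem inHole_succ {H : ℕ → ℕ → Prop} {n d x : ℕ} :
    InHole H n (d + 1) x ↔ InHole H n d (x / 2) ∨ H (n + (d + 1)) x :=
  exists_le_succ_div_iff (W := fun e => H (n + e))

theorem inHole_add {H : ℕ → ℕ → Prop} {n d w y : ℕ} (h : InHole H n d (y / 2 ^ w)) :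
    InHole H n (d + w) y :=
  exists_le_div_of_div (W := fun e => H (n + e)) h

theorem inHole_self {H : ℕ → ℕ → Prop} {n d x : ℕ} (h : H (n + d) x) : InHole H n d x :=
  ⟨d, le_rfl, by simpa using h⟩

/-- A measure whose density exceeds `c` only inside a hole gives the hole at most `2 * c` times its
Lebesgue measure. -/
theorem IsCellMeasure.extSum_hole_le (hμ : IsCellMeasure μ) {H : ℕ → ℕ → Prop} {c : ℝ}
    (hc : 0 ≤ c) (hH : ∀ n x, c < 2 ^ n * μ n x → H n x) {n r : ℕ} (hr : 2 ^ n * μ n r ≤ c)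
    (d : ℕ) :
    extSum (fun x => truthValue (InHole H n d x) * μ (n + d) x) r d ≤
      2 * c / 2 ^ (n + d) * extSum (fun x => truthValue (InHole H n d x)) r d := by
  -- Mass of the hole minus `2 * c` times its Lebesgue measure does not increase under splitting.
  -- Inside the hole it is additive; a cell outside has density at most `c`, so a child entering the
  -- hole has density at most `2 * c` and contributes nothing positive.
  have hstep := extSum_le_of_step (r := r)
    (f := fun d x => truthValue (InHole H n d x) * (μ (n + d) x - 2 * c / 2 ^ (n + d)))
    (fun d x _ => by
      have e0 : 2 * x / 2 = x := by omega
      have e1 : (2 * x + 1) / 2 = x := by omega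
      have hadd := hμ.add (n + d) x
      have hpow : 2 * c / 2 ^ (n + (d + 1)) = c / 2 ^ (n + d) := by
        rw [← add_assoc, pow_succ]
        field_simp
      simp only [← add_assoc] at hpow ⊢
      by_cases hx : InHole H n d x
      · have h0 : InHole H n (d + 1) (2 * x) := inHole_succ.2 (Or.inl (by rwa [e0]))
        have h1 : InHole H n (d + 1) (2 * x + 1) := inHole_succ.2 (Or.inl (by rwa [e1]))
        rw [truthValue_of hx, truthValue_of h0, truthValue_of h1, hpow, ← hadd]
        apply le_of_eq
        ring
      · have hle : μ (n + d) x ≤ c / 2 ^ (n + d) := by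
          rw [le_div_iff₀' (by positivity)]
          by_contra hlt
          exact hx (inHole_self (hH _ _ (not_le.1 hlt)))
        have hchild : ∀ y, μ (n + d + 1) y ≤ c / 2 ^ (n + d) →
            truthValue (InHole H n (d + 1) y) * (μ (n + d + 1) y - c / 2 ^ (n + d)) ≤ 0 :=
          fun y hy => mul_nonpos_of_nonneg_of_nonpos (truthValue_nonneg _) (by linarith)
        have h0 := hchild (2 * x) (by linarith [hμ.nonneg (n + d + 1) (2 * x + 1)])
        have h1 := hchild (2 * x + 1) (by linarith [hμ.nonneg (n + d + 1) (2 * x)])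
        rw [truthValue_of_not hx, zero_mul, hpow]
        linarith) d
  have hbase : truthValue (InHole H n 0 r) * (μ (n + 0) r - 2 * c / 2 ^ (n + 0)) ≤ 0 := by
    refine mul_nonpos_of_nonneg_of_nonpos (truthValue_nonneg _) ?_
    rw [← le_div_iff₀' (by positivity)] at hr
    have : 0 ≤ c / 2 ^ n := by positivity
    rw [add_zero, mul_div_assoc]
    linarith
  have h1 := hstep.trans hbase
  simp only [mul_sub] at h1
  rw [extSum_fun_sub, extSum_mul_right] at h1
  linarith

/-- Growth inside the hole is counted by the current mass there. Growth on a cell outside the hole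
is paid for by `2 ^ k` times the Lebesgue measure of its new chunk. That chunk fits in the cell
because the density there is at most `2 ^ B ≤ 2 ^ k`. The last term on the right collects the
rounding errors. -/
theorem ApproximatesCells.increase_le_hole (h : ApproximatesCells μ num st)
    {H : ℕ → ℕ → Prop} {B k : ℕ} (hBk : B ≤ k)
    (hH : ∀ n x, (2 : ℝ) ^ B < 2 ^ n * μ n x → H n x) (hC : ∀ n x, InChunk num st k n x → H n x)
    {n r : ℕ} (hr : r < 2 ^ n) {T : ℕ} (hT : n ≤ T) :
    (num T n r : ℝ) / 2 ^ st T - num n n r / 2 ^ st n ≤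
      extSum (fun x => truthValue (InHole H n (level T - n) x) *
        (num T (level T) x / 2 ^ st T + 2 ^ k / 2 ^ level T)) r (level T - n) +
      2 ^ k / 2 ^ n * (1 / 2 ^ n - 1 / 2 ^ T) := by
  have hlev : ∀ T, n ≤ T → n ≤ level T := fun T hT => hT.trans (lt_level T).le
  -- The potential at stage `T`: approximate mass plus `2 ^ k` times Lebesgue measure, restricted to
  -- the hole as it stands at level `level T`.
  let G : ℕ → ℕ → ℝ := fun T x => truthValue (InHole H n (level T - n) x) *
        (num T (level T) x / 2 ^ st T + 2 ^ k / 2 ^ level T)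
  have hG0 : ∀ T x, 0 ≤ G T x := fun T x => mul_nonneg (truthValue_nonneg _) (by positivity)
  -- the contribution of a single cell
  have hcell : ∀ T, n ≤ T → ∀ x, x < 2 ^ level T →
      G T x + (increase num st T (level T) x - 2 ^ k / 2 ^ level (T + 1)) ≤
        extSum (G (T + 1)) x (2 * T + 3) := by
    intro T hT x hx
    have hd : level (T + 1) - n = level T - n + (2 * T + 3) := by
      have := hlev T hT
      rw [level_succ]
      omega
    have hpow : (2 : ℝ) ^ (2 * T + 3) * (2 ^ k / 2 ^ level (T + 1)) = 2 ^ k / 2 ^ level T := by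
      rw [level_succ, pow_add 2 (level T)]
      field_simp
    by_cases hhole : InHole H n (level T - n) x
    · have h1 : ∀ y, y / 2 ^ (2 * T + 3) = x → G (T + 1) y =
          num (T + 1) (level (T + 1)) y * (2 ^ st (T + 1))⁻¹ + 2 ^ k / 2 ^ level (T + 1) := by
        intro y hy
        have h2 : InHole H n (level (T + 1) - n) y := by
          rw [hd]
          exact inHole_add (hy ▸ hhole)
        simp only [G]
        rw [truthValue_of h2, one_mul, ← div_eq_mul_inv]
      have h3 := h.extSum_num (T + 1) (level T) (2 * T + 3) x (level_succ T).ge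
      rw [← level_succ] at h3
      rw [extSum_congr h1, extSum_fun_add, extSum_mul_right, h3, extSum_const, hpow]
      simp only [G]
      rw [truthValue_of hhole, one_mul, increase]
      have : (0 : ℝ) < 2 ^ k / 2 ^ level (T + 1) := by positivity
      rw [div_eq_mul_inv (num (T + 1) (level T) x : ℝ)]
      linarith
    · have hGx : G T x = 0 := by
        simp only [G]
        rw [truthValue_of_not hhole, zero_mul]
      have hmu : 2 ^ level T * μ (level T) x ≤ 2 ^ B := by
        by_contra hlt
        refine hhole (inHole_self ?_)
        rw [Nat.add_sub_cancel' (hlev T hT)]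
        exact hH _ _ (not_le.1 hlt)
      have hinc : increase num st T (level T) x ≤ μ (level T) x := by
        have h1 := h.le (T + 1) (level T) x (level_mono (Nat.le_succ T))
        have h2 : (0 : ℝ) ≤ num T (level T) x / 2 ^ st T := by positivity
        unfold increase
        linarith
      obtain ⟨hb1, hb2⟩ := h.chunkSize_bounds k hx
      -- No part of the chunk is cut off: its size does not exceed the number of subcells of `x` at
      -- level `level (T + 1)`.
      have hsize : chunkSize num st k T x ≤ 2 ^ (2 * T + 3) := by
        have h1 : increase num st T (level T) x * 2 ^ level (T + 1) / 2 ^ k ≤ 2 ^ (2 * T + 3) := by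
          rw [div_le_iff₀ (by positivity), level_succ, pow_add]
          have h2 : (2 : ℝ) ^ B ≤ 2 ^ k := pow_le_pow_right₀ (by norm_num) hBk
          have h3 : 2 ^ level T * increase num st T (level T) x ≤ 2 ^ k :=
            (mul_le_mul_of_nonneg_left hinc (by positivity)).trans (hmu.trans h2)
          have h4 : (0 : ℝ) ≤ 2 ^ (2 * T + 3) := by positivity
          have h5 := mul_le_mul_of_nonneg_left h3 h4
          linarith
        exact_mod_cast hb1.trans h1
      have h1 : extSum (fun y => truthValue (y % 2 ^ (2 * T + 3) < chunkSize num st k T x) *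
          (2 ^ k / 2 ^ level (T + 1))) x (2 * T + 3) ≤ extSum (G (T + 1)) x (2 * T + 3) := by
        refine extSum_le_extSum fun y hy => ?_
        by_cases hy' : y % 2 ^ (2 * T + 3) < chunkSize num st k T x
        · have h2 : InHole H n (level (T + 1) - n) y := by
            refine inHole_self ?_
            rw [Nat.add_sub_cancel' (hlev (T + 1) (by omega))]
            exact hC _ _ ⟨T, by have := lt_level (T + 1); omega, rfl, by rwa [hy]⟩
          simp only [G]
          rw [truthValue_of hy', truthValue_of h2, one_mul, one_mul]
          have : (0 : ℝ) ≤ num (T + 1) (level (T + 1)) y / 2 ^ st (T + 1) := by positivity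
          linarith
        · rw [truthValue_of_not hy', zero_mul]
          exact hG0 _ _
      rw [extSum_mul_right, extSum_truthValue_mod_lt, min_eq_left hsize] at h1
      refine le_trans ?_ h1
      rw [hGx, zero_add]
      rw [div_lt_iff₀ (by positivity)] at hb2
      have h2 : increase num st T (level T) x ≤
          (chunkSize num st k T x + 1) * (2 ^ k / 2 ^ level (T + 1)) := by
        rw [← mul_div_assoc, le_div_iff₀ (by positivity)]
        exact hb2.le
      linarith
  induction T, hT using Nat.le_induction with
  | base =>
    simp only [sub_self, mul_zero, add_zero]
    exact extSum_nonneg (hG0 n) _ _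
  | succ T hT ih =>
    have hd : level (T + 1) - n = level T - n + (2 * T + 3) := by
      have := hlev T hT
      rw [level_succ]
      omega
    have h1 : extSum (fun x => G T x + (increase num st T (level T) x -
        2 ^ k / 2 ^ level (T + 1))) r (level T - n) ≤ extSum (G (T + 1)) r (level (T + 1) - n) := by
      rw [hd, extSum_add]
      refine extSum_le_extSum fun x hx => hcell T hT x ?_
      have := lt_two_pow_of_div_eq hx hr
      rwa [Nat.add_sub_cancel' (hlev T hT)] at this
    have h2 := h.extSum_increase (i := T) (m := n) (d := level T - n) r
      (by have := hlev T hT; omega)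
    rw [Nat.add_sub_cancel' (hlev T hT)] at h2
    rw [extSum_fun_add, extSum_fun_sub, h2, extSum_const] at h1
    -- The rounding error of stage `T`, summed over the cells of level `level T`, carries the factor
    -- `2 ^ (-(2 * T + 3))`, which the telescoping difference dominates.
    have h3 : (2 : ℝ) ^ (level T - n) * (2 ^ k / 2 ^ level (T + 1)) ≤
        2 ^ k / 2 ^ n * (1 / 2 ^ T - 1 / 2 ^ (T + 1)) := by
      have h4 : (2 : ℝ) ^ (level T - n) * (2 ^ k / 2 ^ level (T + 1)) =
          2 ^ k / 2 ^ n * (1 / 2 ^ (2 * T + 3)) := by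
        have h5 : (2 : ℝ) ^ level (T + 1) = 2 ^ n * 2 ^ (level T - n) * 2 ^ (2 * T + 3) := by
          rw [← pow_add, ← pow_add, Nat.add_sub_cancel' (hlev T hT), ← level_succ]
        rw [h5]
        field_simp
      rw [h4]
      refine mul_le_mul_of_nonneg_left ?_ (by positivity)
      have h6 : (1 : ℝ) / 2 ^ T - 1 / 2 ^ (T + 1) = 1 / 2 ^ (T + 1) := by
        rw [pow_succ]
        field_simp
        norm_num
      rw [h6]
      exact one_div_le_one_div_of_le (by positivity)
        (pow_le_pow_right₀ (by norm_num) (by omega))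
    have h7 : increase num st T n r =
        num (T + 1) n r / 2 ^ st (T + 1) - num T n r / 2 ^ st T := rfl
    rw [h7] at h1
    change _ ≤ extSum (G T) r _ + _ at ih
    change _ ≤ extSum (G (T + 1)) r _ + _
    simp only [mul_sub] at ih h3 ⊢
    linarith

/-- The density-one hypothesis is applied to the complement of the hole, which contains `z` once `B`
and then `k ≥ B` are chosen by randomness. Near `z` the hole is thin, so little mass can arrive
after stage `n`. -/
theorem ApproximatesCells.tendsto_sub_approxDensity (h : ApproximatesCells μ num st)
    (hμ : IsCellMeasure μ) (hre : LeftCECells μ) {z : ℝ} (hz : MLRandom z) (h0 : 0 ≤ z)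
    (h1 : z < 1) (hdens : DyadicDensityOnePoint z) :
    Tendsto (fun n => 2 ^ n * μ n (dyadicIndex z n) - approxDensity num st n (dyadicIndex z n))
      atTop (𝓝 0) := by
  obtain ⟨B, hB⟩ := hz.exists_bound h0 h1 hμ hre
  obtain ⟨k, hk, hkz⟩ := hz.exists_avoids h0 h1 (W := InChunk num st) h.computable_inChunk.to_re
    (μ 0 0) h.sum_inChunk_le B
  let H : ℕ → ℕ → Prop := fun n x => InChunk num st k n x ∨ (2 : ℝ) ^ B < 2 ^ n * μ n x
  have hHre : REPred fun x : ℕ × ℕ => H x.1 x.2 := by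
    refine REPred.or ?_ ?_
    · exact (h.computable_inChunk.comp ((Computable.const k).pair Computable.id)).to_re
    · refine (REPred.comp (p := fun x : ℕ × ℕ × ℕ × ℕ => (x.2.2.1 : ℝ) / 2 ^ x.2.2.2 < μ x.1 x.2.1)
        (f := fun x : ℕ × ℕ => (x.1, x.2, 2 ^ B, x.1)) hre
        (Computable.fst.pair (Computable.snd.pair ((Computable.const (2 ^ B)).pair
          Computable.fst)))).of_eq fun x => ?_
      simp only
      rw [div_lt_iff₀' (by positivity)]
      push_cast
      rfl
  have hHz : ∀ n, ¬ H n (dyadicIndex z n) := fun n hn =>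
    hn.elim (hkz n) (fun hlt => absurd hlt (not_lt.2 (hB n)))
  -- Each unit of Lebesgue measure of the hole accounts for at most `2 * 2 ^ B` of mass and `2 ^ k`
  -- of payment. With relative measure at most `ε / (4 * K)` this contributes `ε / 4`; the rounding
  -- errors contribute another `ε / 4`.
  set K : ℝ := 2 * 2 ^ B + 2 ^ k
  have hK : 0 < K := by positivity
  rw [Metric.tendsto_atTop']
  intro ε hε
  have hη : 0 < ε / (4 * K) := by positivity
  have hsmall := hdens.eventually_small h0 hz.notMem_dyadicRationals hHre hHz hη
  have hpow : Tendsto (fun n : ℕ => (2 : ℝ) ^ k * (1 / 2) ^ n) atTop (𝓝 0) := by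
    have := (tendsto_pow_atTop_nhds_zero_of_lt_one (r := (1 / 2 : ℝ)) (by norm_num)
      (by norm_num)).const_mul ((2 : ℝ) ^ k)
    rwa [mul_zero] at this
  have hev := hsmall.and (hpow.eventually (gt_mem_nhds (by positivity : (0 : ℝ) < ε / 4)))
  obtain ⟨N, hN⟩ := eventually_atTop.1 hev
  refine ⟨N, fun n hn => ?_⟩
  obtain ⟨hs, hp⟩ := hN n hn.le
  set r := dyadicIndex z n
  have hr : r < 2 ^ n := dyadicIndex_lt h0 h1 n
  have hp2 : (0 : ℝ) < 2 ^ n := by positivity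
  have hT : ∀ T ≥ n, 2 ^ n * ((num T n r : ℝ) / 2 ^ st T) - approxDensity num st n r ≤ ε / 2 := by
    intro T hT
    have h2 := h.increase_le_hole (H := H) hk (fun n x hx => Or.inr hx) (fun n x hx => Or.inl hx)
      hr hT
    set d := level T - n
    have hd : n + d = level T := Nat.add_sub_cancel' (hT.trans (lt_level T).le)
    have h3 := hμ.extSum_hole_le (H := H) (c := 2 ^ B) (by positivity) (fun n x hx => Or.inr hx)
      (hB n) d
    set m := extSum (fun x => truthValue (InHole H n d x)) r d
    have hm : m ≤ ε / (4 * K) * 2 ^ d := hs d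
    have h4 : extSum (fun x => truthValue (InHole H n d x) *
        (num T (level T) x / 2 ^ st T + 2 ^ k / 2 ^ level T)) r d ≤ K / 2 ^ level T * m := by
      have h5 : extSum (fun x => truthValue (InHole H n d x) *
          (num T (level T) x / 2 ^ st T + 2 ^ k / 2 ^ level T)) r d ≤
          extSum (fun x => truthValue (InHole H n d x) * μ (n + d) x +
            truthValue (InHole H n d x) * (2 ^ k / 2 ^ level T)) r d := by
        refine extSum_le_extSum fun x _ => ?_
        rw [← mul_add, hd]
        have h6 := h.le T (level T) x le_rfl
        exact mul_le_mul_of_nonneg_left (by linarith) (truthValue_nonneg _)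
      rw [extSum_fun_add, extSum_mul_right] at h5
      rw [hd] at h3 h5
      refine h5.trans ((add_le_add_left h3 _).trans (le_of_eq ?_))
      simp only [K, m]
      ring
    have h7 : K / 2 ^ level T * m ≤ ε / 4 / 2 ^ n := by
      refine (mul_le_mul_of_nonneg_left hm (by positivity)).trans (le_of_eq ?_)
      rw [← hd, pow_add]
      field_simp
    have h8 : (2 : ℝ) ^ k / 2 ^ n * (1 / 2 ^ n - 1 / 2 ^ T) ≤ ε / 4 / 2 ^ n := by
      have h9 : (2 : ℝ) ^ k / 2 ^ n * (1 / 2 ^ n - 1 / 2 ^ T) ≤ 2 ^ k / 2 ^ n * (1 / 2 ^ n) := by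
        refine mul_le_mul_of_nonneg_left ?_ (by positivity)
        have : (0 : ℝ) < 1 / 2 ^ T := by positivity
        linarith
      refine h9.trans ?_
      rw [one_div_pow] at hp
      have := div_le_div_of_nonneg_right hp.le hp2.le
      refine le_trans (le_of_eq ?_) this
      ring
    have h10 := h2.trans (add_le_add (h4.trans h7) h8)
    have h11 := mul_le_mul_of_nonneg_left h10 hp2.le
    unfold approxDensity
    rw [mul_sub] at h11
    refine h11.trans (le_of_eq ?_)
    field_simp
    ring
  have hle : 2 ^ n * μ n r - approxDensity num st n r ≤ ε / 2 := by
    by_contra hlt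
    rw [not_le] at hlt
    have h2 : (ε / 2 + approxDensity num st n r) / 2 ^ n < μ n r := by
      rw [div_lt_iff₀' hp2]
      linarith
    obtain ⟨T, hT', h3⟩ := h.exists_gt n r _ hr h2 n
    rw [div_lt_iff₀' hp2] at h3
    have := hT T hT'
    linarith
  have hge : 0 ≤ 2 ^ n * μ n r - approxDensity num st n r := sub_nonneg.2 (h.approxDensity_le n r)
  rw [Real.dist_eq, sub_zero, abs_of_nonneg hge]
  linarith

/-- Left-c.e. measures have a density at random dyadic density-one points. -/
theorem MLRandom.tendsto_density {z : ℝ} (hz : MLRandom z) (h0 : 0 ≤ z) (h1 : z < 1)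
    (hdens : DyadicDensityOnePoint z) (hμ : IsCellMeasure μ) (hre : LeftCECells μ) :
    ∃ l, Tendsto (fun n => 2 ^ n * μ n (dyadicIndex z n)) atTop (𝓝 l) := by
  obtain ⟨num, st, h⟩ := exists_approximatesCells hμ hre
  obtain ⟨B, hB⟩ := hz.exists_bound h0 h1 hμ hre
  obtain ⟨l, hl⟩ := h.tendsto_approxDensity hz h0 h1 hB
  refine ⟨0 + l, ?_⟩
  refine ((h.tendsto_sub_approxDensity hμ hre hz h0 h1 hdens).add hl).congr fun n => ?_
  ring

end Holes

/-! ### Effectively closed classes at random reals -/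

section ClosedClass

/-- A computable increasing enumeration of cells that exhausts the open set `U`: the cells of
level `t` that are contained in `U` at stage `t`. -/
structure EnumeratesOpen (U : Set ℝ) (E : ℕ → ℕ → Prop) : Prop where
  computable : ComputablePred fun x : ℕ × ℕ => E x.1 x.2
  succ : ∀ t x, E t (x / 2) → E (t + 1) x
  subset : ∀ t x, E t x → openCell t x ⊆ U
  eventually : ∀ y ∈ U, 0 ≤ y → ∃ t, E t (dyadicIndex y t)

/-- A cell is enumerated at stage `t` if one of the cells containing it, of level at most `t`, has
been recognised by stage `t` as lying strictly inside an enumerated rational interval. Keeping all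
ancestors makes the enumeration pass to subcells. -/
theorem EffectivelyClosed.exists_enumeratesOpen {C : Set ℝ} (hC : EffectivelyClosed C) :
    ∃ E, EnumeratesOpen Cᶜ E := by
  obtain ⟨W, hW, hCW⟩ := hC
  -- The comparisons of endpoints are cross-multiplied, and the negative parts moved across, so that
  -- only natural numbers occur.
  let inside : (ℕ × ℕ) → ((ℕ × ℕ × ℕ) × (ℕ × ℕ × ℕ)) → Prop := fun x p =>
    (p.1.1 * 2 ^ x.1 < x.2 * (p.1.2.2 + 1) + p.1.2.1 * 2 ^ x.1) ∧
    ((x.2 + 1) * (p.2.2.2 + 1) + p.2.2.1 * 2 ^ x.1 < p.2.1 * 2 ^ x.1)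
  have hinside : ∀ x p, inside x p ↔ (ratOfCode p.1 : ℝ) < (x.2 : ℝ) / 2 ^ x.1 ∧
      ((x.2 : ℝ) + 1) / 2 ^ x.1 < ratOfCode p.2 := by
    rintro ⟨n, r⟩ ⟨⟨a, b, c⟩, ⟨a', b', c'⟩⟩
    simp only [inside, ratOfCode_cast]
    refine and_congr ?_ ?_
    · rw [div_lt_div_iff₀ (by positivity) (by positivity), sub_mul, sub_lt_iff_lt_add]
      norm_cast
    · rw [div_lt_div_iff₀ (by positivity) (by positivity), sub_mul, lt_sub_iff_add_lt]
      norm_cast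
  have hinsideC : ComputablePred fun y : (ℕ × ℕ) × ((ℕ × ℕ × ℕ) × (ℕ × ℕ × ℕ)) =>
      inside y.1 y.2 := by
    have hn : Computable fun y : (ℕ × ℕ) × ((ℕ × ℕ × ℕ) × (ℕ × ℕ × ℕ)) => 2 ^ y.1.1 :=
      (Computable.fst.comp Computable.fst).two_pow
    have hr : Computable fun y : (ℕ × ℕ) × ((ℕ × ℕ × ℕ) × (ℕ × ℕ × ℕ)) => y.1.2 :=
      Computable.snd.comp Computable.fst
    have h1 : Computable fun y : (ℕ × ℕ) × ((ℕ × ℕ × ℕ) × (ℕ × ℕ × ℕ)) => y.2.1 :=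
      Computable.fst.comp Computable.snd
    have h2 : Computable fun y : (ℕ × ℕ) × ((ℕ × ℕ × ℕ) × (ℕ × ℕ × ℕ)) => y.2.2 :=
      Computable.snd.comp Computable.snd
    have hb : Computable fun p : ℕ × ℕ × ℕ => p.2.1 := Computable.fst.comp Computable.snd
    have hc : Computable fun p : ℕ × ℕ × ℕ => p.2.2 + 1 :=
      (Computable.snd.comp Computable.snd).natAdd (.const 1)
    exact (ComputablePred.nat_lt ((Computable.fst.comp h1).natMul hn)
      ((hr.natMul (hc.comp h1)).natAdd ((hb.comp h1).natMul hn))).and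
      (ComputablePred.nat_lt (((hr.natAdd (.const 1)).natMul (hc.comp h2)).natAdd
        ((hb.comp h2).natMul hn)) ((Computable.fst.comp h2).natMul hn))
  have hS : REPred fun x : ℕ × ℕ => ∃ p, W p ∧ inside x p :=
    REPred.exists (p := fun (x : ℕ × ℕ) p => W p ∧ inside x p)
      ((REPred.comp hW Computable.snd).and hinsideC.to_re)
  obtain ⟨q, hq, hmono, hqS⟩ := hS.exists_stages
  refine ⟨fun t x => ∃ n < t + 1, q (n, x / 2 ^ (t - n)) t, ?_, ?_, ?_, ?_⟩
  · refine ComputablePred.exists_lt (p := fun (x : ℕ × ℕ) n => q (n, x.2 / 2 ^ (x.1 - n)) x.1) ?_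
      (Computable.fst.natAdd (.const 1))
    have ht : Computable fun x : (ℕ × ℕ) × ℕ => x.1.1 := Computable.fst.comp Computable.fst
    have hx : Computable fun x : (ℕ × ℕ) × ℕ => x.1.2 := Computable.snd.comp Computable.fst
    exact ComputablePred.comp (p := fun x : (ℕ × ℕ) × ℕ => q x.1 x.2) hq
      ((Computable.snd.pair (hx.natDiv (ht.natSub Computable.snd).two_pow)).pair ht)
  · rintro t x ⟨n, hn, h⟩
    refine ⟨n, by omega, hmono _ t (t + 1) (Nat.le_succ t) ?_⟩
    have h1 := div_two_pow_div x 1 (t - n)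
    rw [pow_one, show 1 + (t - n) = t + 1 - n by omega] at h1
    rwa [h1] at h
  · rintro t x ⟨n, hn, h⟩
    obtain ⟨p, hp, hi⟩ := (hqS _).2 ⟨t, h⟩
    rw [hinside] at hi
    have h1 := openCell_subset n (t - n) x
    rw [Nat.add_sub_cancel' (by omega)] at h1
    refine h1.trans ?_
    rw [hCW]
    exact (Set.Ioo_subset_Ioo hi.1.le hi.2.le).trans (Set.subset_biUnion_of_mem (u := ratIoo) hp)
  · intro y hy h0
    rw [hCW] at hy
    simp only [Set.mem_iUnion, exists_prop] at hy
    obtain ⟨p, hp, hy1, hy2⟩ := hy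
    obtain ⟨n, hn⟩ := exists_pow_lt_of_lt_one (lt_min (sub_pos.2 hy1) (sub_pos.2 hy2))
      (by norm_num : (2⁻¹ : ℝ) < 1)
    rw [lt_min_iff, inv_pow] at hn
    have hp2 : (0 : ℝ) < 2 ^ n := by positivity
    have hle : (dyadicIndex y n : ℝ) / 2 ^ n ≤ y := by
      rw [div_le_iff₀ hp2]
      exact Nat.floor_le (by positivity)
    have hlt : y < ((dyadicIndex y n : ℝ) + 1) / 2 ^ n := by
      rw [lt_div_iff₀ hp2]
      exact Nat.lt_floor_add_one _
    have hdiff : ((dyadicIndex y n : ℝ) + 1) / 2 ^ n = dyadicIndex y n / 2 ^ n + (2 ^ n)⁻¹ := by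
      rw [add_div, one_div]
    obtain ⟨s, hs⟩ := (hqS (n, dyadicIndex y n)).1 ⟨p, hp, (hinside _ _).2 ⟨by
      simp only; linarith, by simp only; linarith⟩⟩
    refine ⟨max n s, n, by have := le_max_left n s; omega, ?_⟩
    rw [dyadicIndex_div _ (le_max_left n s)]
    exact hmono _ s _ (le_max_right n s) hs

variable {U : Set ℝ} {E : ℕ → ℕ → Prop}

theorem EnumeratesOpen.add (hE : EnumeratesOpen U E) {t d x : ℕ} (h : E t (x / 2 ^ d)) :
    E (t + d) x := by
  induction d generalizing x with
  | zero => simpa using h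
  | succ d ih =>
    refine hE.succ _ _ (ih ?_)
    have := div_two_pow_div x 1 d
    rw [pow_one, add_comm 1 d] at this
    rwa [this]

/-- The Lebesgue measure of the part of the open set `U` in the dyadic cells. -/
noncomputable def cellVolume (U : Set ℝ) (n r : ℕ) : ℝ := volume.real (openCell n r ∩ U)

theorem volume_openCell_inter_ne_top (n r : ℕ) (U : Set ℝ) : volume (openCell n r ∩ U) ≠ ∞ :=
  ((measure_mono Set.inter_subset_left).trans_lt
    (by rw [volume_openCell]; exact ENNReal.ofReal_lt_top)).ne

/-- The two open halves miss only the midpoint of the cell, a null set. -/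
theorem isCellMeasure_cellVolume (hU : MeasurableSet U) : IsCellMeasure (cellVolume U) where
  nonneg _ _ := measureReal_nonneg
  add n r := by
    have hp : (0 : ℝ) < 2 ^ n := by positivity
    have h1 : (openCell n r ∩ U : Set ℝ) =ᵐ[volume]
        ((openCell (n + 1) (2 * r) ∩ U) ∪ (openCell (n + 1) (2 * r + 1) ∩ U) : Set ℝ) := by
      have hmid : volume {(((2 * r : ℕ) : ℝ) + 1) / 2 ^ (n + 1)} = 0 := by simp
      have h0 : openCell (n + 1) (2 * r) ⊆ openCell n r := by
        have := openCell_subset n 1 (2 * r)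
        rwa [show 2 * r / 2 ^ 1 = r by omega] at this
      have h1 : openCell (n + 1) (2 * r + 1) ⊆ openCell n r := by
        have := openCell_subset n 1 (2 * r + 1)
        rwa [show (2 * r + 1) / 2 ^ 1 = r by omega] at this
      rw [← Set.union_inter_distrib_right]
      refine EventuallyEq.inter ?_ (ae_eq_refl U)
      refine (ae_eq_set.2 ⟨measure_mono_null ?_ hmid, ?_⟩)
      · rintro y ⟨⟨hy1, hy2⟩, hy⟩
        rw [Set.mem_singleton_iff]
        by_contra hne
        refine hy ?_
        rcases lt_or_gt_of_ne hne with hlt | hgt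
        · refine Or.inl ⟨?_, hlt⟩
          refine lt_of_eq_of_lt ?_ hy1
          rw [pow_succ]
          push_cast
          field_simp
        · refine Or.inr ⟨?_, ?_⟩
          · refine lt_of_eq_of_lt ?_ hgt
            push_cast
            rfl
          · refine hy2.trans_eq ?_
            rw [pow_succ]
            push_cast
            field_simp
            ring
      · rw [Set.sdiff_eq_empty.2 (Set.union_subset h0 h1), measure_empty]
    unfold cellVolume
    rw [measureReal_congr h1, measureReal_union
      (((disjoint_openCell (by omega)).inter_left U).inter_right U)
      (measurableSet_Ioo.inter hU) (volume_openCell_inter_ne_top _ _ _)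
      (volume_openCell_inter_ne_top _ _ _)]

/-- The number of cells of level `n + d` inside the cell `(n, r)` that have been enumerated. -/
noncomputable def enumCount (E : ℕ → ℕ → Prop) (n r d : ℕ) : ℕ :=
  open Classical in ((Finset.range (2 ^ d)).filter fun j => E (n + d) (r * 2 ^ d + j)).card

theorem enumCount_eq (E : ℕ → ℕ → Prop) (n r d : ℕ) :
    (enumCount E n r d : ℝ) = extSum (fun x => truthValue (E (n + d) x)) r d := by
  classical
  unfold enumCount extSum truthValue
  rw [Finset.sum_boole]

theorem EnumeratesOpen.computable_enumCount (hE : EnumeratesOpen U E) :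
    Computable fun x : ℕ × ℕ × ℕ => enumCount E x.1 x.2.1 x.2.2 := by
  have hx : Computable fun x : (ℕ × ℕ × ℕ) × ℕ => x.1 := Computable.fst
  have hd : Computable fun x : (ℕ × ℕ × ℕ) × ℕ => x.1.2.2 :=
    Computable.snd.comp (Computable.snd.comp hx)
  have h1 : ComputablePred fun x : (ℕ × ℕ × ℕ) × ℕ =>
      E (x.1.1 + x.1.2.2) (x.1.2.1 * 2 ^ x.1.2.2 + x.2) :=
    hE.computable.comp (((Computable.fst.comp hx).natAdd hd).pair
      (((Computable.fst.comp (Computable.snd.comp hx)).natMul hd.two_pow).natAdd Computable.snd))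
  exact Computable.card_filter_range (p := fun (x : ℕ × ℕ × ℕ) j =>
    E (x.1 + x.2.2) (x.2.1 * 2 ^ x.2.2 + j)) h1
    (Computable.snd.comp Computable.snd).two_pow

theorem EnumeratesOpen.enumCount_le (hE : EnumeratesOpen U E) (n r d : ℕ) :
    (enumCount E n r d : ℝ) / 2 ^ d ≤ 2 ^ n * cellVolume U n r := by
  have h1 : extSum (fun x => truthValue (E (n + d) x)) r d * (2 ^ (n + d))⁻¹ ≤
      cellVolume U n r := by
    rw [cellVolume, Measure.real, ← ENNReal.ofReal_le_iff_le_toReal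
      (volume_openCell_inter_ne_top _ _ _), ← volume_biUnion_openCell]
    refine measure_mono (Set.iUnion₂_subset fun x hx => Set.subset_inter ?_ ?_)
    · rw [← hx.1]
      exact openCell_subset n d x
    · exact hE.subset _ _ hx.2
  rw [← enumCount_eq] at h1
  have h2 := mul_le_mul_of_nonneg_left h1 (by positivity : (0 : ℝ) ≤ 2 ^ n)
  refine le_trans (le_of_eq ?_) h2
  rw [pow_add]
  field_simp

/-- Continuity of measure from below: off the dyadic rationals, every point of `U` in the cell is
eventually covered by an enumerated cell, and stays covered. -/
theorem EnumeratesOpen.eventually_lt_enumCount (hE : EnumeratesOpen U E) {n r : ℕ} {c : ℝ}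
    (hc : c < 2 ^ n * cellVolume U n r) : ∀ᶠ d in atTop, c < (enumCount E n r d : ℝ) / 2 ^ d := by
  let V : ℕ → Set ℝ := fun d =>
    {y | y ∈ openCell n r ∧ y ∉ dyadicRationals ∧ E (n + d) (dyadicIndex y (n + d))}
  have hpos : ∀ y ∈ openCell n r, 0 ≤ y := fun y hy => le_trans (by positivity) hy.1.le
  have hEV : ∀ y d, E (n + d) (dyadicIndex y (n + d)) →
      E (n + (d + 1)) (dyadicIndex y (n + (d + 1))) := by
    intro y d h
    refine hE.succ _ _ ?_
    have h1 := dyadicIndex_div y (Nat.le_succ (n + d))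
    rw [show (n + d).succ - (n + d) = 1 by omega, pow_one] at h1
    have h2 : n + (d + 1) = (n + d).succ := rfl
    rwa [h2, h1]
  have hmono : Monotone V := monotone_nat_of_le_succ fun d y hy =>
    ⟨hy.1, hy.2.1, hEV y d hy.2.2⟩
  have hsub : (openCell n r ∩ U) \ dyadicRationals ⊆ ⋃ d, V d := by
    rintro y ⟨⟨hy, hyU⟩, hyd⟩
    obtain ⟨t, ht⟩ := hE.eventually y hyU (hpos y hy)
    refine Set.mem_iUnion.2 ⟨t, hy, hyd, ?_⟩
    rw [add_comm n t]
    refine hE.add ?_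
    have h1 := dyadicIndex_div y (show t ≤ t + n by omega)
    rw [Nat.add_sub_cancel_left] at h1
    rwa [h1]
  have hVle : ∀ d, volume (V d) ≤ ENNReal.ofReal ((enumCount E n r d : ℝ) * (2 ^ (n + d))⁻¹) := by
    intro d
    rw [enumCount_eq, ← volume_biUnion_openCell]
    refine measure_mono ?_
    rintro y ⟨hy, hyd, hyE⟩
    simp only [Set.mem_iUnion]
    refine ⟨dyadicIndex y (n + d), ⟨?_, hyE⟩, (mem_openCell_iff (hpos y hy) hyd _ _).2 rfl⟩
    have h1 := dyadicIndex_div y (show n ≤ n + d by omega)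
    rw [Nat.add_sub_cancel_left] at h1
    rw [h1]
    exact ((mem_openCell_iff (hpos y hy) hyd _ _).1 hy).symm
  have htend := tendsto_measure_iUnion_atTop (μ := volume) hmono
  -- A negative `c` is treated apart, since `ENNReal.ofReal` would send it to `0` and the strict
  -- inequality could fail for a null intersection.
  have hlt : ENNReal.ofReal (c / 2 ^ n) < volume (⋃ d, V d) ∨ c < 0 := by
    rcases lt_or_ge c 0 with h | h
    · exact Or.inr h
    left
    have h1 : volume (openCell n r ∩ U) ≤ volume (⋃ d, V d) := by
      rw [← measure_sdiff_null (countable_dyadicRationals.measure_zero volume)]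
      exact measure_mono hsub
    refine lt_of_lt_of_le ?_ h1
    rw [ENNReal.ofReal_lt_iff_lt_toReal (by positivity) (volume_openCell_inter_ne_top _ _ _),
      div_lt_iff₀' (by positivity)]
    exact hc
  rcases hlt with hlt | hlt
  · filter_upwards [htend.eventually (lt_mem_nhds hlt)] with d hd
    have h1 := (ENNReal.ofReal_lt_ofReal_iff'.1 (hd.trans_le (hVle d))).1
    rw [div_lt_iff₀ (by positivity)] at h1
    refine h1.trans_eq ?_
    rw [pow_add]
    field_simp
  · exact Eventually.of_forall fun d => hlt.trans_le (by positivity)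

/-- One step of a machine that waits until at least the fraction `2⁻ᵉ` of a cell has been
enumerated, and then moves to the subcells that have not been enumerated. The first component of
the state is `m + 1` if the current cell has level `m`, and `0` if the machine has stopped; the
second one counts the moves. -/
noncomputable def escapeStep (E : ℕ → ℕ → Prop) (e n r : ℕ) (s : ℕ × ℕ) : ℕ × ℕ :=
  open Classical in
  if (0 < s.1 ∧ s.1 ≤ n) ∧
      2 ^ (n + 1 - s.1) < enumCount E (s.1 - 1) (r / 2 ^ (n + 1 - s.1)) (n + 1 - s.1) * 2 ^ e then
    (if E n r then (0, s.2) else (n + 1, s.2 + 1))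
  else s

theorem EnumeratesOpen.computable_escapeStep (hE : EnumeratesOpen U E) (e : ℕ) :
    Computable fun x : ℕ × ℕ × (ℕ × ℕ) => escapeStep E e x.1 x.2.1 x.2.2 := by
  classical
  have hn : Computable fun x : ℕ × ℕ × (ℕ × ℕ) => x.1 := Computable.fst
  have hr : Computable fun x : ℕ × ℕ × (ℕ × ℕ) => x.2.1 := Computable.fst.comp Computable.snd
  have hs : Computable fun x : ℕ × ℕ × (ℕ × ℕ) => x.2.2 := Computable.snd.comp Computable.snd
  have hs1 : Computable fun x : ℕ × ℕ × (ℕ × ℕ) => x.2.2.1 := Computable.fst.comp hs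
  have hs2 : Computable fun x : ℕ × ℕ × (ℕ × ℕ) => x.2.2.2 := Computable.snd.comp hs
  have hd : Computable fun x : ℕ × ℕ × (ℕ × ℕ) => x.1 + 1 - x.2.2.1 :=
    (hn.natAdd (.const 1)).natSub hs1
  have hEnr : ComputablePred fun x : ℕ × ℕ × (ℕ × ℕ) => E x.1 x.2.1 :=
    hE.computable.comp (hn.pair hr)
  exact Computable.if_then_else
    (((ComputablePred.nat_lt (Computable.const 0) hs1).and (ComputablePred.nat_le hs1 hn)).and
      (ComputablePred.nat_lt hd.two_pow ((Computable.comp_three hE.computable_enumCount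
        (hs1.natSub (.const 1)) (hr.natDiv hd.two_pow) hd).natMul (.const (2 ^ e)))))
    (Computable.if_then_else hEnr ((Computable.const 0).pair hs2)
      ((hn.natAdd (.const 1)).pair (hs2.natAdd (.const 1)))) hs

theorem escapeStep_of_trigger {e m c d x : ℕ}
    (h : 2 ^ (d + 1) < enumCount E m (x / 2 ^ (d + 1)) (d + 1) * 2 ^ e) :
    (E (m + d + 1) x → escapeStep E e (m + d + 1) x (m + 1, c) = (0, c)) ∧
    (¬ E (m + d + 1) x → escapeStep E e (m + d + 1) x (m + 1, c) = (m + d + 2, c + 1)) := by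
  have h1 : m + d + 1 + 1 - (m + 1) = d + 1 := by omega
  unfold escapeStep
  simp only [h1, Nat.add_sub_cancel]
  rw [if_pos ⟨⟨by omega, by omega⟩, h⟩]
  exact ⟨fun h => if_pos h, fun h => if_neg h⟩

theorem escapeStep_of_not_trigger {e m c d x : ℕ}
    (h : ¬ 2 ^ (d + 1) < enumCount E m (x / 2 ^ (d + 1)) (d + 1) * 2 ^ e) :
    escapeStep E e (m + d + 1) x (m + 1, c) = (m + 1, c) := by
  have h1 : m + d + 1 + 1 - (m + 1) = d + 1 := by omega
  unfold escapeStep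
  simp only [h1, Nat.add_sub_cancel]
  rw [if_neg fun hc => h hc.2]

theorem cellRun_eq_of_fixed {σ : Type*} {step : ℕ → ℕ → σ → σ} {s₀ s : σ} {m d y : ℕ}
    (h0 : cellRun step s₀ m (y / 2 ^ d) = s)
    (h : ∀ i < d, step (m + i + 1) (y / 2 ^ (d - (i + 1))) s = s) :
    cellRun step s₀ (m + d) y = s := by
  induction d generalizing y with
  | zero => simpa using h0
  | succ d ih =>
    have h1 : ∀ i, y / 2 / 2 ^ i = y / 2 ^ (i + 1) := fun i => by
      have := div_two_pow_div y 1 i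
      rwa [pow_one, add_comm 1 i] at this
    have h2 : cellRun step s₀ (m + d) (y / 2) = s := by
      refine ih ?_ fun i hi => ?_
      · rwa [h1]
      · rw [h1, show d - (i + 1) + 1 = d + 1 - (i + 1) by omega]
        exact h i (by omega)
    rw [← add_assoc]
    simp only [cellRun]
    rw [h2]
    simpa using h d (Nat.lt_succ_self d)

theorem escape_wait {e m c d y n₀ : ℕ}
    (h0 : cellRun (escapeStep E e) (n₀ + 1, 0) m (y / 2 ^ d) = (m + 1, c))
    (h : ∀ i < d, ¬ 2 ^ (i + 1) < enumCount E m (y / 2 ^ d) (i + 1) * 2 ^ e) :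
    cellRun (escapeStep E e) (n₀ + 1, 0) (m + d) y = (m + 1, c) := by
  refine cellRun_eq_of_fixed h0 fun i hi => escapeStep_of_not_trigger ?_
  rw [div_two_pow_div, show d - (i + 1) + (i + 1) = d by omega]
  exact h i hi

theorem escape_move {e m c d y n₀ : ℕ}
    (h0 : cellRun (escapeStep E e) (n₀ + 1, 0) m (y / 2 ^ (d + 1)) = (m + 1, c))
    (h : ∀ i < d, ¬ 2 ^ (i + 1) < enumCount E m (y / 2 ^ (d + 1)) (i + 1) * 2 ^ e)
    (hd : 2 ^ (d + 1) < enumCount E m (y / 2 ^ (d + 1)) (d + 1) * 2 ^ e) :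
    (E (m + d + 1) y → cellRun (escapeStep E e) (n₀ + 1, 0) (m + d + 1) y = (0, c)) ∧
    (¬ E (m + d + 1) y →
      cellRun (escapeStep E e) (n₀ + 1, 0) (m + d + 1) y = (m + d + 2, c + 1)) := by
  have h1 : y / 2 / 2 ^ d = y / 2 ^ (d + 1) := by
    have := div_two_pow_div y 1 d
    rwa [pow_one, add_comm 1 d] at this
  have h2 : cellRun (escapeStep E e) (n₀ + 1, 0) (m + d) (y / 2) = (m + 1, c) :=
    escape_wait (by rwa [h1]) (by rwa [h1])
  have h3 : cellRun (escapeStep E e) (n₀ + 1, 0) (m + d + 1) y =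
      escapeStep E e (m + d + 1) y (m + 1, c) := by
    simp only [cellRun]
    rw [h2]
  rw [h3]
  exact escapeStep_of_trigger hd

theorem escape_dead {e m c d y n₀ : ℕ}
    (h0 : cellRun (escapeStep E e) (n₀ + 1, 0) m (y / 2 ^ d) = (0, c)) :
    cellRun (escapeStep E e) (n₀ + 1, 0) (m + d) y = (0, c) :=
  cellRun_eq_of_fixed h0 fun i _ => by
    unfold escapeStep
    simp

/-- Inside a cell where the machine has just moved, it makes `K` further moves on at most the
fraction `(1 - 2⁻ᵉ) ^ K`. -/
theorem extSum_escape_le {e n₀ : ℕ} (d : ℕ) : ∀ m x c K,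
    cellRun (escapeStep E e) (n₀ + 1, 0) m x = (m + 1, c) →
    extSum (fun y => truthValue (c + K ≤ (cellRun (escapeStep E e) (n₀ + 1, 0) (m + d) y).2)) x d ≤
      (1 - (2 ^ e)⁻¹) ^ K * 2 ^ d := by
  have ha : (0 : ℝ) ≤ 1 - (2 ^ e)⁻¹ :=
    sub_nonneg.2 (inv_le_one_of_one_le₀ (one_le_pow₀ (by norm_num)))
  induction d using Nat.strong_induction_on with
  | _ d ih =>
    intro m x c K hx
    set run := cellRun (escapeStep E e) (n₀ + 1, 0)
    rcases K with _ | K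
    · rw [pow_zero, one_mul]
      calc _ ≤ extSum (fun _ => 1) x d := extSum_le_extSum fun y _ => by
            refine (truthValue_mono (fun _ => trivial)).trans (truthValue_of trivial).le
        _ = 2 ^ d := by rw [extSum_const, mul_one]
    have hzero : ∀ {y s a : ℕ}, run s y = (a, c) → truthValue (c + (K + 1) ≤ (run s y).2) = 0 :=
      fun h => truthValue_of_not (by rw [h]; simp)
    -- At the first level where the enumerated fraction exceeds `2⁻ᵉ`, the enumerated subcells stop
    -- for good, and each remaining one is a fresh start needing one move fewer; induction supplies
    -- the other factors. If no such level occurs, no move is made.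
    by_cases hex : ∃ i, i < d ∧ 2 ^ (i + 1) < enumCount E m x (i + 1) * 2 ^ e
    · classical
      let t := Nat.find hex
      obtain ⟨htd, ht⟩ := Nat.find_spec hex
      have hmin : ∀ i < t, ¬ 2 ^ (i + 1) < enumCount E m x (i + 1) * 2 ^ e := fun i hi hc =>
        Nat.find_min hex hi ⟨by omega, hc⟩
      have hdt : d = (t + 1) + (d - (t + 1)) := by omega
      have hbound : extSum (fun y => truthValue (c + (K + 1) ≤ (run (m + d) y).2)) x d ≤
          extSum (fun y => (1 - truthValue (E (m + (t + 1)) y)) *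
            ((1 - (2 ^ e)⁻¹) ^ K * 2 ^ (d - (t + 1)))) x (t + 1) := by
        nth_rw 2 [hdt]
        rw [extSum_add]
        refine extSum_le_extSum fun y hy => ?_
        obtain ⟨hin, hout⟩ := escape_move (E := E) (e := e) (m := m) (c := c) (d := t) (y := y)
          (n₀ := n₀) (by rw [hy]; exact hx) (by rw [hy]; exact hmin) (by rw [hy]; exact ht)
        by_cases hyE : E (m + t + 1) y
        · have h1 : ∀ w, w / 2 ^ (d - (t + 1)) = y →
              truthValue (c + (K + 1) ≤ (run (m + d) w).2) = 0 := by
            intro w hw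
            refine hzero (a := 0) ?_
            have := escape_dead (E := E) (e := e) (m := m + t + 1) (c := c) (d := d - (t + 1))
              (y := w) (n₀ := n₀) (by rw [hw]; exact hin hyE)
            rwa [show m + t + 1 + (d - (t + 1)) = m + d by omega] at this
          rw [extSum_congr h1, extSum_const, mul_zero, truthValue_of (by exact hyE)]
          simp
        · rw [truthValue_of_not (by exact hyE), sub_zero, one_mul]
          have h1 := ih (d - (t + 1)) (by omega) (m + t + 1) y (c + 1) K (hout hyE)
          rw [show m + t + 1 + (d - (t + 1)) = m + d by omega] at h1
          rwa [show c + (K + 1) = c + 1 + K by omega]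
      refine hbound.trans ?_
      rw [extSum_mul_right, extSum_fun_sub, extSum_const, mul_one, ← enumCount_eq]
      have h1 : (2 : ℝ) ^ (t + 1) < enumCount E m x (t + 1) * 2 ^ e := by exact_mod_cast ht
      have h2 : (2 : ℝ) ^ (t + 1) - enumCount E m x (t + 1) ≤ (1 - (2 ^ e)⁻¹) * 2 ^ (t + 1) := by
        rw [← div_lt_iff₀ (by positivity)] at h1
        rw [sub_mul, one_mul, ← div_eq_inv_mul]
        linarith
      refine (mul_le_mul_of_nonneg_right h2 (by positivity)).trans (le_of_eq ?_)
      have h3 : (2 : ℝ) ^ d = 2 ^ (t + 1) * 2 ^ (d - (t + 1)) := by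
        rw [← pow_add, ← hdt]
      rw [h3]
      ring
    · push Not at hex
      have h1 : ∀ y, y / 2 ^ d = x → truthValue (c + (K + 1) ≤ (run (m + d) y).2) = 0 := by
        intro y hy
        refine hzero (a := m + 1) (escape_wait (by rw [hy]; exact hx) fun i hi => ?_)
        rw [hy]
        exact not_lt.2 (hex i hi)
      rw [extSum_congr h1, extSum_const, mul_zero]
      positivity

/-- A random real outside an effectively open set is not a point where the set has positive lower
density. -/
theorem EnumeratesOpen.frequently_small (hE : EnumeratesOpen U E) {z : ℝ} (hz : MLRandom z)
    (h0 : 0 ≤ z) (h1 : z < 1) (hzU : z ∉ U) {a : ℝ} (ha : 0 < a) :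
    ∃ᶠ n in atTop, 2 ^ n * cellVolume U n (dyadicIndex z n) ≤ a := by
  by_contra hcon
  rw [not_frequently] at hcon
  obtain ⟨n₀, hn₀⟩ := eventually_atTop.1 hcon
  obtain ⟨e, he⟩ := exists_pow_lt_of_lt_one ha (by norm_num : (2⁻¹ : ℝ) < 1)
  rw [inv_pow] at he
  set run := cellRun (escapeStep E e) (n₀ + 1, 0)
  have hb0 : (0 : ℝ) ≤ 1 - (2 ^ e)⁻¹ :=
    sub_nonneg.2 (inv_le_one_of_one_le₀ (one_le_pow₀ (by norm_num)))
  have hb1 : (1 : ℝ) - (2 ^ e)⁻¹ < 1 := by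
    have : (0 : ℝ) < (2 ^ e)⁻¹ := by positivity
    linarith
  -- Each block of `M` moves at least halves the measure, so `k * M` moves have measure at most
  -- `2⁻ᵏ` and form a test.
  obtain ⟨M, hM⟩ := exists_pow_lt_of_lt_one (by norm_num : (0 : ℝ) < 2⁻¹) hb1
  -- the runs before the starting level
  have hstart : ∀ n x, n ≤ n₀ → run n x = (n₀ + 1, 0) := by
    intro n
    induction n with
    | zero => exact fun _ _ => rfl
    | succ n ih =>
      intro x hn
      change escapeStep E e (n + 1) x (run n (x / 2)) = _
      rw [ih _ (by omega)]
      unfold escapeStep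
      rw [if_neg]
      rintro ⟨⟨-, h⟩, -⟩
      simp only at h
      omega
  have hcount : ∀ N n x, n ≤ N → (run n (x / 2 ^ (N - n))).2 ≤ (run N x).2 := by
    intro N n x hn
    induction N generalizing x with
    | zero =>
      obtain rfl : n = 0 := by omega
      simp
    | succ N ih =>
      rcases Nat.lt_or_eq_of_le hn with hn | rfl
      · have h2 := div_two_pow_div x 1 (N - n)
        rw [pow_one, show 1 + (N - n) = N + 1 - n by omega] at h2
        rw [← h2]
        refine (ih (x / 2) (by omega)).trans ?_
        change _ ≤ (escapeStep E e (N + 1) x (run N (x / 2))).2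
        unfold escapeStep
        split_ifs <;> simp
      · simp
  have hmeas : ∀ K N, extSum (fun x => truthValue (K ≤ (run N x).2)) 0 N ≤
      (1 - (2 ^ e)⁻¹) ^ K * 2 ^ N := by
    intro K N
    rcases le_total N n₀ with hN | hN
    · rcases K with _ | K
      · rw [pow_zero, one_mul]
        calc _ ≤ extSum (fun _ => 1) 0 N := extSum_le_extSum fun y _ => by
              refine (truthValue_mono (fun _ => trivial)).trans (truthValue_of trivial).le
          _ = 2 ^ N := by rw [extSum_const, mul_one]
      · rw [extSum_congr (g := fun _ => 0), extSum_const, mul_zero]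
        · positivity
        · intro x _
          rw [hstart N x hN]
          exact truthValue_of_not (by simp)
    · obtain ⟨d, rfl⟩ := Nat.exists_eq_add_of_le hN
      rw [extSum_add]
      have h2 : ∀ x, extSum (fun y => truthValue (K ≤ (run (n₀ + d) y).2)) x d ≤
          (1 - (2 ^ e)⁻¹) ^ K * 2 ^ d := fun x => by
        have := extSum_escape_le (E := E) (e := e) (n₀ := n₀) d n₀ x 0 K (hstart n₀ x le_rfl)
        rwa [zero_add] at this
      refine (extSum_le_extSum fun x _ => h2 x).trans (le_of_eq ?_)
      rw [extSum_const, pow_add]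
      ring
  have hrun : Computable fun x : ℕ × ℕ => run x.1 x.2 :=
    computable_cellRun _ (hE.computable_escapeStep e)
  obtain ⟨k, -, hk⟩ := hz.exists_avoids h0 h1 (W := fun k n r => k * M ≤ (run n r).2)
    (ComputablePred.nat_le (Computable.fst.natMul (.const M))
      (Computable.snd.comp (hrun.comp Computable.snd))).to_re 1 (fun k N => by
      refine (extSum_le_extSum (g := fun x => truthValue (k * M ≤ (run N x).2)) fun x _ =>
        truthValue_mono ?_).trans ((hmeas _ _).trans ?_)
      · rintro ⟨n, hn, h⟩
        exact h.trans (hcount N n x hn)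
      · refine mul_le_mul_of_nonneg_right ?_ (by positivity)
        have h2 := pow_le_pow_left₀ (pow_nonneg hb0 M) hM.le k
        rw [inv_pow] at h2
        rwa [mul_comm k M, pow_mul, one_div]) 0
  -- the machine moves infinitely often along `z`
  have hnot : ∀ n, ¬ E n (dyadicIndex z n) := fun n hn =>
    hzU (hE.subset _ _ hn ((mem_openCell_iff h0 hz.notMem_dyadicRationals _ _).2 rfl))
  -- Along `z` every waiting period ends, because `U` has density above `2⁻ᵉ` in the current cell;
  -- and the machine never stops, because `z` lies in no enumerated cell.
  have hmove : ∀ K, ∃ n ≥ n₀, run n (dyadicIndex z n) = (n + 1, K) := by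
    intro K
    induction K with
    | zero => exact ⟨n₀, le_rfl, hstart _ _ le_rfl⟩
    | succ K ih =>
      obtain ⟨m, hm, hrm⟩ := ih
      have h2 := he.trans (not_le.1 (hn₀ m hm))
      have hex : ∃ i, 2 ^ (i + 1) < enumCount E m (dyadicIndex z m) (i + 1) * 2 ^ e := by
        obtain ⟨d, hd, hd1⟩ := ((hE.eventually_lt_enumCount h2).and (eventually_ge_atTop 1)).exists
        obtain ⟨i, rfl⟩ : ∃ i, d = i + 1 := ⟨d - 1, by omega⟩
        refine ⟨i, ?_⟩
        rw [inv_eq_one_div, div_lt_div_iff₀ (by positivity) (by positivity), one_mul] at hd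
        exact_mod_cast hd
      classical
      let t := Nat.find hex
      have hdiv : dyadicIndex z (m + t + 1) / 2 ^ (t + 1) = dyadicIndex z m := by
        have := dyadicIndex_div z (show m ≤ m + t + 1 by omega)
        rwa [show m + t + 1 - m = t + 1 by omega] at this
      obtain ⟨-, hout⟩ := escape_move (E := E) (e := e) (m := m) (c := K) (d := t)
        (y := dyadicIndex z (m + t + 1)) (n₀ := n₀) (by rw [hdiv]; exact hrm)
        (by rw [hdiv]; exact fun i hi => Nat.find_min hex hi) (by rw [hdiv]; exact Nat.find_spec hex)
      exact ⟨m + t + 1, by omega, hout (hnot _)⟩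
  obtain ⟨n, -, hn⟩ := hmove (k * M)
  exact hk n (by rw [hn])

end ClosedClass

/-! ### Binary strings and dyadic cells -/

section Strings

/-- The index of the dyadic cell of level `σ.length` given by the string `σ`. -/
def stringIndex (σ : List Bool) : ℕ := σ.foldl (fun v b => 2 * v + b.toNat) 0

theorem stringIndex_concat (σ : List Bool) (b : Bool) :
    stringIndex (σ ++ [b]) = 2 * stringIndex σ + b.toNat := by
  simp [stringIndex, List.foldl_append]

theorem computable_stringIndex : Computable stringIndex := by
  refine Primrec.to_comp (Primrec.list_foldl (h := fun (_ : List Bool) (x : ℕ × Bool) => 2 * x.1 + x.2.toNat) Primrec.id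
    (Primrec.const 0) ?_)
  exact Primrec.nat_add.comp (Primrec.nat_double.comp (Primrec.fst.comp Primrec.snd))
    ((Primrec.dom_bool Bool.toNat).comp (Primrec.snd.comp Primrec.snd))

/-- The string of length `n` that gives the dyadic cell of level `n` and index `r`. -/
def cellString (n r : ℕ) : List Bool :=
  (List.range n).map fun j => decide (r / 2 ^ (n - (j + 1)) % 2 = 1)

theorem cellString_succ (n r : ℕ) :
    cellString (n + 1) r = cellString n (r / 2) ++ [decide (r % 2 = 1)] := by
  simp only [cellString, List.range_succ, List.map_append, List.map_cons, List.map_nil,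
    Nat.sub_self, pow_zero, Nat.div_one]
  congr 1
  refine List.map_congr_left fun j hj => ?_
  have hj' := List.mem_range.1 hj
  have h := div_two_pow_div r 1 (n - (j + 1))
  rw [pow_one, show 1 + (n - (j + 1)) = n + 1 - (j + 1) by omega] at h
  rw [h]

theorem cellString_two_mul (n r : ℕ) : cellString (n + 1) (2 * r) = cellString n r ++ [false] := by
  rw [cellString_succ, show 2 * r / 2 = r by omega]
  simp

theorem cellString_two_mul_add_one (n r : ℕ) :
    cellString (n + 1) (2 * r + 1) = cellString n r ++ [true] := by
  rw [cellString_succ, show (2 * r + 1) / 2 = r by omega]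
  simp [Nat.add_mod]

theorem computable_cellString : Computable fun x : ℕ × ℕ => cellString x.1 x.2 := by
  refine (Computable.nat_rec (f := fun x : ℕ × ℕ => x.1) (g := fun _ => ([] : List Bool))
    (h := fun x y => y.2 ++ [decide (x.2 / 2 ^ (x.1 - (y.1 + 1)) % 2 = 1)]) Computable.fst
    (Computable.const []) ?_).of_eq fun x => ?_
  · have hd : Computable fun p : (ℕ × ℕ) × ℕ × List Bool =>
        p.1.2 / 2 ^ (p.1.1 - (p.2.1 + 1)) % 2 :=
      ((Computable.snd.comp Computable.fst).natDiv ((Computable.fst.comp Computable.fst).natSub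
        ((Computable.fst.comp Computable.snd).natAdd (.const 1))).two_pow).natMod (.const 2)
    exact Computable.list_concat.comp (Computable.snd.comp Computable.snd)
      (ComputablePred.eq hd (Computable.const 1)).decide
  · have h : ∀ m, (Nat.rec ([] : List Bool)
        (fun j l => l ++ [decide (x.2 / 2 ^ (x.1 - (j + 1)) % 2 = 1)]) m : List Bool) =
        (List.range m).map fun j => decide (x.2 / 2 ^ (x.1 - (j + 1)) % 2 = 1) := by
      intro m
      induction m with
      | zero => rfl
      | succ m ih => rw [List.range_succ, List.map_append, ← ih]; rfl
    exact h x.1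

theorem initialSegment_succ (Z : ℕ → Bool) (n : ℕ) :
    initialSegment Z (n + 1) = initialSegment Z n ++ [Z n] := by
  simp [initialSegment, List.range_succ]

theorem length_initialSegment (Z : ℕ → Bool) (n : ℕ) : (initialSegment Z n).length = n := by
  simp [initialSegment]

variable {Z : ℕ → Bool} {z : ℝ}

/-- The left endpoint is a partial sum of the expansion. The upper bound is the same argument for
the complementary series, whose digits are flipped and whose sum is `1 - z`. -/
theorem IsBinaryExpansion.bounds (hZ : IsBinaryExpansion Z z) (n : ℕ) :
    (stringIndex (initialSegment Z n) : ℝ) / 2 ^ n ≤ z ∧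
      z ≤ ((stringIndex (initialSegment Z n) : ℝ) + 1) / 2 ^ n := by
  have hpart : ∀ n, ∑ i ∈ Finset.range n, (if Z i = true then (2⁻¹ : ℝ) ^ (i + 1) else 0) =
      (stringIndex (initialSegment Z n) : ℝ) / 2 ^ n := by
    intro n
    induction n with
    | zero => simp [initialSegment, stringIndex]
    | succ n ih =>
      rw [Finset.sum_range_succ, ih, initialSegment_succ, stringIndex_concat, pow_succ, inv_pow,
        pow_succ]
      cases Z n
      · simp
        field_simp
      · simp
        field_simp
  have hgeom : ∀ n, ∑ i ∈ Finset.range n, (2⁻¹ : ℝ) ^ (i + 1) = 1 - (2 ^ n)⁻¹ := by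
    intro n
    induction n with
    | zero => simp
    | succ n ih =>
      rw [Finset.sum_range_succ, ih, inv_pow, pow_succ]
      field_simp
      ring
  have hone : HasSum (fun n : ℕ => (2⁻¹ : ℝ) ^ (n + 1)) 1 := by
    refine (hasSum_geometric_two' 1).congr_fun fun n => ?_
    rw [inv_pow, pow_succ]
    field_simp
  constructor
  · rw [← hpart]
    exact sum_le_hasSum _ (fun i _ => by split_ifs <;> positivity) hZ
  · have h1 := sum_le_hasSum (Finset.range n) (fun i _ => by
      by_cases h : Z i = true <;> simp [h]) (hone.sub hZ)
    rw [Finset.sum_sub_distrib, hpart, hgeom] at h1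
    rw [add_div, one_div]
    linarith

theorem IsBinaryExpansion.stringIndex_eq (hZ : IsBinaryExpansion Z z) (h0 : 0 ≤ z)
    (hd : z ∉ dyadicRationals) (n : ℕ) :
    stringIndex (initialSegment Z n) = dyadicIndex z n := by
  obtain ⟨h1, h2⟩ := hZ.bounds n
  rw [← mem_openCell_iff h0 hd]
  refine ⟨lt_of_le_of_ne h1 fun h => hd ⟨(n, _), h⟩, lt_of_le_of_ne h2 fun h => hd
    ⟨(n, stringIndex (initialSegment Z n) + 1), ?_⟩⟩
  rw [h]
  push_cast
  rfl

theorem IsBinaryExpansion.cellString_eq (hZ : IsBinaryExpansion Z z) (h0 : 0 ≤ z)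
    (hd : z ∉ dyadicRationals) (n : ℕ) : cellString n (dyadicIndex z n) = initialSegment Z n := by
  refine List.map_congr_left fun j hj => ?_
  have hj' := List.mem_range.1 hj
  rw [dyadicIndex_div z (show j + 1 ≤ n by omega), ← hZ.stringIndex_eq h0 hd, initialSegment_succ,
    stringIndex_concat]
  cases Z j
  · simp
  · simp [Nat.add_mod]

end Strings

/-! ### The two implications -/

section Main

theorem IsMartingale.isCellMeasure {L : List Bool → ℝ} (hL : IsMartingale L) :
    IsCellMeasure fun n r => L (cellString n r) / 2 ^ n where
  nonneg n r := div_nonneg (hL.1 _) (by positivity)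
  add n r := by
    rw [cellString_two_mul, cellString_two_mul_add_one, ← add_div, hL.2, pow_succ]
    field_simp

theorem LeftCE.leftCECells {L : List Bool → ℝ} (hL : LeftCE L) :
    LeftCECells fun n r => L (cellString n r) / 2 ^ n := by
  have hn : Computable fun x : ℕ × ℕ × ℕ × ℕ => x.1 := Computable.fst
  have hr : Computable fun x : ℕ × ℕ × ℕ × ℕ => x.2.1 := Computable.fst.comp Computable.snd
  have hc : Computable fun x : ℕ × ℕ × ℕ × ℕ => x.2.2.1 :=
    Computable.fst.comp (Computable.snd.comp Computable.snd)
  have he : Computable fun x : ℕ × ℕ × ℕ × ℕ => x.2.2.2 :=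
    Computable.snd.comp (Computable.snd.comp Computable.snd)
  -- Multiplying by `2 ^ n` turns the comparison with the cell mass into one with `L`. The code
  -- stores `2 ^ e - 1` because `ratOfCode` adds one to the last component.
  refine (REPred.comp (p := fun x : List Bool × (ℕ × ℕ × ℕ) => (ratOfCode x.2 : ℝ) < L x.1)
    (f := fun x : ℕ × ℕ × ℕ × ℕ =>
      (cellString x.1 x.2.1, (x.2.2.1 * 2 ^ x.1, 0, 2 ^ x.2.2.2 - 1))) hL
    ((computable_cellString.comp (hn.pair hr)).pair ((hc.natMul hn.two_pow).pair
      ((Computable.const 0).pair (he.two_pow.natSub (.const 1)))))).of_eq ?_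
  rintro ⟨n, r, c, e⟩
  have h : ((2 ^ e - 1 : ℕ) : ℝ) + 1 = 2 ^ e := by
    have : 2 ^ e - 1 + 1 = 2 ^ e := Nat.sub_add_cancel (Nat.succ_le_of_lt (by positivity))
    exact_mod_cast this
  simp only [ratOfCode_cast, h]
  rw [lt_div_iff₀ (by positivity)]
  push_cast
  rw [sub_zero, mul_div_right_comm]

/-- The density of `U` on the cell of a string. -/
noncomputable def stringDensity (U : Set ℝ) (σ : List Bool) : ℝ :=
  2 ^ σ.length * cellVolume U σ.length (stringIndex σ)

theorem isMartingale_stringDensity {U : Set ℝ} (hU : MeasurableSet U) :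
    IsMartingale (stringDensity U) := by
  have h := isCellMeasure_cellVolume hU
  refine ⟨fun σ => mul_nonneg (by positivity) (h.nonneg _ _), fun σ => ?_⟩
  have h1 := h.add σ.length (stringIndex σ)
  simp only [stringDensity, stringIndex_concat, List.length_append, List.length_singleton,
    Bool.toNat_false, Bool.toNat_true, add_zero]
  rw [← mul_add, h1, pow_succ]
  ring

theorem EnumeratesOpen.leftCE_stringDensity {U : Set ℝ} {E : ℕ → ℕ → Prop}
    (hE : EnumeratesOpen U E) : LeftCE (stringDensity U) := by
  let P : List Bool × (ℕ × ℕ × ℕ) → ℕ → Prop := fun x d =>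
    x.2.1 * 2 ^ d < enumCount E x.1.length (stringIndex x.1) d * (x.2.2.2 + 1) + x.2.2.1 * 2 ^ d
  have hP : ComputablePred fun y : (List Bool × (ℕ × ℕ × ℕ)) × ℕ => P y.1 y.2 := by
    have hσ : Computable fun y : (List Bool × (ℕ × ℕ × ℕ)) × ℕ => y.1.1 :=
      Computable.fst.comp Computable.fst
    have hp : Computable fun y : (List Bool × (ℕ × ℕ × ℕ)) × ℕ => y.1.2 :=
      Computable.snd.comp Computable.fst
    have hd : Computable fun y : (List Bool × (ℕ × ℕ × ℕ)) × ℕ => 2 ^ y.2 :=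
      Computable.snd.two_pow
    exact ComputablePred.nat_lt ((Computable.fst.comp hp).natMul hd)
      (((Computable.comp_three hE.computable_enumCount (Computable.list_length.comp hσ)
        (computable_stringIndex.comp hσ) Computable.snd).natMul
        ((Computable.snd.comp (Computable.snd.comp hp)).natAdd (.const 1))).natAdd
        ((Computable.fst.comp (Computable.snd.comp hp)).natMul hd))
  refine (ComputablePred.re_exists hP).of_eq ?_
  rintro ⟨σ, a, b, c⟩
  have hiff : ∀ d, P (σ, a, b, c) d ↔
      (ratOfCode (a, b, c) : ℝ) < (enumCount E σ.length (stringIndex σ) d : ℝ) / 2 ^ d := by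
    intro d
    rw [ratOfCode_cast, div_lt_div_iff₀ (by positivity) (by positivity), sub_mul,
      sub_lt_iff_lt_add]
    simp only [P]
    norm_cast
  simp only [hiff]
  constructor
  · rintro ⟨d, hd⟩
    exact hd.trans_le (hE.enumCount_le _ _ _)
  · intro h
    exact (hE.eventually_lt_enumCount h).exists

theorem mainTheorem9 (z : ℝ) (hz : z ∈ Set.Icc (0 : ℝ) 1) (hrandom : MLRandom z)
    (Z : ℕ → Bool) (hZ : IsBinaryExpansion Z z) :
    DyadicDensityOnePoint z ↔
      ∀ L : List Bool → ℝ, IsMartingale L → LeftCE L → ConvergesAlong L Z := by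
  have hd := hrandom.notMem_dyadicRationals
  have h0 : 0 ≤ z := hz.1
  have h1 : z < 1 := lt_of_le_of_ne hz.2 fun h => hd ⟨(0, 1), by simp [h]⟩
  constructor
  · intro hdens L hL hLre
    obtain ⟨l, hl⟩ := hrandom.tendsto_density h0 h1 hdens hL.isCellMeasure hLre.leftCECells
    refine ⟨l, hl.congr fun n => ?_⟩
    rw [hZ.cellString_eq h0 hd]
    field_simp
  · intro hconv C hC hzC
    obtain ⟨E, hE⟩ := hC.exists_enumeratesOpen
    have hmeas := hC.measurableSet
    obtain ⟨l, hl⟩ := hconv _ (isMartingale_stringDensity hmeas.compl) hE.leftCE_stringDensity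
    have hl' : Tendsto (fun n => 2 ^ n * cellVolume Cᶜ n (dyadicIndex z n)) atTop (𝓝 l) := by
      refine hl.congr fun n => ?_
      rw [stringDensity, length_initialSegment, hZ.stringIndex_eq h0 hd]
    -- A positive limit would keep the density of `Cᶜ` above `l / 2` at all small cells around `z`,
    -- which `frequently_small` forbids.
    have hl0 : l = 0 := by
      refine le_antisymm (not_lt.1 fun hpos => ?_) (ge_of_tendsto' hl' fun n =>
        mul_nonneg (by positivity) measureReal_nonneg)
      have hfreq := hE.frequently_small hrandom h0 h1 (fun h => h hzC) (half_pos hpos)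
      have hev := hl'.eventually (lt_mem_nhds (half_lt_self hpos))
      obtain ⟨n, hn1, hn2⟩ := (hfreq.and_eventually hev).exists
      exact absurd hn2 (not_lt.2 hn1)
    rw [lowerDyadicDensity_eq h0 hd]
    have hlim : Tendsto (fun n => 2 ^ n * volume.real (openCell n (dyadicIndex z n) ∩ C)) atTop
        (𝓝 1) := by
      have h2 := (hl0 ▸ hl').const_sub 1
      rw [sub_zero] at h2
      refine h2.congr fun n => ?_
      have h3 := real_volume_inter_compl n (dyadicIndex z n) hmeas
      have h4 : (2 : ℝ) ^ n * (2 ^ n)⁻¹ = 1 := mul_inv_cancel₀ (by positivity)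
      rw [← h3] at h4
      simp only [cellVolume]
      linarith
    have h5 := (ENNReal.continuous_ofReal.tendsto 1).comp hlim
    rw [ENNReal.ofReal_one] at h5
    exact h5.liminf_eq

end Main
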